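/- **Theorem (Local existence for the 1-D MHD model).** Let $\mathbb{T}=\mathbb{R}/2\pi\mathbb{Z}$, let $a,p,q\in\mathbb{R}$ be arbitrary and let $k\ge 1$ be an integer. Consider real-valued solutions of the Cauchy problem $$ \begin{cases} \omega^+_t + a\,u^-\,\omega^+_\theta = p\,\omega^+H\omega^- + q\,\omega^-H\omega^+,\\ \omega^-_t + a\,u^+\,\omega^-_\theta = p\,\omega^-H\omega^+ + q\,\omega^+H\omega^-, \end{cases} \qquad \omega^\pm(\cdot,0)=\omega_0^\pm , $$ where $Hf(\theta)=\frac1{2\pi}\,\mathrm{p.v.}\!\int_{-\pi}^{\pi}\cot\!\big(\tfrac{\theta-\vartheta}{2}\big)f(\vartheta)\,d\vartheta$ and $u^\pm$ is determined by $u^\pm_\theta=H\omega^\pm$, $u^\pm(0,t)=0$. Here $H^k=H^k(\mathbb{T})$ has the norm $\|f\|_{H^k}^2=\sum_{j\le k}\|\partial_\theta^j f\|_{L^2}^2$ (so $H^0=L^2$), and a solution on $[0,T)$, $0<T<\infty$, is a pair $\omega^\pm\in C([0,T);H^k)\cap \mathrm{Lip}([0,T);H^{k-1})$ that attains the initial data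 and satisfies the equations at every $t\in[0,T)$, with the time derivative taken in $L^2(\mathbb{T})$ (one-sided at $t=0$). For $0<S\le\infty$, a solution on $[0,S)$ in the local sense is a pair that is a solution on $[0,T)$ for every finite $0<T<S$. There is a constant $C>0$, depending only on $a,p,q,k$, such that for all $\omega_0^+,\omega_0^-\in H^k(\mathbb{T})$ the following hold. 1. For every $T>0$ with $T\,\big(\|\omega_0^+\|_{H^k}^2+\|\omega_0^-\|_{H^k}^2\big)^{1/2}<C$ there is a unique solution $\omega^\pm\in C([0,T);H^k)\cap \mathrm{Lip}([0,T);H^{k-1})$ on $[0,T)$ with initial data $\omega_0^\pm$. 2. There are $T^*\in(0,\infty]$ and a solution $\omega^\pm$ on $[0,T^*)$ in the local sense, with initial data $\omega_0^\pm$, which is maximal and unique: if $\tilde\omega^\pm$ is a solution on $[0,S)$ in the local sense with the same initial data, then $S\le T^*$ and $\tilde\omega^\pm=\omega^\pm$ on $[0,S)$. Moreover, either $$T^*=\infty\qquad\text{or}\qquad \limsup_{t\uparrow T^*}\big(\|\omega^+(t)\|_{H^k}+\|\omega^-(t)\|_{H^k}\big)=\infty .$$ -/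

import Mathlib

open MeasureTheory Set Filter Topology
open scoped Real

noncomputable section

namespace MHD

/-- The torus of length `2π`. -/
abbrev Torus : Type := AddCircle (2 * π)

instance factTwoPiPos : Fact (0 < 2 * π) := ⟨Real.two_pi_pos⟩

/-- Real-valued `L²` on the torus, with the Lebesgue measure of total mass `2π`. -/
abbrev L2 : Type := Lp ℝ 2 (volume : Measure Torus)

/-- `φ` is a smooth function on the torus with derivative `ψ`. -/
def IsTestPair (φ ψ : Torus → ℝ) : Prop :=
  ContDiff ℝ ((⊤ : ℕ∞) : WithTop ℕ∞) (fun θ : ℝ => φ (θ : Torus)) ∧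
    ∀ θ : ℝ, HasDerivAt (fun s : ℝ => φ (s : Torus)) (ψ (θ : Torus)) θ

/-- `g` is the weak derivative of `f` on the torus. -/
def HasWeakDeriv (f g : L2) : Prop :=
  ∀ φ ψ : Torus → ℝ, IsTestPair φ ψ → ∫ x, f x * ψ x = -∫ x, g x * φ x

theorem continuous_of_lift {φ : Torus → ℝ} (h : Continuous fun θ : ℝ => φ (θ : Torus)) :
    Continuous φ :=
  (QuotientAddGroup.isQuotientMap_mk (N := AddSubgroup.zmultiples (2 * π))).continuous_iff.2 h

theorem IsTestPair.continuous_left {φ ψ : Torus → ℝ} (h : IsTestPair φ ψ) : Continuous φ :=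
  continuous_of_lift h.1.continuous

theorem IsTestPair.continuous_right {φ ψ : Torus → ℝ} (h : IsTestPair φ ψ) : Continuous ψ := by
  refine continuous_of_lift ?_
  have e : (fun θ : ℝ => ψ (θ : Torus)) = deriv fun s : ℝ => φ (s : Torus) :=
    funext fun θ => (h.2 θ).deriv.symm
  rw [e]
  exact h.1.continuous_deriv (by simp)

theorem integrable_mul_continuous (f : L2) {φ : Torus → ℝ} (hφ : Continuous φ) :
    Integrable (fun x => f x * φ x) := by
  have h : MemLp φ 2 (volume : Measure Torus) := hφ.memLp_of_hasCompactSupport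
    (HasCompactSupport.of_compactSpace φ)
  exact (Lp.memLp f).integrable_mul h

theorem integral_add_mul (f g : L2) {φ : Torus → ℝ} (hφ : Continuous φ) :
    ∫ x, (f + g : L2) x * φ x = (∫ x, f x * φ x) + ∫ x, g x * φ x := by
  rw [← integral_add (integrable_mul_continuous f hφ) (integrable_mul_continuous g hφ)]
  refine integral_congr_ae ?_
  filter_upwards [Lp.coeFn_add f g] with x hx
  rw [hx, Pi.add_apply, add_mul]

theorem integral_smul_mul (c : ℝ) (f : L2) (φ : Torus → ℝ) :
    ∫ x, (c • f : L2) x * φ x = c * ∫ x, f x * φ x := by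
  rw [← integral_const_mul]
  refine integral_congr_ae ?_
  filter_upwards [Lp.coeFn_smul c f] with x hx
  rw [hx, Pi.smul_apply, smul_eq_mul, mul_assoc]

theorem HasWeakDeriv.zero : HasWeakDeriv 0 0 := by
  intro φ ψ _
  have h := fun χ : Torus → ℝ => integral_smul_mul 0 0 χ
  simp only [smul_zero, zero_mul] at h
  rw [h, h, neg_zero]

theorem HasWeakDeriv.add {f g f' g' : L2} (h : HasWeakDeriv f g) (h' : HasWeakDeriv f' g') :
    HasWeakDeriv (f + f') (g + g') := by
  intro φ ψ hφ
  rw [integral_add_mul _ _ hφ.continuous_right, integral_add_mul _ _ hφ.continuous_left,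
    h φ ψ hφ, h' φ ψ hφ]
  ring

theorem HasWeakDeriv.smul (c : ℝ) {f g : L2} (h : HasWeakDeriv f g) :
    HasWeakDeriv (c • f) (c • g) := by
  intro φ ψ hφ
  rw [integral_smul_mul, integral_smul_mul, h φ ψ hφ]
  ring

/-- The Sobolev space `H^k` of the torus. An element is the tuple `(f, f', …, f^(k))` of an `L²`
function and its weak derivatives up to order `k`, all in `L²`; the tuple is determined by `f`.
The norm is the one inherited from the `ℓ²` product: `‖f‖² = ∑_{j ≤ k} ‖f^(j)‖²_{L²}`. -/
def sobolev (k : ℕ) : Submodule ℝ (PiLp 2 fun _ : Fin (k + 1) => L2) where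
  carrier := {v | ∀ j : Fin k, HasWeakDeriv (v j.castSucc) (v j.succ)}
  zero_mem' := fun _ => HasWeakDeriv.zero
  add_mem' := fun h h' j => (h j).add (h' j)
  smul_mem' := fun c _ h j => (h j).smul c

/-- `H^k` as a normed space. -/
abbrev Hk (k : ℕ) : Type := sobolev k

namespace Hk

/-- The `j`-th weak derivative of `f ∈ H^k`, for `j ≤ k`. -/
def wderiv {k : ℕ} (f : Hk k) (j : ℕ) (hj : j ≤ k) : L2 := f.1 ⟨j, Nat.lt_succ_of_le hj⟩

/-- The underlying function of `f ∈ H^k`. -/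
def val {k : ℕ} (f : Hk k) : L2 := f.wderiv 0 (Nat.zero_le k)

/-- The inclusion `H^k ⊆ H^m` for `m ≤ k`. -/
def incl {k m : ℕ} (hm : m ≤ k) (f : Hk k) : Hk m :=
  ⟨WithLp.toLp 2 fun j => f.wderiv j (le_trans (Nat.le_of_lt_succ j.2) hm),
    fun j => f.2 ⟨j, lt_of_lt_of_le j.2 hm⟩⟩

end Hk

/-- The Hilbert transform integral on the torus with the arc of radius `ε` about `θ` removed. -/
def hilbertTrunc (f : Torus → ℝ) (ε θ : ℝ) : ℝ :=
  1 / (2 * π) * ∫ ϑ in {ϑ : ℝ | ϑ ∈ Ioc (-π) π ∧ ε < ‖((θ - ϑ : ℝ) : Torus)‖},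
    Real.cot ((θ - ϑ) / 2) * f (ϑ : Torus)

/-- `h = Hf`: at every `θ` the principal value integral converges, to `h θ`. -/
def IsHilbertTransform (f : Torus → ℝ) (h : ℝ → ℝ) : Prop :=
  ∀ θ : ℝ, Tendsto (fun ε => hilbertTrunc f ε θ) (𝓝[>] 0) (𝓝 (h θ))

/-- `u` is the velocity with `u_θ = h` and `u(0) = 0`. -/
def IsVelocity (h u : ℝ → ℝ) : Prop :=
  u 0 = 0 ∧ ∀ θ : ℝ, HasDerivAt u (h θ) θ

/-- `F + a u_w v_θ = p v Hw + q w Hv` almost everywhere, where `(u_w)_θ = Hw`, `u_w(0) = 0`.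
With `F = v_t`, this is the first equation of the system for `(v, w) = (ω⁺, ω⁻)` and the second
one for `(v, w) = (ω⁻, ω⁺)`. -/
def Equation (a p q : ℝ) {k : ℕ} (hk : 1 ≤ k) (v w : Hk k) (F : L2) : Prop :=
  ∃ Hv Hw u : ℝ → ℝ, IsHilbertTransform v.val Hv ∧ IsHilbertTransform w.val Hw ∧
    IsVelocity Hw u ∧
    ∀ᵐ θ : ℝ, F (θ : Torus) + a * u θ * v.wderiv 1 hk (θ : Torus) =
      p * v.val (θ : Torus) * Hw θ + q * w.val (θ : Torus) * Hv θ

/-- `ω ∈ C([0,T); H^k) ∩ Lip([0,T); H^{k-1})`. -/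
def InClass {k : ℕ} (T : ℝ) (ω : ℝ → Hk k) : Prop :=
  ContinuousOn ω (Ico 0 T) ∧
    ∃ K, LipschitzOnWith K (fun t => (ω t).incl (Nat.sub_le k 1)) (Ico 0 T)

/-- `(ω⁺, ω⁻)` is a solution on `[0,T)`, in the class `C([0,T); H^k) ∩ Lip([0,T); H^{k-1})`, of the
Cauchy problem with data `(ω₀⁺, ω₀⁻)`; the time derivatives are taken in `L²`. -/
structure IsSolution (a p q : ℝ) {k : ℕ} (hk : 1 ≤ k) (ω₀p ω₀m : Hk k) (T : ℝ)
    (ωp ωm : ℝ → Hk k) : Prop where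
  inClass_plus : InClass T ωp
  inClass_minus : InClass T ωm
  init_plus : ωp 0 = ω₀p
  init_minus : ωm 0 = ω₀m
  eq_plus : ∀ t ∈ Ico 0 T, ∃ F : L2,
    HasDerivWithinAt (fun s => (ωp s).val) F (Ico 0 T) t ∧ Equation a p q hk (ωp t) (ωm t) F
  eq_minus : ∀ t ∈ Ico 0 T, ∃ F : L2,
    HasDerivWithinAt (fun s => (ωm s).val) F (Ico 0 T) t ∧ Equation a p q hk (ωm t) (ωp t) F

/-- `(ω⁺, ω⁻)` is a solution on `[0,S)`, `S ≤ ∞`: it is one on every `[0,T)` with `T < S` finite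
(so it is continuous on `[0,S)` in `H^k` and locally Lipschitz there in `H^{k-1}`). -/
def IsSolutionUpTo (a p q : ℝ) {k : ℕ} (hk : 1 ≤ k) (ω₀p ω₀m : Hk k) (S : EReal)
    (ωp ωm : ℝ → Hk k) : Prop :=
  ∀ T : ℝ, 0 < T → (T : EReal) < S → IsSolution a p q hk ω₀p ω₀m T ωp ωm

end MHD

end

/-! The right-hand side is quadratic and loses a derivative only in the transport term `u v_θ`,
where integration by parts recovers it: `2⟪u y_θ, y⟫ = -⟪u_θ y, y⟫`, and `u_θ = Hw` is bounded
because `H¹` embeds in the continuous functions and `H` does not increase Sobolev norms. Applied to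
all derivatives up to order `k`, with Leibniz commutators that always leave a derivative on `u`,
this gives `⟪y, B y⟫ ≤ C‖y‖³` in `H^k` (`inner_trunc_rhs_le`). The norm is then controlled by a
Riccati equation up to a time proportional to `1 / ‖y₀‖`.

Existence is by the Galerkin method. Truncation to frequencies `|n| ≤ N` is symmetric in `L²` and in
`H^k`, so the truncated ODE keeps the energy bound. Differences of truncated solutions obey a
Gronwall estimate in `L²` (`abs_inner_rhs_self_le`) with an error of order `1/N`, so they converge
uniformly in `L²` (`IsApprox.dist_le`). Limits in `L²` of vectors in an `H^k` ball stay in that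
ball, so the limit is a bounded weak solution, Lipschitz in `H^{k-1}`. The same difference estimate
gives uniqueness (`IsWeakSol.eqOn`).

Strong continuity in `H^k` uses that `B` is even: `-y(s - t)` is a solution whenever `y(t)` is.
Restarting at time `s` in both directions gives `limsup ‖y(t)‖ ≤ ‖y(s)‖` as `t → s`, which together
with weak continuity is strong continuity (`IsWeakSol.continuousOn`); the time derivative then
exists in `L²`. As the guaranteed lifespan depends only on the norm, solutions glue to a maximal
one, and a bounded norm near a finite end time would allow an extension (`wellPosed`).

The analysis on the circle uses the real Hartley basis `cos nθ + sin nθ`, on which `d/dθ` and `H`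
are the reflection `n ↦ -n` with a multiplier. The principal value and the pointwise velocity are
identified with these multipliers in `isHilbertTransform_evH` and `isVelocity_vel`, and
`equation_iff` thereby reduces the system to the abstract equation. -/

noncomputable section

open scoped NNReal InnerProductSpace

namespace MHD

/-! ### Quadratic ordinary differential equations in Hilbert space. -/

section ODE

variable {E : Type*} [NormedAddCommGroup E]

/-- A bounded, globally Lipschitz autonomous vector field has integral curves on all of `[0,T]`. -/
theorem exists_integralCurve_of_lipschitz [NormedSpace ℝ E] [CompleteSpace E] {f : E → E} {M K : ℝ≥0}
    (hM : ∀ x, ‖f x‖ ≤ M) (hK : LipschitzWith K f) (x₀ : E) {T : ℝ} (hT : 0 ≤ T) :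
    ∃ y : ℝ → E, y 0 = x₀ ∧ ∀ t ∈ Icc 0 T, HasDerivWithinAt y (f (y t)) (Icc 0 T) t := by
  have h : IsPicardLindelof (fun _ => f) (tmin := 0) (tmax := T) ⟨0, left_mem_Icc.2 hT⟩ x₀
      (M * T.toNNReal) 0 M K := by
    refine IsPicardLindelof.of_time_independent (fun x _ => hM x) hK.lipschitzOnWith ?_
    simp [hT]
  exact h.exists_eq_forall_mem_Icc_hasDerivWithinAt₀

/-- Radial retraction onto the closed ball of radius `R`. -/
def radial [NormedSpace ℝ E] (R : ℝ) (x : E) : E := (R / max R ‖x‖) • x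

variable [NormedSpace ℝ E]

theorem radial_of_le {R : ℝ} (hR : 0 < R) {x : E} (hx : ‖x‖ ≤ R) : radial R x = x := by
  rw [radial, max_eq_left hx, div_self hR.ne', one_smul]

theorem norm_radial_le {R : ℝ} (hR : 0 < R) (x : E) : ‖radial R x‖ ≤ R := by
  have hm : 0 < max R ‖x‖ := lt_max_of_lt_left hR
  rw [radial, norm_smul, Real.norm_of_nonneg (by positivity), div_mul_eq_mul_div, div_le_iff₀ hm]
  exact mul_le_mul_of_nonneg_left (le_max_right _ _) hR.le

theorem norm_radial_le_norm {R : ℝ} (hR : 0 < R) (x : E) : ‖radial R x‖ ≤ ‖x‖ := by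
  have hm : 0 < max R ‖x‖ := lt_max_of_lt_left hR
  rw [radial, norm_smul, Real.norm_of_nonneg (by positivity)]
  exact mul_le_of_le_one_left (norm_nonneg _) (div_le_one_of_le₀ (le_max_left _ _) hm.le)

theorem lipschitzWith_radial {R : ℝ} (hR : 0 < R) : LipschitzWith 2 (radial R : E → E) := by
  refine LipschitzWith.of_dist_le_mul fun x y => ?_
  rw [dist_eq_norm, dist_eq_norm, radial, radial]
  have hx : 0 < max R ‖x‖ := lt_max_of_lt_left hR
  have hy : 0 < max R ‖y‖ := lt_max_of_lt_left hR
  set a := max R ‖x‖ with ha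
  set c := max R ‖y‖ with hc
  have hac : |c - a| ≤ ‖x - y‖ := by
    rw [ha, hc]
    refine (abs_max_sub_max_le_max _ _ _ _).trans ?_
    rw [sub_self, abs_zero, max_eq_right (abs_nonneg _), norm_sub_rev]
    exact abs_norm_sub_norm_le _ _
  -- The change of direction and the change of scaling factor are separated; each contributes at
  -- most `‖x - y‖`, whence the constant 2.
  have e : (R / a) • x - (R / c) • y = (R / a) • (x - y) + ((R / a) * ((c - a) / c)) • y := by
    rw [smul_sub, sub_add, ← sub_smul]
    congr 2
    field_simp
    ring
  have h1 : R / a ≤ 1 := div_le_one_of_le₀ (le_max_left _ _) hx.le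
  have h0 : 0 ≤ R / a := by positivity
  have hyc : ‖y‖ / c ≤ 1 := div_le_one_of_le₀ (le_max_right _ _) hy.le
  calc ‖(R / a) • x - (R / c) • y‖ ≤ ‖(R / a) • (x - y)‖ + ‖((R / a) * ((c - a) / c)) • y‖ := by
        rw [e]; exact norm_add_le _ _
    _ = R / a * ‖x - y‖ + R / a * (|c - a| * (‖y‖ / c)) := by
        rw [norm_smul, norm_smul, norm_mul, Real.norm_of_nonneg h0, norm_div, Real.norm_eq_abs,
          Real.norm_of_nonneg hy.le]
        ring
    _ ≤ 1 * ‖x - y‖ + 1 * (‖x - y‖ * 1) := by gcongr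
    _ = ((2 : ℝ≥0) : ℝ) * ‖x - y‖ := by push_cast; ring

end ODE

section Quadratic

variable {E : Type*} [NormedAddCommGroup E] [InnerProductSpace ℝ E]

theorem hasDerivWithinAt_norm_sq {f : ℝ → E} {f' : E} {s : Set ℝ} {t : ℝ}
    (h : HasDerivWithinAt f f' s t) :
    HasDerivWithinAt (fun r => ‖f r‖ ^ 2) (2 * ⟪f t, f'⟫_ℝ) s t := by
  have := h.norm_sq
  simpa using this

/-- Riccati comparison: a function with `(‖y‖²)' ≤ 2 C ‖y‖³` stays below the solution of
`h' = C' h²`, for `C' > C`. -/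
theorem norm_le_of_riccati {y y' : ℝ → E} {C C' m T : ℝ} (hCC : C < C')
    (hm : 0 < m) (h0 : ‖y 0‖ ≤ m) (hC' : 0 ≤ C') (hT : C' * m * T < 1)
    (hy : ∀ t ∈ Icc 0 T, HasDerivWithinAt y (y' t) (Icc 0 T) t)
    (hE : ∀ t ∈ Icc 0 T, ⟪y t, y' t⟫_ℝ ≤ C * ‖y t‖ ^ 3) :
    ∀ t ∈ Icc 0 T, ‖y t‖ ≤ m / (1 - C' * m * t) := by
  have hpos : ∀ t ∈ Icc 0 T, 0 < 1 - C' * m * t := fun t ht => by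
    have : C' * m * t ≤ C' * m * T := mul_le_mul_of_nonneg_left ht.2 (by positivity)
    linarith
  have hB : ∀ t ∈ Icc 0 T, HasDerivAt (fun t => (m / (1 - C' * m * t)) ^ 2)
      (2 * C' * (m / (1 - C' * m * t)) ^ 3) t := fun t ht => by
    have h1 : HasDerivAt (fun t => 1 - C' * m * t) (-(C' * m)) t := by
      simpa using ((hasDerivAt_id t).const_mul (C' * m)).const_sub 1
    have h2 := (((hasDerivAt_const t m).div h1 (hpos t ht).ne').pow 2)
    refine h2.congr_deriv ?_
    have := (hpos t ht).ne'
    norm_num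
    field_simp
  -- The comparison needs a strict inequality of derivatives only at times of contact, where it is
  -- supplied by `C < C'`.
  have key := image_le_of_deriv_right_lt_deriv_boundary' (f := fun t => ‖y t‖ ^ 2)
    (f' := fun t => 2 * ⟪y t, y' t⟫_ℝ) (a := 0) (b := T)
    (B := fun t => (m / (1 - C' * m * t)) ^ 2) (B' := fun t => 2 * C' * (m / (1 - C' * m * t)) ^ 3)
    (fun t ht => (hasDerivWithinAt_norm_sq (hy t ht)).continuousWithinAt)
    (fun t ht => (hasDerivWithinAt_norm_sq (hy t (Ico_subset_Icc_self ht))).mono_of_mem_nhdsWithin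
      (Icc_mem_nhdsGE_of_mem ht))
    (by simpa using pow_le_pow_left₀ (norm_nonneg _) h0 2)
    (fun t ht => (hB t ht).continuousAt.continuousWithinAt)
    (fun t ht => (hB t (Ico_subset_Icc_self ht)).hasDerivWithinAt)
    (fun t ht he => by
      have hp := hpos t (Ico_subset_Icc_self ht)
      have hq : 0 < m / (1 - C' * m * t) := by positivity
      have e : ‖y t‖ = m / (1 - C' * m * t) :=
        (pow_left_inj₀ (norm_nonneg _) hq.le two_ne_zero).1 he
      have h3 := hE t (Ico_subset_Icc_self ht)
      rw [e] at h3
      have : C * (m / (1 - C' * m * t)) ^ 3 < C' * (m / (1 - C' * m * t)) ^ 3 :=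
        mul_lt_mul_of_pos_right hCC (by positivity)
      show 2 * ⟪y t, y' t⟫_ℝ < 2 * C' * (m / (1 - C' * m * t)) ^ 3
      linarith)
  intro t ht
  have hp := hpos t ht
  exact (pow_le_pow_iff_left₀ (norm_nonneg _) (by positivity) two_ne_zero).1 (key ht)

/-- The quadratic equation `y' = q(y,y)` with the energy inequality `⟪q(x,x),x⟫ ≤ C‖x‖³` is solvable
up to times of order `1 / ‖y(0)‖`. -/
theorem exists_quadratic_ode [CompleteSpace E] (q : E →L[ℝ] E →L[ℝ] E) {C C' m T : ℝ} (hC : 0 ≤ C)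
    (hCC : C < C') (hq : ∀ x, ⟪x, q x x⟫_ℝ ≤ C * ‖x‖ ^ 3) (hm : 0 < m) (hT : 0 ≤ T)
    (hmT : C' * m * T < 1) {y₀ : E} (hy₀ : ‖y₀‖ ≤ m) :
    ∃ y : ℝ → E, y 0 = y₀ ∧ (∀ t ∈ Icc 0 T, HasDerivWithinAt y (q (y t) (y t)) (Icc 0 T) t) ∧
      ∀ t ∈ Icc 0 T, ‖y t‖ ≤ m / (1 - C' * m * t) := by
  have hC' : 0 ≤ C' := hC.trans hCC.le
  set R : ℝ := m / (1 - C' * m * T) with hRdef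
  have hR : 0 < R := div_pos hm (by linarith)
  -- Cutting off at radius `R` makes the field bounded and Lipschitz. `R` is the value of the
  -- Riccati bound at time `T`, so the solution never leaves the ball where the cut-off is inactive.
  set f : E → E := fun x => q (radial R x) (radial R x) with hf
  have hM : ∀ x, ‖f x‖ ≤ (‖q‖₊ * R.toNNReal * R.toNNReal : ℝ≥0) := fun x => by
    refine (q.le_opNorm₂ _ _).trans ?_
    push_cast
    have := norm_radial_le hR x
    rw [Real.coe_toNNReal _ hR.le]
    gcongr
  have hL : LipschitzWith (‖q‖₊ * (2 * R.toNNReal) * 2) f := by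
    refine LipschitzWith.of_dist_le_mul fun x y => ?_
    rw [dist_eq_norm, hf]
    have e : q (radial R x) (radial R x) - q (radial R y) (radial R y) =
        q (radial R x - radial R y) (radial R x) + q (radial R y) (radial R x - radial R y) := by
      simp only [map_sub, sub_apply]; abel
    have hxy := (lipschitzWith_radial hR).dist_le_mul x y
    rw [dist_eq_norm] at hxy
    simp only [e]
    refine (norm_add_le _ _).trans ((add_le_add (q.le_opNorm₂ _ _) (q.le_opNorm₂ _ _)).trans ?_)
    have h1 := norm_radial_le hR x
    have h2 := norm_radial_le hR y
    calc ‖q‖ * ‖radial R x - radial R y‖ * ‖radial R x‖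
          + ‖q‖ * ‖radial R y‖ * ‖radial R x - radial R y‖
        ≤ ‖q‖ * (↑(2 : ℝ≥0) * dist x y) * R + ‖q‖ * R * (↑(2 : ℝ≥0) * dist x y) := by gcongr
      _ = _ := by push_cast; rw [Real.coe_toNNReal _ hR.le]; ring
  obtain ⟨y, hy0, hy⟩ := exists_integralCurve_of_lipschitz hM hL y₀ hT
  -- The cut-off keeps the energy inequality, since `x` is a multiple of `radial R x` by a factor at
  -- least 1.
  have hE : ∀ x, ⟪x, f x⟫_ℝ ≤ C * ‖x‖ ^ 3 := fun x => by
    have hmx : 0 < max R ‖x‖ := lt_max_of_lt_left hR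
    have e : x = (max R ‖x‖ / R) • radial R x := by
      rw [radial, smul_smul, div_mul_div_comm, mul_comm R, div_self (by positivity), one_smul]
    have h1 := hq (radial R x)
    have h2 : ‖x‖ = max R ‖x‖ / R * ‖radial R x‖ := by
      conv_lhs => rw [e]
      rw [norm_smul, Real.norm_of_nonneg (by positivity)]
    have h3 := norm_radial_le_norm hR x
    have e1 : ⟪x, f x⟫_ℝ = max R ‖x‖ / R * ⟪radial R x, f x⟫_ℝ := by
      conv_lhs => rw [e]
      rw [real_inner_smul_left, ← e]
    calc ⟪x, f x⟫_ℝ = max R ‖x‖ / R * ⟪radial R x, f x⟫_ℝ := e1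
      _ ≤ max R ‖x‖ / R * (C * ‖radial R x‖ ^ 3) := by gcongr
      _ = C * ‖radial R x‖ ^ 2 * ‖x‖ := by
        conv_rhs => rw [h2]
        ring
      _ ≤ C * ‖x‖ ^ 2 * ‖x‖ := by gcongr
      _ = C * ‖x‖ ^ 3 := by ring
  have hb := norm_le_of_riccati hCC hm (by rwa [hy0]) hC' hmT hy fun t _ => hE (y t)
  refine ⟨y, hy0, fun t ht => ?_, hb⟩
  have hle : ‖y t‖ ≤ R := (hb t ht).trans (by
    rw [hRdef]
    have : C' * m * t ≤ C' * m * T := mul_le_mul_of_nonneg_left ht.2 (by positivity)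
    have h1 : 0 < 1 - C' * m * T := by linarith
    gcongr)
  have e : f (y t) = q (y t) (y t) := by rw [hf]; simp only [radial_of_le hR hle]
  exact e ▸ hy t ht

end Quadratic

/-! ### Passing to the limit in derivatives and in norm bounds. -/

section Limits

/-- A pointwise limit of functions on a compact interval whose derivatives converge uniformly to a
continuous function is differentiable, also at the end points. -/
theorem hasDerivWithinAt_of_tendstoUniformlyOn {g G : ℕ → ℝ → ℝ} {h H : ℝ → ℝ} {a b : ℝ}
    (hg : ∀ n, ∀ t ∈ Icc a b, HasDerivWithinAt (g n) (G n t) (Icc a b) t)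
    (hgh : ∀ t ∈ Icc a b, Tendsto (fun n => g n t) atTop (𝓝 (h t)))
    (hGH : TendstoUniformlyOn G H atTop (Icc a b)) (hH : ContinuousOn H (Icc a b))
    {t : ℝ} (ht : t ∈ Icc a b) : HasDerivWithinAt h (H t) (Icc a b) t := by
  rw [hasDerivWithinAt_iff_isLittleO, Asymptotics.isLittleO_iff]
  intro c hc
  obtain ⟨δ, hδ, hδH⟩ := Metric.continuousOn_iff.1 hH t ht (c / 2) (by positivity)
  rw [eventually_nhdsWithin_iff]
  filter_upwards [Metric.ball_mem_nhds t hδ] with s hs hsI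
  -- The radius `δ` does not depend on `n`, so this mean value bound survives the pointwise limit.
  have key : ∀ᶠ n in atTop, ‖g n s - g n t - (s - t) • H t‖ ≤ c * ‖s - t‖ := by
    filter_upwards [Metric.tendstoUniformlyOn_iff.1 hGH (c / 2) (by positivity)] with n hn
    have hconv : Convex ℝ (Icc a b ∩ Metric.ball t δ) := (convex_Icc a b).inter (convex_ball t δ)
    have hd : ∀ r ∈ Icc a b ∩ Metric.ball t δ, HasDerivWithinAt (fun r => g n r - r * H t)
        (G n r - H t) (Icc a b ∩ Metric.ball t δ) r := fun r hr => by
      have h1 := ((hg n r hr.1).mono (inter_subset_left (t := Metric.ball t δ)))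
      exact (h1.sub ((hasDerivWithinAt_id r _).mul_const (H t))).congr_deriv (by rw [one_mul])
    have hbd : ∀ r ∈ Icc a b ∩ Metric.ball t δ, ‖G n r - H t‖ ≤ c := fun r hr => by
      have h1 := hn r hr.1
      have h2 := hδH r hr.1 hr.2
      rw [dist_comm, dist_eq_norm] at h1
      rw [dist_eq_norm] at h2
      calc ‖G n r - H t‖ ≤ ‖G n r - H r‖ + ‖H r - H t‖ := norm_sub_le_norm_sub_add_norm_sub _ _ _
        _ ≤ c := by linarith
    have := hconv.norm_image_sub_le_of_norm_hasDerivWithin_le hd hbd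
      ⟨ht, Metric.mem_ball_self hδ⟩ ⟨hsI, hs⟩
    rwa [show g n s - s * H t - (g n t - t * H t) = g n s - g n t - (s - t) • H t by
      rw [smul_eq_mul]; ring] at this
  refine le_of_tendsto ?_ key
  exact ((((hgh s hsI).sub (hgh t ht)).sub_const _).norm)

variable {Y L : Type*} [NormedAddCommGroup Y] [InnerProductSpace ℝ Y] [CompleteSpace Y]
  [NormedAddCommGroup L] [InnerProductSpace ℝ L] [CompleteSpace L]

/-- The image of a closed ball of a Hilbert space under a continuous linear map is closed under
limits. -/
theorem exists_norm_le_of_tendsto (ι : Y →L[ℝ] L) {y : ℕ → Y} {R : ℝ} (hy : ∀ n, ‖y n‖ ≤ R) {x : L}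
    (hx : Tendsto (fun n => ι (y n)) atTop (𝓝 x)) : ∃ z : Y, ι z = x ∧ ‖z‖ ≤ R := by
  let φ : ℕ → WeakDual ℝ Y := fun n =>
    StrongDual.toWeakDual (InnerProductSpace.toDual ℝ Y (y n))
  -- Banach–Alaoglu, used along an ultrafilter so that no weakly convergent subsequence has to be
  -- extracted.
  have hK : IsCompact (WeakDual.toStrongDual ⁻¹' Metric.closedBall (0 : StrongDual ℝ Y) R) :=
    WeakDual.isCompact_closedBall _ _
  let U : Ultrafilter ℕ := Filter.hyperfilter ℕ
  have hU : (U : Filter ℕ) ≤ atTop := Nat.hyperfilter_le_atTop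
  obtain ⟨ψ, hψ, hlim⟩ := hK.ultrafilter_le_nhds (U.map φ) (by
    rw [le_principal_iff]
    exact Filter.mem_map.2 (univ_mem' fun n => by simpa [φ] using hy n))
  have hlim' : Tendsto φ U (𝓝 ψ) := hlim
  let z : Y := (InnerProductSpace.toDual ℝ Y).symm (WeakDual.toStrongDual ψ)
  have hz : ∀ w, Tendsto (fun n => ⟪y n, w⟫_ℝ) U (𝓝 ⟪z, w⟫_ℝ) := fun w => by
    have h1 := ((WeakDual.eval_continuous w).tendsto ψ).comp hlim'
    have h2 : ⟪z, w⟫_ℝ = ψ w := InnerProductSpace.toDual_symm_apply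
    rw [h2]
    exact h1
  refine ⟨z, ?_, ?_⟩
  · refine ext_inner_right ℝ fun l => ?_
    have h1 : Tendsto (fun n => ⟪ι (y n), l⟫_ℝ) U (𝓝 ⟪ι z, l⟫_ℝ) := by
      -- Testing with the adjoint turns weak convergence in `Y` into weak convergence of the images.
      have := hz (ContinuousLinearMap.adjoint ι l)
      simpa only [ContinuousLinearMap.adjoint_inner_right] using this
    exact tendsto_nhds_unique h1 ((hx.mono_left hU).inner tendsto_const_nhds)
  · have : ‖z‖ = ‖WeakDual.toStrongDual ψ‖ := LinearIsometryEquiv.norm_map _ _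
    rw [this]
    simpa using hψ

end Limits

/-! ### The abstract Galerkin scheme: estimates, uniqueness and weak solutions. -/

/-- A quadratic evolution equation `ι y' = b(y, ι y)` in Hilbert spaces `Y ⊆ Z ⊆ L`, together with
spectral projections `P N` and the a priori estimates which make the Galerkin scheme converge. -/
structure Galerkin (Y Z L : Type*) [NormedAddCommGroup Y] [InnerProductSpace ℝ Y]
    [NormedAddCommGroup Z] [InnerProductSpace ℝ Z]
    [NormedAddCommGroup L] [InnerProductSpace ℝ L] where
  ι : Y →L[ℝ] L
  j : Y →L[ℝ] Z
  κ : Z →L[ℝ] L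
  κ_j : ∀ y, κ (j y) = ι y
  κ_inj : Function.Injective κ
  ι_inj : Function.Injective ι
  dense : DenseRange ι
  -- Only the first slot loses a derivative; the second needs no regularity beyond `L`.
  b : Y →L[ℝ] L →L[ℝ] L
  P : ℕ → L →L[ℝ] Y
  P_symm : ∀ N x x', ⟪ι (P N x), x'⟫_ℝ = ⟪x, ι (P N x')⟫_ℝ
  P_symm' : ∀ N y y', ⟪P N (ι y), y'⟫_ℝ = ⟪y, P N (ι y')⟫_ℝ
  P_idem : ∀ N x, P N (ι (P N x)) = P N x
  ε : ℕ → ℝ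
  ε_tendsto : Tendsto ε atTop (𝓝 0)
  P_approx : ∀ N y, ‖ι (P N (ι y)) - ι y‖ ≤ ε N * ‖y‖
  P_tendsto : ∀ y, Tendsto (fun N => P N (ι y)) atTop (𝓝 y)
  C : ℝ
  C_pos : 0 < C
  -- The roles differ: `b_self` controls differences of solutions in `L`, `b_weak` makes the
  -- right-hand side continuous from `L` to the dual of `Y` on bounded sets of `Y`, `b_energy`
  -- bounds the `Y` norm, and `b_smooth` bounds the speed in `Z`. The last two are asked of
  -- truncated vectors only.
  b_self : ∀ d y, |⟪b d (ι y), ι d⟫_ℝ| ≤ C * ‖y‖ * ‖ι d‖ ^ 2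
  b_weak : ∀ y z φ, |⟪b y (ι z), ι φ⟫_ℝ| ≤ C * ‖φ‖ * ‖ι y‖ * ‖ι z‖
  b_energy : ∀ N y, P N (ι y) = y → ⟪y, P N (b y (ι y))⟫_ℝ ≤ C * ‖y‖ ^ 3
  b_smooth : ∀ N y, P N (ι y) = y → ‖j (P N (b y (ι y)))‖ ≤ C * ‖y‖ ^ 2

section Gronwall

theorem le_of_deriv_le_linear {g g' : ℝ → ℝ} {K δ ε T : ℝ} (hK : 0 < K) (hδ : 0 ≤ δ) (hε : 0 ≤ ε)
    (hg : ∀ t ∈ Icc 0 T, HasDerivWithinAt g (g' t) (Icc 0 T) t) (h0 : g 0 ≤ δ)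
    (hb : ∀ t ∈ Icc 0 T, g' t ≤ K * g t + ε) :
    ∀ t ∈ Icc 0 T, g t ≤ (δ + ε / K) * Real.exp (K * T) := by
  intro t ht
  have h1 := le_gronwallBound_of_liminf_deriv_right_le (f := g) (f' := g') (δ := δ) (K := K) (ε := ε)
    (a := 0) (b := T) (fun t ht => (hg t ht).continuousWithinAt)
    (fun t ht r hr => (((hg t (Ico_subset_Icc_self ht)).mono_of_mem_nhdsWithin
      (Icc_mem_nhdsGE_of_mem ht)).liminf_right_slope_le hr))
    h0 (fun t ht => hb t (Ico_subset_Icc_self ht)) t ht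
  refine h1.trans ?_
  rw [gronwallBound_of_K_ne_0 hK.ne', sub_zero]
  have h2 : Real.exp (K * t) ≤ Real.exp (K * T) :=
    Real.exp_le_exp.2 (mul_le_mul_of_nonneg_left ht.2 hK.le)
  have h3 : 0 ≤ ε / K := by positivity
  calc δ * Real.exp (K * t) + ε / K * (Real.exp (K * t) - 1)
      ≤ δ * Real.exp (K * T) + ε / K * Real.exp (K * T) := by
        gcongr
        linarith
    _ = _ := by ring

variable {L : Type*} [NormedAddCommGroup L] [InnerProductSpace ℝ L]

/-- The squared norm of a Lipschitz curve is differentiable where the curve is weakly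
differentiable in its own direction. -/
theorem hasDerivWithinAt_norm_sq_of_weak {f : ℝ → L} {I : Set ℝ} {K : ℝ≥0}
    (hf : LipschitzOnWith K f I) {t c : ℝ} (ht : t ∈ I)
    (hc : HasDerivWithinAt (fun s => ⟪f s, f t⟫_ℝ) c I t) :
    HasDerivWithinAt (fun s => ‖f s‖ ^ 2) (2 * c) I t := by
  -- The Lipschitz bound makes this square quadratically small, so in the expansion of `‖f s‖²`
  -- about `f t` only the pairing with the fixed vector `f t` contributes.
  have h1 : HasDerivWithinAt (fun s => ‖f s - f t‖ ^ 2) 0 I t := by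
    rw [hasDerivWithinAt_iff_isLittleO]
    have hO : (fun s => ‖f s - f t‖ ^ 2 - ‖f t - f t‖ ^ 2 - (s - t) • (0 : ℝ)) =O[𝓝[I] t]
        fun s => (s - t) ^ 2 := by
      refine Asymptotics.IsBigO.of_bound ((K : ℝ) ^ 2) ?_
      filter_upwards [self_mem_nhdsWithin] with s hs
      have := hf.dist_le_mul s hs t ht
      rw [dist_eq_norm, dist_eq_norm] at this
      simp only [sub_self, norm_zero, ne_eq, OfNat.ofNat_ne_zero, not_false_eq_true, zero_pow,
        sub_zero, smul_zero, norm_pow, norm_norm]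
      calc ‖f s - f t‖ ^ 2 ≤ (K * ‖s - t‖) ^ 2 := by gcongr
        _ = _ := by ring
    refine hO.trans_isLittleO ?_
    have h2 : (fun s : ℝ => s - t) =o[𝓝[I] t] fun _ => (1 : ℝ) := by
      rw [Asymptotics.isLittleO_one_iff]
      have : ContinuousWithinAt (fun s : ℝ => s - t) I t := by fun_prop
      simpa [ContinuousWithinAt] using this
    have := h2.mul_isBigO (Asymptotics.isBigO_refl (fun s : ℝ => s - t) (𝓝[I] t))
    simpa [pow_two] using this
  have h2 := (h1.add (hc.const_mul 2)).sub_const (‖f t‖ ^ 2)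
  have e : (fun s => ‖f s‖ ^ 2) = fun s =>
      (‖f s - f t‖ ^ 2 + 2 * ⟪f s, f t⟫_ℝ) - ‖f t‖ ^ 2 := by
    funext s
    rw [norm_sub_sq_real]
    ring
  rw [e]
  exact h2.congr_deriv (by ring)

end Gronwall

namespace Galerkin

variable {Y Z L : Type*} [NormedAddCommGroup Y] [InnerProductSpace ℝ Y]
    [NormedAddCommGroup Z] [InnerProductSpace ℝ Z]
    [NormedAddCommGroup L] [InnerProductSpace ℝ L] (G : Galerkin Y Z L)

/-- The right-hand side of the equation. -/
def B (y : Y) : L := G.b y (G.ι y)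

theorem B_neg (y : Y) : G.B (-y) = G.B y := by simp [B]

theorem norm_P_le (N : ℕ) (y : Y) : ‖G.P N (G.ι y)‖ ≤ ‖y‖ := by
  have h1 : ‖G.P N (G.ι y)‖ ^ 2 = ⟪y, G.P N (G.ι y)⟫_ℝ := by
    rw [← real_inner_self_eq_norm_sq, G.P_symm', G.P_idem]
  have h2 := real_inner_le_norm y (G.P N (G.ι y))
  rcases eq_or_lt_of_le (norm_nonneg (G.P N (G.ι y))) with h | h
  · rw [← h]; exact norm_nonneg _
  · exact le_of_mul_le_mul_right (by rw [← sq, h1]; exact h2) h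

/-- The split is chosen so that, paired with `ι (x - y)`, the first term falls under the
cancellation `b_self`, while the second has the difference in the slot that costs only its `L` norm.
-/
theorem B_sub (x y : Y) : G.B x - G.B y = G.b (x - y) (G.ι x) + G.b y (G.ι (x - y)) := by
  simp only [B, map_sub, sub_apply]
  abel

theorem norm_B_le (y : Y) : ‖G.B y‖ ≤ ‖G.b‖ * ‖G.ι‖ * ‖y‖ ^ 2 := by
  have h1 := G.b.le_opNorm₂ y (G.ι y)
  have h2 := G.ι.le_opNorm y
  calc ‖G.B y‖ ≤ ‖G.b‖ * ‖y‖ * (‖G.ι‖ * ‖y‖) := h1.trans (by gcongr)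
    _ = _ := by ring

theorem continuous_B : Continuous G.B :=
  G.b.continuous.clm_apply G.ι.continuous

theorem inner_B_sub_le {x y : Y} {R : ℝ} (hx : ‖x‖ ≤ R) (hy : ‖y‖ ≤ R) :
    ⟪G.B x - G.B y, G.ι (x - y)⟫_ℝ ≤ (G.C + ‖G.b‖) * R * ‖G.ι (x - y)‖ ^ 2 := by
  rw [B_sub, inner_add_left]
  have h1 := (le_abs_self _).trans (G.b_self (x - y) x)
  have h2 := (real_inner_le_norm (G.b y (G.ι (x - y))) (G.ι (x - y))).trans
    (mul_le_mul_of_nonneg_right (G.b.le_opNorm₂ y _) (norm_nonneg _))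
  have hC := G.C_pos.le
  calc _ ≤ G.C * ‖x‖ * ‖G.ι (x - y)‖ ^ 2 + ‖G.b‖ * ‖y‖ * ‖G.ι (x - y)‖ * ‖G.ι (x - y)‖ :=
        add_le_add h1 h2
    _ ≤ G.C * R * ‖G.ι (x - y)‖ ^ 2 + ‖G.b‖ * R * ‖G.ι (x - y)‖ * ‖G.ι (x - y)‖ := by gcongr
    _ = _ := by ring

/-- Against a fixed smooth test vector, convergence in `L` with a bound in `Y` is enough to pass to
the limit in the nonlinearity. -/
theorem abs_inner_B_sub_le {x y : Y} {R : ℝ} (hx : ‖x‖ ≤ R) (hy : ‖y‖ ≤ R) (φ : Y) :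
    |⟪G.B x - G.B y, G.ι φ⟫_ℝ| ≤ 2 * G.C * ‖φ‖ * (‖G.ι‖ * R) * ‖G.ι x - G.ι y‖ := by
  rw [B_sub, inner_add_left, ← map_sub]
  have hC := G.C_pos.le
  have h1 := G.b_weak (x - y) x φ
  have h2 := G.b_weak y (x - y) φ
  have h3 := (G.ι.le_opNorm x).trans (mul_le_mul_of_nonneg_left hx (norm_nonneg _))
  have h4 := (G.ι.le_opNorm y).trans (mul_le_mul_of_nonneg_left hy (norm_nonneg _))
  calc _ ≤ G.C * ‖φ‖ * ‖G.ι (x - y)‖ * ‖G.ι x‖ + G.C * ‖φ‖ * ‖G.ι y‖ * ‖G.ι (x - y)‖ :=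
        (abs_add_le _ _).trans (add_le_add h1 h2)
    _ ≤ G.C * ‖φ‖ * ‖G.ι (x - y)‖ * (‖G.ι‖ * R) + G.C * ‖φ‖ * (‖G.ι‖ * R) * ‖G.ι (x - y)‖ := by
        gcongr
    _ = _ := by ring

/-- Weak solutions on `[0,T]`: bounded in `Y`, Lipschitz in `L`. -/
structure IsWeakSol (T : ℝ) (y : ℝ → Y) : Prop where
  bdd : ∃ R, ∀ t ∈ Icc 0 T, ‖y t‖ ≤ R
  lip : ∃ K : ℝ≥0, LipschitzOnWith K (fun t => G.ι (y t)) (Icc 0 T)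
  deriv : ∀ t ∈ Icc 0 T, ∀ φ, HasDerivWithinAt (fun s => ⟪G.ι (y s), G.ι φ⟫_ℝ)
    ⟪G.B (y t), G.ι φ⟫_ℝ (Icc 0 T) t

variable {G}

/-- Gronwall for `‖ι (y - z)‖²`. The equation is known only in weak form, but at each time `t` it
may be tested with the difference frozen at `t`, thanks to the Lipschitz bound in `L`. -/
theorem IsWeakSol.eqOn {T : ℝ} {y z : ℝ → Y} (hy : G.IsWeakSol T y) (hz : G.IsWeakSol T z)
    (h0 : y 0 = z 0) : EqOn y z (Icc 0 T) := by
  obtain ⟨R₁, hR₁⟩ := hy.bdd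
  obtain ⟨R₂, hR₂⟩ := hz.bdd
  obtain ⟨K₁, hK₁⟩ := hy.lip
  obtain ⟨K₂, hK₂⟩ := hz.lip
  have hR : ∃ R, 0 < R ∧ R₁ ≤ R ∧ R₂ ≤ R :=
    ⟨max 1 (max R₁ R₂), by positivity, by simp, by simp⟩
  obtain ⟨R, hR, h1, h2⟩ := hR
  have hC := G.C_pos
  have hd : ∀ t ∈ Icc 0 T, HasDerivWithinAt (fun s => ‖G.ι (y s - z s)‖ ^ 2)
      (2 * ⟪G.B (y t) - G.B (z t), G.ι (y t - z t)⟫_ℝ) (Icc 0 T) t := fun t ht => by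
    have hlip : LipschitzOnWith (K₁ + K₂) (fun s => G.ι (y s - z s)) (Icc 0 T) := by
      simpa only [map_sub] using hK₁.sub hK₂
    refine hasDerivWithinAt_norm_sq_of_weak hlip ht ?_
    have := (hy.deriv t ht (y t - z t)).sub (hz.deriv t ht (y t - z t))
    rw [← inner_sub_left] at this
    refine this.congr_of_mem (fun s _ => ?_) ht
    rw [map_sub, inner_sub_left]
    rfl
  have hg := le_of_deriv_le_linear (K := 2 * ((G.C + ‖G.b‖) * R)) (δ := 0) (ε := 0) (by positivity)
    le_rfl le_rfl hd (by simp [h0]) fun t ht => by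
      have := G.inner_B_sub_le ((hR₁ t ht).trans h1) ((hR₂ t ht).trans h2)
      linarith
  intro t ht
  have h3 := hg t ht
  have h4 : ‖G.ι (y t - z t)‖ = 0 := by
    have : ‖G.ι (y t - z t)‖ ^ 2 ≤ 0 := by simpa using h3
    exact pow_eq_zero_iff two_ne_zero |>.1 (le_antisymm this (sq_nonneg _))
  have h5 : G.ι (y t - z t) = G.ι 0 := by rw [map_zero]; exact norm_eq_zero.1 h4
  exact sub_eq_zero.1 (G.ι_inj h5)

theorem IsWeakSol.shift {T s r : ℝ} {y : ℝ → Y} (hy : G.IsWeakSol T y) (hs : 0 ≤ s)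
    (hsr : s + r ≤ T) : G.IsWeakSol r fun t => y (s + t) := by
  have hmap : MapsTo (fun t => s + t) (Icc 0 r) (Icc 0 T) := fun t ht =>
    ⟨add_nonneg hs ht.1, (add_le_add_right ht.2 s).trans hsr⟩
  obtain ⟨R, hR⟩ := hy.bdd
  obtain ⟨K, hK⟩ := hy.lip
  refine ⟨⟨R, fun t ht => hR _ (hmap ht)⟩, ⟨K, ?_⟩, fun t ht φ => ?_⟩
  · refine LipschitzOnWith.of_dist_le_mul fun u hu v hv => ?_
    simpa using hK.dist_le_mul _ (hmap hu) _ (hmap hv)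
  · have h1 := hy.deriv (s + t) (hmap ht) φ
    have h2 : HasDerivWithinAt (fun t => s + t) 1 (Icc 0 r) t :=
      (hasDerivWithinAt_id t _).const_add s
    have := h1.scomp t h2 hmap
    simpa [Function.comp_def] using this

/-- Reversing time and changing the sign of `y` each flip the derivative, and the quadratic
right-hand side is even. -/
theorem IsWeakSol.reverse {T s : ℝ} {y : ℝ → Y} (hy : G.IsWeakSol T y) (hs : s ≤ T) :
    G.IsWeakSol s fun t => -y (s - t) := by
  have hmap : MapsTo (fun t => s - t) (Icc 0 s) (Icc 0 T) := fun t ht =>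
    ⟨sub_nonneg.2 ht.2, (sub_le_self _ ht.1).trans hs⟩
  obtain ⟨R, hR⟩ := hy.bdd
  obtain ⟨K, hK⟩ := hy.lip
  refine ⟨⟨R, fun t ht => by simpa using hR _ (hmap ht)⟩, ⟨K, ?_⟩, fun t ht φ => ?_⟩
  · refine LipschitzOnWith.of_dist_le_mul fun u hu v hv => ?_
    have := hK.dist_le_mul _ (hmap hu) _ (hmap hv)
    rw [dist_sub_left] at this
    simpa only [map_neg, dist_neg_neg] using this
  · have h1 := hy.deriv (s - t) (hmap ht) φ
    have h2 : HasDerivWithinAt (fun t => s - t) (-1) (Icc 0 s) t :=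
      (hasDerivWithinAt_id t _).const_sub s
    have := (h1.scomp t h2 hmap).neg
    simp only [map_neg, inner_neg_left, B_neg]
    exact this.congr_deriv (by simp)

end Galerkin

theorem uniformCauchySeqOn_of_dist_sq_le {L : Type*} [PseudoMetricSpace L] {f : ℕ → ℝ → L}
    {I : Set ℝ} {A : ℝ} {ε : ℕ → ℝ} (hε : Tendsto ε atTop (𝓝 0))
    (hf : ∀ N M, ∀ t ∈ I, dist (f N t) (f M t) ^ 2 ≤ A * (ε N + ε M)) :
    UniformCauchySeqOn f atTop I := by
  rw [Metric.uniformCauchySeqOn_iff]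
  intro r hr
  have h1 : Tendsto (fun N => A * ε N) atTop (𝓝 0) := by simpa using hε.const_mul A
  obtain ⟨N₀, hN₀⟩ := eventually_atTop.1 (h1.eventually_lt_const (show 0 < r ^ 2 / 2 by positivity))
  refine ⟨N₀, fun m hm n hn t ht => ?_⟩
  have h2 := hf m n t ht
  have h3 := hN₀ m hm
  have h4 := hN₀ n hn
  exact lt_of_pow_lt_pow_left₀ 2 hr.le (by linarith)

namespace Galerkin

variable {Y Z L : Type*} [NormedAddCommGroup Y] [InnerProductSpace ℝ Y]
    [NormedAddCommGroup Z] [InnerProductSpace ℝ Z]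
    [NormedAddCommGroup L] [InnerProductSpace ℝ L] (G : Galerkin Y Z L)

/-- Solutions of the truncated equation. -/
structure IsApprox (N : ℕ) (T : ℝ) (x : ℝ → Y) : Prop where
  proj : ∀ t ∈ Icc 0 T, G.P N (G.ι (x t)) = x t
  deriv : ∀ t ∈ Icc 0 T, HasDerivWithinAt x (G.P N (G.B (x t))) (Icc 0 T) t

/-- `P N` maps `L` into `Y`, so the truncated equation is an ODE with a bounded quadratic field. The
arguments are projected as well, because `b_energy` is available for projected vectors only;
projecting the resulting curve solves the truncated equation. -/
theorem exists_isApprox [CompleteSpace Y] (N : ℕ) {m T : ℝ} (hm : 0 < m) (hT : 0 ≤ T)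
    (hmT : 2 * G.C * m * T < 1) {y₀ : Y} (hy₀ : ‖y₀‖ ≤ m) :
    ∃ x : ℝ → Y, x 0 = G.P N (G.ι y₀) ∧ G.IsApprox N T x ∧
      ∀ t ∈ Icc 0 T, ‖x t‖ ≤ m / (1 - 2 * G.C * m * t) := by
  set A : Y →L[ℝ] Y := (G.P N).comp G.ι with hA
  have hAA : ∀ y, A (A y) = A y := fun y => G.P_idem N (G.ι y)
  let q : Y →L[ℝ] Y →L[ℝ] Y :=
    (ContinuousLinearMap.compL ℝ Y L Y (G.P N)).comp (G.b.bilinearComp A (G.ι.comp A))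
  have hq : ∀ y z, q y z = G.P N (G.b (A y) (G.ι (A z))) := fun y z => rfl
  have hE : ∀ y, ⟪y, q y y⟫_ℝ ≤ G.C * ‖y‖ ^ 3 := fun y => by
    have h1 : ⟪y, q y y⟫_ℝ = ⟪A y, G.P N (G.b (A y) (G.ι (A y)))⟫_ℝ := by
      rw [hq]
      conv_lhs => rw [← G.P_idem]
      exact (G.P_symm' N y _).symm
    rw [h1]
    refine (G.b_energy N _ (hAA y)).trans ?_
    have := G.C_pos.le
    have := G.norm_P_le N y
    gcongr
    exact this
  have hC := G.C_pos
  obtain ⟨y, hy0, hy, hyb⟩ := exists_quadratic_ode q (C := G.C) (C' := 2 * G.C) hC.le (by linarith) hE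
    hm hT hmT hy₀
  refine ⟨fun t => A (y t), by simp [hy0, hA], ⟨fun t _ => hAA _, fun t ht => ?_⟩,
    fun t ht => (G.norm_P_le N _).trans (hyb t ht)⟩
  have h1 := A.hasFDerivAt.comp_hasDerivWithinAt t (hy t ht)
  refine h1.congr_deriv ?_
  exact G.P_idem _ _

variable {G}

theorem IsApprox.norm_sub_le {N : ℕ} {T R : ℝ} {x : ℝ → Y} (hx : G.IsApprox N T x)
    (hR : ∀ t ∈ Icc 0 T, ‖x t‖ ≤ R) {s t : ℝ} (hs : s ∈ Icc 0 T) (ht : t ∈ Icc 0 T) :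
    ‖G.j (x t - x s)‖ ≤ G.C * R ^ 2 * |t - s| := by
  rw [map_sub]
  refine (convex_Icc 0 T).norm_image_sub_le_of_norm_hasDerivWithin_le (f := fun t => G.j (x t))
    (fun r hr => G.j.hasFDerivAt.comp_hasDerivWithinAt r (hx.deriv r hr)) (fun r hr => ?_) hs ht
  have h1 := G.b_smooth N _ (hx.proj r hr)
  have hC := G.C_pos.le
  have h2 := hR r hr
  exact h1.trans (by gcongr)

/-- Gronwall in `L`. The two truncations disagree through the initial data and through the projected
right-hand sides, and each discrepancy is of order `ε N + ε M` because everything is bounded in `Y`.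
-/
theorem IsApprox.dist_le {N M : ℕ} {T R : ℝ} {x x' : ℝ → Y} (hx : G.IsApprox N T x)
    (hx' : G.IsApprox M T x') (hR : ∀ t ∈ Icc 0 T, ‖x t‖ ≤ R) (hR' : ∀ t ∈ Icc 0 T, ‖x' t‖ ≤ R)
    {y₀ : Y} (h0 : x 0 = G.P N (G.ι y₀)) (h0' : x' 0 = G.P M (G.ι y₀)) (hR0 : 0 < R)
    (hy₀ : ‖y₀‖ ≤ R) {t : ℝ} (ht : t ∈ Icc 0 T) :
    dist (G.ι (x t)) (G.ι (x' t)) ^ 2 ≤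
      (2 * ‖G.ι‖ * R ^ 2 + 4 * (‖G.b‖ * ‖G.ι‖ * R ^ 3) / (2 * ((G.C + ‖G.b‖) * R))) *
        Real.exp (2 * ((G.C + ‖G.b‖) * R) * T) * (|G.ε N| + |G.ε M|) := by
  have hC := G.C_pos
  set η := |G.ε N| + |G.ε M| with hη
  have hη0 : 0 ≤ η := by positivity
  have happ : ∀ (N : ℕ) (y : Y), ‖G.ι (G.P N (G.ι y)) - G.ι y‖ ≤ |G.ε N| * ‖y‖ := fun N y =>
    (G.P_approx N y).trans (mul_le_mul_of_nonneg_right (le_abs_self _) (norm_nonneg _))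
  have hd : ∀ t ∈ Icc 0 T, HasDerivWithinAt (fun s => ‖G.ι (x s - x' s)‖ ^ 2)
      (2 * ⟪G.ι (x t - x' t), G.ι (G.P N (G.B (x t)) - G.P M (G.B (x' t)))⟫_ℝ) (Icc 0 T) t :=
    fun t ht => hasDerivWithinAt_norm_sq
      (G.ι.hasFDerivAt.comp_hasDerivWithinAt t ((hx.deriv t ht).sub (hx'.deriv t ht)))
  have herr : ∀ (N : ℕ) (z δ : Y), ‖z‖ ≤ R → ‖δ‖ ≤ 2 * R →
      |⟪G.B z, G.ι (G.P N (G.ι δ)) - G.ι δ⟫_ℝ| ≤ ‖G.b‖ * ‖G.ι‖ * R ^ 2 * (|G.ε N| * (2 * R)) :=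
    fun N z δ hz hδ => by
      refine (abs_real_inner_le_norm _ _).trans ?_
      have h1 := G.norm_B_le z
      have h2 := happ N δ
      calc ‖G.B z‖ * ‖G.ι (G.P N (G.ι δ)) - G.ι δ‖
          ≤ (‖G.b‖ * ‖G.ι‖ * ‖z‖ ^ 2) * (|G.ε N| * ‖δ‖) := by gcongr
        _ ≤ _ := by gcongr
  have hg := le_of_deriv_le_linear (K := 2 * ((G.C + ‖G.b‖) * R)) (δ := 2 * ‖G.ι‖ * R ^ 2 * η)
    (ε := 4 * (‖G.b‖ * ‖G.ι‖ * R ^ 3) * η)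
    (by positivity) (by positivity) (by positivity) hd (by
      have h1 := happ N y₀
      have h2 := happ M y₀
      have h3 : ‖G.ι (x 0 - x' 0)‖ ≤ η * R := by
        rw [h0, h0', map_sub]
        calc _ ≤ ‖G.ι (G.P N (G.ι y₀)) - G.ι y₀‖ + ‖G.ι y₀ - G.ι (G.P M (G.ι y₀))‖ :=
              norm_sub_le_norm_sub_add_norm_sub _ _ _
          _ ≤ |G.ε N| * ‖y₀‖ + |G.ε M| * ‖y₀‖ := by
              rw [norm_sub_rev (G.ι y₀)]; gcongr
          _ = η * ‖y₀‖ := by rw [hη]; ring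
          _ ≤ η * R := by gcongr
      -- One factor of the squared initial distance is bounded crudely, so that the bound is linear
      -- in `η` like the forcing term.
      have h4 : ‖G.ι (x 0 - x' 0)‖ ≤ ‖G.ι‖ * (2 * R) := by
        refine (G.ι.le_opNorm _).trans ?_
        have h5 : ‖x 0 - x' 0‖ ≤ ‖y₀‖ + ‖y₀‖ := by
          rw [h0, h0']
          exact (_root_.norm_sub_le _ _).trans (add_le_add (G.norm_P_le _ _) (G.norm_P_le _ _))
        gcongr
        linarith
      calc ‖G.ι (x 0 - x' 0)‖ ^ 2 = ‖G.ι (x 0 - x' 0)‖ * ‖G.ι (x 0 - x' 0)‖ := sq _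
        _ ≤ ‖G.ι‖ * (2 * R) * (η * R) := by gcongr
        _ = _ := by ring)
    (fun t ht => by
      -- By symmetry the projections move onto the difference `x - x'`, where `P_approx` measures
      -- how far they are from the identity.
      have e1 : ⟪G.ι (x t - x' t), G.ι (G.P N (G.B (x t)) - G.P M (G.B (x' t)))⟫_ℝ =
          ⟪G.B (x t) - G.B (x' t), G.ι (x t - x' t)⟫_ℝ +
          ⟪G.B (x t), G.ι (G.P N (G.ι (x t - x' t))) - G.ι (x t - x' t)⟫_ℝ -
          ⟪G.B (x' t), G.ι (G.P M (G.ι (x t - x' t))) - G.ι (x t - x' t)⟫_ℝ := by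
        rw [real_inner_comm, map_sub G.ι (G.P N _), inner_sub_left, G.P_symm, G.P_symm,
          inner_sub_left, inner_sub_right, inner_sub_right]
        ring
      have hδ : ‖x t - x' t‖ ≤ 2 * R :=
        (_root_.norm_sub_le _ _).trans (by linarith [hR t ht, hR' t ht])
      have h1 := G.inner_B_sub_le (hR t ht) (hR' t ht)
      have h2 := (abs_le.1 (herr N (x t) _ (hR t ht) hδ)).2
      have h3 := (abs_le.1 (herr M (x' t) _ (hR' t ht) hδ)).1
      rw [e1]
      have e2 : 4 * (‖G.b‖ * ‖G.ι‖ * R ^ 3) * η = 2 * (‖G.b‖ * ‖G.ι‖ * R ^ 2 * (|G.ε N| * (2 * R))) +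
          2 * (‖G.b‖ * ‖G.ι‖ * R ^ 2 * (|G.ε M| * (2 * R))) := by rw [hη]; ring
      rw [e2]
      linarith)
  have := hg t ht
  rw [dist_eq_norm, ← map_sub]
  refine this.trans (le_of_eq ?_)
  ring

theorem exists_isWeakSol [CompleteSpace Y] [CompleteSpace Z] [CompleteSpace L]
    {m T : ℝ} (hm : 0 < m) (hT : 0 ≤ T)
    (hmT : 2 * G.C * m * T < 1) {y₀ : Y} (hy₀ : ‖y₀‖ ≤ m) :
    ∃ y : ℝ → Y, y 0 = y₀ ∧ G.IsWeakSol T y ∧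
      (∃ K : ℝ≥0, LipschitzOnWith K (fun t => G.j (y t)) (Icc 0 T)) ∧
      ∀ t ∈ Icc 0 T, ‖y t‖ ≤ m / (1 - 2 * G.C * m * t) := by
  have hC := G.C_pos
  choose x hx0 hx hxb using fun N => G.exists_isApprox N hm hT hmT hy₀
  set R := m / (1 - 2 * G.C * m * T) with hRdef
  have hden : 0 < 1 - 2 * G.C * m * T := by linarith
  have hle : ∀ t ∈ Icc 0 T, m / (1 - 2 * G.C * m * t) ≤ R := fun t ht => by
    have : 2 * G.C * m * t ≤ 2 * G.C * m * T := mul_le_mul_of_nonneg_left ht.2 (by positivity)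
    rw [hRdef]
    gcongr
  have hR : 0 < R := div_pos hm hden
  have hmR : m ≤ R := by simpa using hle 0 (left_mem_Icc.2 hT)
  have hxR : ∀ N, ∀ t ∈ Icc 0 T, ‖x N t‖ ≤ R := fun N t ht => (hxb N t ht).trans (hle t ht)
  have hεa : Tendsto (fun N => |G.ε N|) atTop (𝓝 0) := by simpa using G.ε_tendsto.abs
  have hUC : UniformCauchySeqOn (fun N t => G.ι (x N t)) atTop (Icc 0 T) :=
    uniformCauchySeqOn_of_dist_sq_le hεa fun N M t ht =>
      (hx N).dist_le (hx M) (hxR N) (hxR M) (hx0 N) (hx0 M) hR (hy₀.trans hmR) ht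
  have hlim : ∀ t, ∃ z : Y, t ∈ Icc 0 T → Tendsto (fun N => G.ι (x N t)) atTop (𝓝 (G.ι z)) ∧
      ‖z‖ ≤ m / (1 - 2 * G.C * m * t) := fun t => by
    by_cases ht : t ∈ Icc 0 T
    · obtain ⟨l, hl⟩ := cauchySeq_tendsto_of_complete (hUC.cauchySeq ht)
      -- The bound kept is the one at time `t`, not the uniform `R`: its sharpness as `t → 0` is
      -- what later gives strong continuity.
      obtain ⟨z, hz, hzR⟩ := exists_norm_le_of_tendsto G.ι (fun N => hxb N t ht) hl
      exact ⟨z, fun _ => ⟨hz ▸ hl, hzR⟩⟩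
    · exact ⟨0, fun h => absurd h ht⟩
  choose y hy using hlim
  have hyR : ∀ t ∈ Icc 0 T, ‖y t‖ ≤ R := fun t ht => (hy t ht).2.trans (hle t ht)
  have hunif : TendstoUniformlyOn (fun N t => G.ι (x N t)) (fun t => G.ι (y t)) atTop (Icc 0 T) :=
    hUC.tendstoUniformlyOn_of_tendsto fun t ht => (hy t ht).1
  have hy0 : y 0 = y₀ := by
    refine G.ι_inj (tendsto_nhds_unique (hy 0 (left_mem_Icc.2 hT)).1 ?_)
    simp only [hx0]
    exact (G.ι.continuous.tendsto _).comp (G.P_tendsto y₀)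
  -- The increments lie in a fixed ball of `Z`, which is closed under limits taken in `L`;
  -- injectivity of `κ` identifies the limit.
  have hjlip : ∀ s ∈ Icc 0 T, ∀ t ∈ Icc 0 T, ‖G.j (y t - y s)‖ ≤ G.C * R ^ 2 * |t - s| := by
    intro s hs t ht
    have h1 : Tendsto (fun N => G.κ (G.j (x N t - x N s))) atTop (𝓝 (G.ι (y t - y s))) := by
      simp only [G.κ_j, map_sub]
      exact (hy t ht).1.sub (hy s hs).1
    obtain ⟨z, hz, hzR⟩ := exists_norm_le_of_tendsto G.κ
      (fun N => (hx N).norm_sub_le (hxR N) hs ht) h1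
    rwa [G.κ_inj (hz.trans (G.κ_j _).symm)] at hzR
  have hjL : LipschitzOnWith (G.C * R ^ 2).toNNReal (fun t => G.j (y t)) (Icc 0 T) := by
    refine LipschitzOnWith.of_dist_le_mul fun t ht s hs => ?_
    rw [Real.coe_toNNReal _ (by positivity), dist_eq_norm, ← map_sub, Real.dist_eq]
    exact hjlip s hs t ht
  have hιL : LipschitzOnWith (‖G.κ‖₊ * (G.C * R ^ 2).toNNReal) (fun t => G.ι (y t)) (Icc 0 T) := by
    have := G.κ.lipschitz.comp_lipschitzOnWith hjL
    simpa only [Function.comp_def, G.κ_j] using this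
  have hBc : ∀ φ, ContinuousOn (fun t => ⟪G.B (y t), G.ι φ⟫_ℝ) (Icc 0 T) := fun φ => by
    refine LipschitzOnWith.continuousOn (K := (2 * G.C * ‖φ‖ * (‖G.ι‖ * R)).toNNReal *
      (‖G.κ‖₊ * (G.C * R ^ 2).toNNReal)) ?_
    refine LipschitzOnWith.of_dist_le_mul fun t ht s hs => ?_
    rw [Real.dist_eq, ← inner_sub_left, NNReal.coe_mul, mul_assoc]
    refine (G.abs_inner_B_sub_le (hyR t ht) (hyR s hs) φ).trans ?_
    rw [Real.coe_toNNReal _ (by positivity), ← dist_eq_norm]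
    exact mul_le_mul_of_nonneg_left (hιL.dist_le_mul t ht s hs) (by positivity)
  refine ⟨y, hy0, ⟨⟨R, hyR⟩, ⟨_, hιL⟩, fun t ht φ => ?_⟩, ⟨_, hjL⟩, fun t ht => (hy t ht).2⟩
  refine hasDerivWithinAt_of_tendstoUniformlyOn
    (g := fun N s => ⟪G.ι (x N s), G.ι φ⟫_ℝ) (G := fun N s => ⟪G.ι (G.P N (G.B (x N s))), G.ι φ⟫_ℝ)
    (h := fun s => ⟪G.ι (y s), G.ι φ⟫_ℝ) (H := fun s => ⟪G.B (y s), G.ι φ⟫_ℝ)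
    (fun N t ht => ?_) (fun t ht => (hy t ht).1.inner tendsto_const_nhds) ?_ (hBc φ) ht
  · have h1 := G.ι.hasFDerivAt.comp_hasDerivWithinAt t ((hx N).deriv t ht)
    have h2 := h1.inner ℝ (hasDerivWithinAt_const t (Icc 0 T) (G.ι φ))
    simpa using h2
  · rw [Metric.tendstoUniformlyOn_iff]
    intro r hr
    have hc1 : Tendsto (fun N => ‖G.b‖ * ‖G.ι‖ * R ^ 2 * (‖φ‖ * |G.ε N|)) atTop (𝓝 0) := by
      simpa using (hεa.const_mul ‖φ‖).const_mul (‖G.b‖ * ‖G.ι‖ * R ^ 2)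
    set D := 2 * G.C * ‖φ‖ * (‖G.ι‖ * R) with hD
    have hD0 : 0 ≤ D := by positivity
    filter_upwards [hc1.eventually_lt_const (half_pos hr),
      Metric.tendstoUniformlyOn_iff.1 hunif (r / 2 / (D + 1)) (by positivity)] with N h1 h2 s hs
    have h3 := h2 s hs
    rw [dist_comm, dist_eq_norm] at h3
    rw [dist_comm, Real.dist_eq, G.P_symm]
    -- The error splits into the projection error of the test vector and the weak continuity of `B`.
    have e : ⟪G.B (x N s), G.ι (G.P N (G.ι φ))⟫_ℝ - ⟪G.B (y s), G.ι φ⟫_ℝ =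
        ⟪G.B (x N s), G.ι (G.P N (G.ι φ)) - G.ι φ⟫_ℝ + ⟪G.B (x N s) - G.B (y s), G.ι φ⟫_ℝ := by
      rw [inner_sub_right, inner_sub_left]; ring
    rw [e]
    have h4 := G.abs_inner_B_sub_le (hxR N s hs) (hyR s hs) φ
    have h5 : |⟪G.B (x N s), G.ι (G.P N (G.ι φ)) - G.ι φ⟫_ℝ| ≤
        ‖G.b‖ * ‖G.ι‖ * R ^ 2 * (‖φ‖ * |G.ε N|) := by
      refine (abs_real_inner_le_norm _ _).trans ?_
      have h6 := G.norm_B_le (x N s)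
      have h7 := hxR N s hs
      have h8 : ‖G.ι (G.P N (G.ι φ)) - G.ι φ‖ ≤ ‖φ‖ * |G.ε N| :=
        (G.P_approx N φ).trans (by
          rw [mul_comm]
          exact mul_le_mul_of_nonneg_left (le_abs_self _) (norm_nonneg _))
      calc _ ≤ (‖G.b‖ * ‖G.ι‖ * ‖x N s‖ ^ 2) * (‖φ‖ * |G.ε N|) := by gcongr
        _ ≤ _ := by gcongr
    have h9 : D * ‖G.ι (x N s) - G.ι (y s)‖ ≤ r / 2 := by
      calc D * ‖G.ι (x N s) - G.ι (y s)‖ ≤ (D + 1) * (r / 2 / (D + 1)) := by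
            gcongr
            linarith
        _ = r / 2 := by field_simp
    calc _ ≤ _ := abs_add_le _ _
      _ < r := by linarith

end Galerkin

/-! ### Strong continuity in time, strong solutions and the maximal solution. -/

namespace Galerkin

variable {Y Z L : Type*} [NormedAddCommGroup Y] [InnerProductSpace ℝ Y]
    [NormedAddCommGroup Z] [InnerProductSpace ℝ Z]
    [NormedAddCommGroup L] [InnerProductSpace ℝ L] {G : Galerkin Y Z L}

theorem IsWeakSol.mono {T T' : ℝ} {y : ℝ → Y} (hy : G.IsWeakSol T y) (h : T' ≤ T) :
    G.IsWeakSol T' y := by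
  simpa using hy.shift (s := 0) (r := T') le_rfl (by simpa using h)

/-- By uniqueness, the solution coincides with the one constructed from its value at `s`, which
carries the Riccati bound. Earlier times are reached through the reversed solution. -/
theorem IsWeakSol.norm_le [CompleteSpace Y] [CompleteSpace Z] [CompleteSpace L]
    {T m : ℝ} {y : ℝ → Y} (hy : G.IsWeakSol T y) {s t : ℝ} (hs : s ∈ Icc 0 T) (ht : t ∈ Icc 0 T)
    (hm : 0 < m) (hsm : ‖y s‖ ≤ m) (hst : 2 * G.C * m * |t - s| < 1) :
    ‖y t‖ ≤ m / (1 - 2 * G.C * m * |t - s|) := by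
  rcases le_total s t with h | h
  · rw [abs_of_nonneg (sub_nonneg.2 h)] at hst ⊢
    obtain ⟨z, hz0, hz, -, hzb⟩ := exists_isWeakSol hm (sub_nonneg.2 h) hst hsm
    have hmem : t - s ∈ Icc 0 (t - s) := right_mem_Icc.2 (sub_nonneg.2 h)
    have h1 := hz.eqOn (hy.shift (r := t - s) hs.1 (by linarith [ht.2])) (by simpa using hz0) hmem
    have h2 := hzb _ hmem
    rw [h1] at h2
    simpa only [add_sub_cancel] using h2
  · rw [abs_of_nonpos (sub_nonpos.2 h), neg_sub] at hst ⊢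
    obtain ⟨z, hz0, hz, -, hzb⟩ := exists_isWeakSol (y₀ := -y s) hm (sub_nonneg.2 h) hst
      (by rwa [norm_neg])
    have hmem : s - t ∈ Icc 0 (s - t) := right_mem_Icc.2 (sub_nonneg.2 h)
    have h1 := hz.eqOn ((hy.reverse hs.2).mono (by linarith [ht.1])) (by simpa using hz0) hmem
    have h2 := hzb _ hmem
    rw [h1] at h2
    simpa only [norm_neg, sub_sub_cancel] using h2

/-- Pairing with a truncated vector depends on `ι (y t)` only, which is continuous; boundedness in
`Y` makes the approximation of `z` by truncations uniform in `t`. -/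
theorem IsWeakSol.continuousOn_inner {T : ℝ} {y : ℝ → Y} (hy : G.IsWeakSol T y) (z : Y) :
    ContinuousOn (fun t => ⟪y t, z⟫_ℝ) (Icc 0 T) := by
  obtain ⟨R, hR⟩ := hy.bdd
  obtain ⟨K, hK⟩ := hy.lip
  refine TendstoUniformlyOn.continuousOn (F := fun N t => ⟪y t, G.P N (G.ι z)⟫_ℝ) (p := atTop) ?_
    (Eventually.frequently (Eventually.of_forall fun N => ?_))
  · rw [Metric.tendstoUniformlyOn_iff]
    intro r hr
    have h1 : Tendsto (fun N => |R| * ‖z - G.P N (G.ι z)‖) atTop (𝓝 0) := by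
      have := ((tendsto_const_nhds (x := z)).sub (G.P_tendsto z)).norm.const_mul |R|
      simpa using this
    filter_upwards [h1.eventually_lt_const hr] with N hN t ht
    rw [Real.dist_eq, ← inner_sub_right]
    refine (abs_real_inner_le_norm _ _).trans_lt (lt_of_le_of_lt ?_ hN)
    gcongr
    exact (hR t ht).trans (le_abs_self R)
  · have : ContinuousOn (fun t => ⟪G.P N (G.ι (y t)), z⟫_ℝ) (Icc 0 T) :=
      ((G.P N).continuous.comp_continuousOn hK.continuousOn).inner continuousOn_const
    simpa only [G.P_symm'] using this

/-- Weak solutions are strongly continuous: they restart, forwards and backwards in time, with a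
norm bound that is sharp at the initial time. -/
theorem IsWeakSol.continuousOn [CompleteSpace Y] [CompleteSpace Z] [CompleteSpace L]
    {T : ℝ} {y : ℝ → Y} (hy : G.IsWeakSol T y) : ContinuousOn y (Icc 0 T) := by
  intro s hs
  have key : Tendsto (fun t => ‖y t - y s‖ ^ 2) (𝓝[Icc 0 T] s) (𝓝 0) := by
    rw [Metric.tendsto_nhds]
    intro η hη
    -- A bound slightly above `‖y s‖` is used because `y s` may vanish and the Riccati estimate
    -- needs a positive one.
    obtain ⟨m, hm0, hm1⟩ : ∃ m, ‖y s‖ < m ∧ m ^ 2 < ‖y s‖ ^ 2 + η / 2 := by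
      have h1 : Tendsto (fun m : ℝ => m ^ 2) (𝓝[>] ‖y s‖) (𝓝 (‖y s‖ ^ 2)) :=
        ((continuous_pow 2).tendsto _).mono_left nhdsWithin_le_nhds
      obtain ⟨m, h2, h3⟩ := ((h1.eventually_lt_const (show ‖y s‖ ^ 2 < ‖y s‖ ^ 2 + η / 2 by
        linarith)).and self_mem_nhdsWithin).exists
      exact ⟨m, h3, h2⟩
    have hm : 0 < m := (norm_nonneg _).trans_lt hm0
    have hc : Tendsto (fun t => 2 * G.C * m * |t - s|) (𝓝[Icc 0 T] s) (𝓝 0) := by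
      have : Continuous fun t : ℝ => 2 * G.C * m * |t - s| := by fun_prop
      have h2 := (this.tendsto s).mono_left (nhdsWithin_le_nhds (s := Icc 0 T))
      simpa using h2
    have hc2 : Tendsto (fun t => (m / (1 - 2 * G.C * m * |t - s|)) ^ 2) (𝓝[Icc 0 T] s)
        (𝓝 (m ^ 2)) := by
      have h2 := ((tendsto_const_nhds (x := m)).div (hc.const_sub 1) (by norm_num)).pow 2
      simpa using h2
    have hi := (hy.continuousOn_inner (y s) s hs).tendsto
    rw [real_inner_self_eq_norm_sq] at hi
    filter_upwards [self_mem_nhdsWithin, hc.eventually_lt_const zero_lt_one,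
      hc2.eventually_lt_const hm1,
      hi.eventually_const_lt (show ‖y s‖ ^ 2 - η / 4 < ‖y s‖ ^ 2 by linarith)] with t ht h1 h2 h3
    have h4 := hy.norm_le hs ht hm hm0.le h1
    have h5 : ‖y t‖ ^ 2 ≤ (m / (1 - 2 * G.C * m * |t - s|)) ^ 2 :=
      pow_le_pow_left₀ (norm_nonneg _) h4 2
    -- Expanding the square: weak continuity handles the cross term, the restarted norm bound the
    -- first one.
    rw [Real.dist_eq, sub_zero, abs_of_nonneg (sq_nonneg _), norm_sub_sq_real]
    linarith
  rw [ContinuousWithinAt, tendsto_iff_norm_sub_tendsto_zero]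
  have := key.sqrt
  simpa using this

theorem norm_le_of_abs_inner_le (G : Galerkin Y Z L) {x : L} {c : ℝ} (hc : 0 ≤ c)
    (h : ∀ φ, |⟪x, G.ι φ⟫_ℝ| ≤ c * ‖G.ι φ‖) : ‖x‖ ≤ c := by
  have h1 : ∀ l, |⟪x, l⟫_ℝ| ≤ c * ‖l‖ := fun l =>
    G.dense.induction_on l (isClosed_le (by fun_prop) (by fun_prop)) h
  have h2 := h1 x
  rw [real_inner_self_eq_norm_sq, abs_of_nonneg (sq_nonneg _), sq] at h2
  rcases eq_or_lt_of_le (norm_nonneg x) with h3 | h3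
  · rwa [← h3]
  · exact le_of_mul_le_mul_right h2 h3

/-- `B ∘ y` is now continuous into `L`. The scalar mean value inequality for each test vector `φ`
has a constant proportional to `‖ι φ‖`, so by density it becomes an estimate in the norm of `L`. -/
theorem IsWeakSol.hasDerivWithinAt [CompleteSpace Y] [CompleteSpace Z] [CompleteSpace L]
    {T : ℝ} {y : ℝ → Y} (hy : G.IsWeakSol T y) {t : ℝ} (ht : t ∈ Icc 0 T) :
    HasDerivWithinAt (fun s => G.ι (y s)) (G.B (y t)) (Icc 0 T) t := by
  have hc : ContinuousOn (fun s => G.B (y s)) (Icc 0 T) :=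
    G.continuous_B.comp_continuousOn hy.continuousOn
  rw [hasDerivWithinAt_iff_isLittleO, Asymptotics.isLittleO_iff]
  intro c hcpos
  obtain ⟨δ, hδ, hδB⟩ := Metric.continuousOn_iff.1 hc t ht c hcpos
  rw [eventually_nhdsWithin_iff]
  filter_upwards [Metric.ball_mem_nhds t hδ] with s hs hsI
  refine G.norm_le_of_abs_inner_le (by positivity) fun φ => ?_
  have hconv : Convex ℝ (Icc 0 T ∩ Metric.ball t δ) := (convex_Icc 0 T).inter (convex_ball t δ)
  have hd : ∀ r ∈ Icc 0 T ∩ Metric.ball t δ, HasDerivWithinAt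
      (fun r => ⟪G.ι (y r), G.ι φ⟫_ℝ - r * ⟪G.B (y t), G.ι φ⟫_ℝ)
      (⟪G.B (y r) - G.B (y t), G.ι φ⟫_ℝ) (Icc 0 T ∩ Metric.ball t δ) r := fun r hr => by
    have h1 := ((hy.deriv r hr.1 φ).mono (inter_subset_left (t := Metric.ball t δ)))
    refine (h1.sub ((hasDerivWithinAt_id r _).mul_const _)).congr_deriv ?_
    rw [inner_sub_left, one_mul]
  have hbd : ∀ r ∈ Icc 0 T ∩ Metric.ball t δ, ‖⟪G.B (y r) - G.B (y t), G.ι φ⟫_ℝ‖ ≤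
      c * ‖G.ι φ‖ := fun r hr => by
    refine (norm_inner_le_norm _ _).trans ?_
    have := (hδB r hr.1 hr.2).le
    rw [dist_eq_norm] at this
    gcongr
  have := hconv.norm_image_sub_le_of_norm_hasDerivWithin_le hd hbd
    ⟨ht, Metric.mem_ball_self hδ⟩ ⟨hsI, hs⟩
  rw [Real.norm_eq_abs, show ⟪G.ι (y s), G.ι φ⟫_ℝ - s * ⟪G.B (y t), G.ι φ⟫_ℝ -
    (⟪G.ι (y t), G.ι φ⟫_ℝ - t * ⟪G.B (y t), G.ι φ⟫_ℝ) =
    ⟪G.ι (y s) - G.ι (y t) - (s - t) • G.B (y t), G.ι φ⟫_ℝ by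
      rw [inner_sub_left, inner_sub_left, real_inner_smul_left]; ring] at this
  linarith

variable (G)

/-- Strong solutions on `[0,T)`. -/
structure IsSol (y₀ : Y) (T : ℝ) (y : ℝ → Y) : Prop where
  cont : ContinuousOn y (Ico 0 T)
  lip : ∃ K : ℝ≥0, LipschitzOnWith K (fun t => G.j (y t)) (Ico 0 T)
  init : y 0 = y₀
  deriv : ∀ t ∈ Ico 0 T, HasDerivWithinAt (fun s => G.ι (y s)) (G.B (y t)) (Ico 0 T) t

variable {G}

theorem IsSol.mono {y₀ : Y} {T T' : ℝ} {y : ℝ → Y} (hy : G.IsSol y₀ T y) (h : T' ≤ T) :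
    G.IsSol y₀ T' y := by
  have hI : Ico 0 T' ⊆ Ico 0 T := Ico_subset_Ico_right h
  exact ⟨hy.cont.mono hI, hy.lip.imp fun K hK => hK.mono hI, hy.init,
    fun t ht => (hy.deriv t (hI ht)).mono hI⟩

theorem IsSol.congr {y₀ : Y} {T : ℝ} {y z : ℝ → Y} (hy : G.IsSol y₀ T y) (hT : 0 < T)
    (h : EqOn z y (Ico 0 T)) : G.IsSol y₀ T z := by
  refine ⟨hy.cont.congr h, hy.lip.imp fun K hK => ?_, (h ⟨le_rfl, hT⟩).trans hy.init,
    fun t ht => ?_⟩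
  · intro s hs t ht
    simpa only [h hs, h ht] using hK hs ht
  · rw [h ht]
    exact (hy.deriv t ht).congr_of_mem (fun s hs => by simp only [h hs]) ht

theorem IsSol.isWeakSol {y₀ : Y} {T T' : ℝ} {y : ℝ → Y} (hy : G.IsSol y₀ T y) (h : T' < T) :
    G.IsWeakSol T' y := by
  have hI : Icc 0 T' ⊆ Ico 0 T := fun t ht => ⟨ht.1, ht.2.trans_lt h⟩
  obtain ⟨K, hK⟩ := hy.lip
  refine ⟨?_, ⟨‖G.κ‖₊ * K, ?_⟩, fun t ht φ => ?_⟩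
  · obtain ⟨R, hR⟩ := isCompact_Icc.exists_bound_of_continuousOn (hy.cont.mono hI)
    exact ⟨R, hR⟩
  · have := G.κ.lipschitz.comp_lipschitzOnWith (hK.mono hI)
    simpa only [Function.comp_def, G.κ_j] using this
  · have := ((hy.deriv t (hI ht)).mono hI).inner ℝ (hasDerivWithinAt_const t _ (G.ι φ))
    simpa using this

theorem IsSol.eq {y₀ : Y} {T T' : ℝ} {y z : ℝ → Y} (hy : G.IsSol y₀ T y) (hz : G.IsSol y₀ T' z)
    {t : ℝ} (ht : 0 ≤ t) (htT : t < T) (htT' : t < T') : y t = z t :=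
  (hy.isWeakSol htT).eqOn (hz.isWeakSol htT') (hy.init.trans hz.init.symm) ⟨ht, le_rfl⟩

theorem exists_isSol [CompleteSpace Y] [CompleteSpace Z] [CompleteSpace L] {y₀ : Y} {T : ℝ}
    (hT : 0 < T) (hyT : T * ‖y₀‖ < 1 / (2 * G.C)) : ∃ y, G.IsSol y₀ T y := by
  have hC := G.C_pos
  obtain ⟨m, h1, h2⟩ := exists_between (show ‖y₀‖ < 1 / (2 * G.C) / T by
    rwa [lt_div_iff₀ hT, mul_comm])
  have hm : 0 < m := (norm_nonneg _).trans_lt h1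
  obtain ⟨y, hy0, hy, ⟨K, hK⟩, -⟩ := exists_isWeakSol (G := G) hm hT.le (by
    rw [lt_div_iff₀ hT, lt_div_iff₀ (by positivity)] at h2
    linarith) h1.le
  exact ⟨y, hy.continuousOn.mono Ico_subset_Icc_self, ⟨K, hK.mono Ico_subset_Icc_self⟩, hy0,
    fun t ht => (hy.hasDerivWithinAt (Ico_subset_Icc_self ht)).mono Ico_subset_Icc_self⟩

/-- A solution on `[0,T₁)` and a solution restarted at `t₀ < T₁` can be glued. -/
theorem IsSol.glue {y₀ : Y} {T₁ T₂ t₀ : ℝ} {y z : ℝ → Y} (hy : G.IsSol y₀ T₁ y) (ht₀ : 0 ≤ t₀)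
    (ht₁ : t₀ < T₁) (hz : G.IsSol (y t₀) T₂ z) (h12 : T₁ < t₀ + T₂) :
    ∃ w, G.IsSol y₀ (t₀ + T₂) w := by
  set w : ℝ → Y := fun t => if t < T₁ then y t else z (t - t₀) with hw
  have hwy : ∀ t < T₁, w t = y t := fun t ht => if_pos ht
  -- The overlap `[t₀, T₁)` is nontrivial and the two pieces agree there by uniqueness; near every
  -- time `w` is therefore one of the two solutions.
  have hwz : ∀ t ∈ Ico t₀ (t₀ + T₂), w t = z (t - t₀) := fun t ht => by
    by_cases h : t < T₁
    · rw [hwy t h]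
      have h1 : G.IsWeakSol (t - t₀) fun s => y (t₀ + s) :=
        (hy.isWeakSol h).shift ht₀ (by linarith)
      have h2 := h1.eqOn (hz.isWeakSol (show t - t₀ < T₂ by linarith [ht.2]))
        (by simpa using hz.init.symm) (right_mem_Icc.2 (sub_nonneg.2 ht.1))
      simpa using h2
    · exact if_neg h
  have hmap : MapsTo (fun t => t - t₀) (Ico t₀ (t₀ + T₂)) (Ico 0 T₂) := fun t ht =>
    ⟨sub_nonneg.2 ht.1, by linarith [ht.2]⟩
  have hn1 : ∀ t < T₁, Ico 0 T₁ ∈ 𝓝[Ico 0 (t₀ + T₂)] t := fun t ht => by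
    filter_upwards [self_mem_nhdsWithin, mem_nhdsWithin_of_mem_nhds (Iio_mem_nhds ht)] with s h1 h2
    exact ⟨h1.1, h2⟩
  have hn2 : ∀ t, t₀ < t → Ico t₀ (t₀ + T₂) ∈ 𝓝[Ico 0 (t₀ + T₂)] t := fun t ht => by
    filter_upwards [self_mem_nhdsWithin, mem_nhdsWithin_of_mem_nhds (Ioi_mem_nhds ht)] with s h1 h2
    exact ⟨le_of_lt h2, h1.2⟩
  obtain ⟨K₁, hK₁⟩ := hy.lip
  obtain ⟨K₂, hK₂⟩ := hz.lip
  refine ⟨w, fun t ht => ?_, ⟨K₁ + K₂, ?_⟩, (hwy 0 (ht₀.trans_lt ht₁)).trans hy.init,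
    fun t ht => ?_⟩
  · rcases lt_or_ge t T₁ with h | h
    · refine ContinuousWithinAt.mono_of_mem_nhdsWithin ?_ (hn1 t h)
      exact (hy.cont t ⟨ht.1, h⟩).congr (fun s hs => hwy s hs.2) (hwy t h)
    · have hlt : t₀ < t := ht₁.trans_le h
      refine ContinuousWithinAt.mono_of_mem_nhdsWithin ?_ (hn2 t hlt)
      have hmem : t ∈ Ico t₀ (t₀ + T₂) := ⟨hlt.le, ht.2⟩
      have h1 : ContinuousOn (fun t => z (t - t₀)) (Ico t₀ (t₀ + T₂)) :=
        hz.cont.comp (by fun_prop) hmap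
      exact (h1 t hmem).congr hwz (hwz t hmem)
  · have hle1 : ∀ s ∈ Ico 0 T₁, ∀ t ∈ Ico 0 T₁, dist (G.j (w s)) (G.j (w t)) ≤ K₁ * dist s t :=
      fun s hs t ht => by
        rw [hwy s hs.2, hwy t ht.2]; exact hK₁.dist_le_mul s hs t ht
    have hle2 : ∀ s ∈ Ico t₀ (t₀ + T₂), ∀ t ∈ Ico t₀ (t₀ + T₂),
        dist (G.j (w s)) (G.j (w t)) ≤ K₂ * dist s t := fun s hs t ht => by
      rw [hwz s hs, hwz t ht]
      simpa using hK₂.dist_le_mul _ (hmap hs) _ (hmap ht)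
    have hmain : ∀ s ∈ Ico 0 (t₀ + T₂), ∀ t ∈ Ico 0 (t₀ + T₂), s ≤ t →
        dist (G.j (w s)) (G.j (w t)) ≤ (K₁ + K₂) * dist s t := fun s hs t ht hst => by
      have hK1 := K₁.coe_nonneg
      have hK2 := K₂.coe_nonneg
      have hd : (0 : ℝ) ≤ dist s t := dist_nonneg
      rcases lt_or_ge t T₁ with h | h
      · refine (hle1 s ⟨hs.1, hst.trans_lt h⟩ t ⟨ht.1, h⟩).trans ?_
        nlinarith
      · have hlt : t₀ < t := ht₁.trans_le h
        -- An interval that crosses `t₀` is split there, at a point common to both pieces.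
        rcases le_total t₀ s with h' | h'
        · refine (hle2 s ⟨h', hs.2⟩ t ⟨hlt.le, ht.2⟩).trans ?_
          nlinarith
        · have h1 := hle1 s ⟨hs.1, h'.trans_lt ht₁⟩ t₀ ⟨ht₀, ht₁⟩
          have h2 := hle2 t₀ ⟨le_rfl, by linarith⟩ t ⟨hlt.le, ht.2⟩
          have h3 := dist_triangle (G.j (w s)) (G.j (w t₀)) (G.j (w t))
          rw [Real.dist_eq, abs_sub_comm, abs_of_nonneg (by linarith)] at h1 h2 ⊢
          nlinarith
    refine LipschitzOnWith.of_dist_le_mul fun s hs t ht => ?_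
    rw [NNReal.coe_add]
    rcases le_total s t with h | h
    · exact hmain s hs t ht h
    · rw [dist_comm, dist_comm s]; exact hmain t ht s hs h
  · rcases lt_or_ge t T₁ with h | h
    · rw [hwy t h]
      have h1 := (hy.deriv t ⟨ht.1, h⟩).congr_of_mem (f₁ := fun s => G.ι (w s))
        (fun s hs => by simp only [hwy s hs.2]) ⟨ht.1, h⟩
      exact h1.mono_of_mem_nhdsWithin (hn1 t h)
    · have hlt : t₀ < t := ht₁.trans_le h
      have hmem : t ∈ Ico t₀ (t₀ + T₂) := ⟨hlt.le, ht.2⟩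
      rw [hwz t hmem]
      have h1 := (hz.deriv (t - t₀) (hmap hmem)).scomp t
        ((hasDerivWithinAt_id t _).sub_const t₀) hmap
      rw [one_smul] at h1
      have h2 := h1.congr_of_mem (f₁ := fun s => G.ι (w s))
        (fun s hs => by simp only [hwz s hs]; rfl) hmem
      exact h2.mono_of_mem_nhdsWithin (hn2 t hlt)

/-- Local well-posedness, the maximal solution and the blow-up alternative. -/
theorem wellPosed [CompleteSpace Y] [CompleteSpace Z] [CompleteSpace L] (G : Galerkin Y Z L) :
    ∃ c : ℝ, 0 < c ∧ ∀ y₀ : Y,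
      (∀ T : ℝ, 0 < T → T * ‖y₀‖ < c → ∃ y, G.IsSol y₀ T y ∧
        ∀ z, G.IsSol y₀ T z → EqOn z y (Ico 0 T)) ∧
      ∃ (Tstar : EReal) (y : ℝ → Y), 0 < Tstar ∧
        (∀ T : ℝ, 0 < T → (T : EReal) < Tstar → G.IsSol y₀ T y) ∧
        (∀ (S : EReal) (z : ℝ → Y), (∀ T : ℝ, 0 < T → (T : EReal) < S → G.IsSol y₀ T z) →
          S ≤ Tstar ∧ ∀ t : ℝ, 0 ≤ t → (t : EReal) < S → z t = y t) ∧
        (Tstar = ⊤ ∨ ∃ τ : ℝ, Tstar = τ ∧ ∀ M : ℝ, ∃ᶠ t in 𝓝[<] τ, M < ‖y t‖) := by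
  have hC := G.C_pos
  refine ⟨1 / (2 * G.C), by positivity, fun y₀ => ⟨fun T hT hyT => ?_, ?_⟩⟩
  · obtain ⟨y, hy⟩ := exists_isSol hT hyT
    exact ⟨y, hy, fun z hz t ht => hz.eq hy ht.1 ht.2 ht.2⟩
  set A : Set ℝ := {T | 0 < T ∧ ∃ y, G.IsSol y₀ T y} with hA
  obtain ⟨T₀, hT₀⟩ : ∃ T₀, T₀ ∈ A := by
    refine ⟨1 / (2 * G.C) / (‖y₀‖ + 1), by positivity, exists_isSol (by positivity) ?_⟩
    rw [div_mul_eq_mul_div, div_lt_iff₀ (by positivity)]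
    have : 0 < 1 / (2 * G.C) := by positivity
    nlinarith
  set Tstar : EReal := sSup ((fun T : ℝ => (T : EReal)) '' A) with hTs
  have hle : ∀ T ∈ A, (T : EReal) ≤ Tstar := fun T hT => le_sSup ⟨T, hT, rfl⟩
  have hpos : 0 < Tstar := lt_of_lt_of_le (by exact_mod_cast hT₀.1) (hle T₀ hT₀)
  have hex : ∀ t : ℝ, (t : EReal) < Tstar → ∃ T ∈ A, t < T := fun t ht => by
    obtain ⟨_, ⟨T, hT, rfl⟩, h⟩ := lt_sSup_iff.1 ht
    exact ⟨T, hT, EReal.coe_lt_coe_iff.1 h⟩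
  -- All solutions alive at time `t` share one value there, so the maximal solution can be defined
  -- pointwise.
  have hval : ∀ t : ℝ, ∃ v : Y, 0 ≤ t → ∀ T z, t < T → G.IsSol y₀ T z → z t = v := fun t => by
    by_cases h : ∃ T z, t < T ∧ G.IsSol y₀ T z
    · obtain ⟨T, z, h1, h2⟩ := h
      exact ⟨z t, fun ht T' z' h1' h2' => h2'.eq h2 ht h1' h1⟩
    · exact ⟨0, fun _ T z h1 h2 => absurd ⟨T, z, h1, h2⟩ h⟩
  choose y hy using hval
  have hysol : ∀ T : ℝ, 0 < T → (T : EReal) < Tstar → G.IsSol y₀ T y := fun T hT hTT => by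
    obtain ⟨T', ⟨-, z, hz⟩, h⟩ := hex T hTT
    exact (hz.mono h.le).congr hT fun t ht => (hy t ht.1 T' z (ht.2.trans h) hz).symm
  refine ⟨Tstar, y, hpos, hysol, fun S z hz => ⟨?_, fun t ht htS => ?_⟩, ?_⟩
  · by_contra! hlt
    obtain ⟨r, hr1, hr2⟩ := EReal.lt_iff_exists_real_btwn.1 hlt
    have hr0 : 0 < r := by exact_mod_cast hpos.trans hr1
    exact absurd (hle r ⟨hr0, z, hz r hr0 hr2⟩) (not_le.2 hr1)
  · obtain ⟨r, hr1, hr2⟩ := EReal.lt_iff_exists_real_btwn.1 htS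
    have htr : t < r := by exact_mod_cast hr1
    exact hy t ht r z htr (hz r (ht.trans_lt htr) hr2)
  · rcases eq_or_ne Tstar ⊤ with h | h
    · exact Or.inl h
    refine Or.inr ⟨Tstar.toReal, (EReal.coe_toReal h (ne_bot_of_gt hpos)).symm, fun M => ?_⟩
    set τ := Tstar.toReal
    have hτ : (τ : EReal) = Tstar := EReal.coe_toReal h (ne_bot_of_gt hpos)
    have hτ0 : 0 < τ := by exact_mod_cast hτ ▸ hpos
    by_contra hfr
    rw [Filter.not_frequently] at hfr
    -- A lifespan guaranteed for all data of norm at most `M`. Restarting within `r` of `τ` would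
    -- reach beyond `τ`, against the definition of the supremum.
    set r := 1 / (2 * G.C) / (|M| + 1) with hr
    have hr0 : 0 < r := by positivity
    have hnear : ∀ᶠ t in 𝓝[<] τ, max 0 (τ - r) < t :=
      mem_nhdsWithin_of_mem_nhds (Ioi_mem_nhds (max_lt hτ0 (by linarith)))
    obtain ⟨t₀, ⟨h1, h2⟩, h3⟩ := ((hfr.and hnear).and self_mem_nhdsWithin).exists
    have h3' : t₀ < τ := h3
    have ht0 : 0 < t₀ := (le_max_left _ _).trans_lt h2
    have ht1 : τ - r < t₀ := (le_max_right _ _).trans_lt h2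
    obtain ⟨T₁, hT₁, hT₁τ⟩ := exists_between h3'
    have hs1 : G.IsSol y₀ T₁ y := hysol T₁ (ht0.trans hT₁) (by
      rw [← hτ]; exact_mod_cast hT₁τ)
    obtain ⟨z, hz⟩ := exists_isSol (G := G) (y₀ := y t₀) hr0 (by
      rw [hr, div_mul_eq_mul_div, div_lt_iff₀ (by positivity)]
      have h4 : ‖y t₀‖ < |M| + 1 := by linarith [not_lt.1 h1, le_abs_self M]
      have : 0 < 1 / (2 * G.C) := by positivity
      exact mul_lt_mul_of_pos_left h4 this)
    obtain ⟨w, hw⟩ := hs1.glue ht0.le hT₁ hz (by linarith)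
    have := hle (t₀ + r) ⟨by linarith, w, hw⟩
    rw [← hτ] at this
    have : t₀ + r ≤ τ := by exact_mod_cast this
    linarith

end Galerkin

/-! ### Continuous and smooth functions on the circle inside `L²`. -/

/-- The inclusion `C(𝕋) → L²(𝕋)`. -/
def cL : C(Torus, ℝ) →L[ℝ] L2 := ContinuousMap.toLp 2 (volume : Measure Torus) ℝ

theorem coeFn_cL (φ : C(Torus, ℝ)) : cL φ =ᵐ[volume] φ :=
  ContinuousMap.coeFn_toLp (p := 2) (𝕜 := ℝ) volume φ

theorem cL_injective : Function.Injective cL := ContinuousMap.toLp_injective volume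

theorem inner_cL_cL (φ ψ : C(Torus, ℝ)) : ⟪cL φ, cL ψ⟫_ℝ = ∫ x, φ x * ψ x := by
  rw [cL, ContinuousMap.inner_toLp]
  simp [mul_comm]

theorem inner_cL (f : L2) (φ : C(Torus, ℝ)) : ⟪f, cL φ⟫_ℝ = ∫ x, f x * φ x := by
  rw [L2.inner_def]
  refine integral_congr_ae ?_
  filter_upwards [coeFn_cL φ] with x hx
  rw [hx]
  simp [mul_comm]

theorem memLp_continuous_mul (φ : C(Torus, ℝ)) (f : L2) :
    MemLp (fun x => φ x * f x) 2 (volume : Measure Torus) :=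
  (Lp.memLp f).of_le_mul (c := ‖φ‖) (φ.continuous.aestronglyMeasurable.mul
    (Lp.aestronglyMeasurable f)) (Eventually.of_forall fun x => by
      rw [norm_mul]
      exact mul_le_mul_of_nonneg_right (φ.norm_coe_le_norm x) (norm_nonneg _))

/-- Multiplication of an `L²` function by a continuous function. -/
def M : C(Torus, ℝ) →L[ℝ] L2 →L[ℝ] L2 := by
  have hmem := memLp_continuous_mul
  refine LinearMap.mkContinuous₂ (LinearMap.mk₂ ℝ (fun φ f => (hmem φ f).toLp _) ?_ ?_ ?_ ?_) 1 ?_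
  · intro φ ψ f
    refine Lp.ext ?_
    filter_upwards [(hmem (φ + ψ) f).coeFn_toLp, (hmem φ f).coeFn_toLp, (hmem ψ f).coeFn_toLp,
      Lp.coeFn_add ((hmem φ f).toLp _) ((hmem ψ f).toLp _)] with x h1 h2 h3 h4
    rw [h1, h4, Pi.add_apply, h2, h3, ContinuousMap.add_apply, add_mul]
  · intro c φ f
    refine Lp.ext ?_
    filter_upwards [(hmem (c • φ) f).coeFn_toLp, (hmem φ f).coeFn_toLp,
      Lp.coeFn_smul c ((hmem φ f).toLp _)] with x h1 h2 h3
    rw [h1, h3, Pi.smul_apply, h2, ContinuousMap.smul_apply, smul_mul_assoc]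
  · intro φ f g
    refine Lp.ext ?_
    filter_upwards [(hmem φ (f + g)).coeFn_toLp, (hmem φ f).coeFn_toLp, (hmem φ g).coeFn_toLp,
      Lp.coeFn_add ((hmem φ f).toLp _) ((hmem φ g).toLp _), Lp.coeFn_add f g] with x h1 h2 h3 h4 h5
    rw [h1, h4, Pi.add_apply, h2, h3, h5, Pi.add_apply, mul_add]
  · intro c φ f
    refine Lp.ext ?_
    filter_upwards [(hmem φ (c • f)).coeFn_toLp, (hmem φ f).coeFn_toLp,
      Lp.coeFn_smul c ((hmem φ f).toLp _), Lp.coeFn_smul c f] with x h1 h2 h3 h4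
    rw [h1, h3, Pi.smul_apply, h2, h4, Pi.smul_apply, smul_eq_mul, smul_eq_mul]
    ring
  · intro φ f
    rw [one_mul]
    refine Lp.norm_le_mul_norm_of_ae_le_mul ?_
    filter_upwards [(hmem φ f).coeFn_toLp] with x h1
    rw [LinearMap.mk₂_apply, h1, norm_mul]
    exact mul_le_mul_of_nonneg_right (φ.norm_coe_le_norm x) (norm_nonneg _)

theorem coeFn_M (φ : C(Torus, ℝ)) (f : L2) : M φ f =ᵐ[volume] fun x => φ x * f x :=
  MemLp.coeFn_toLp (memLp_continuous_mul φ f)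

theorem norm_M_le (φ : C(Torus, ℝ)) (f : L2) : ‖M φ f‖ ≤ ‖φ‖ * ‖f‖ := by
  refine Lp.norm_le_mul_norm_of_ae_le_mul ?_
  filter_upwards [coeFn_M φ f] with x h1
  rw [h1, norm_mul]
  exact mul_le_mul_of_nonneg_right (φ.norm_coe_le_norm x) (norm_nonneg _)

theorem M_cL (φ ψ : C(Torus, ℝ)) : M φ (cL ψ) = cL (φ * ψ) := by
  refine Lp.ext ?_
  filter_upwards [coeFn_M φ (cL ψ), coeFn_cL ψ, coeFn_cL (φ * ψ)] with x h1 h2 h3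
  rw [h1, h2, h3, ContinuousMap.mul_apply]

theorem M_cL_comm (φ ψ : C(Torus, ℝ)) : M φ (cL ψ) = M ψ (cL φ) := by
  rw [M_cL, M_cL]
  exact congrArg cL (mul_comm φ ψ)

theorem inner_M_left (φ : C(Torus, ℝ)) (f g : L2) : ⟪M φ f, g⟫_ℝ = ⟪f, M φ g⟫_ℝ := by
  rw [L2.inner_def, L2.inner_def]
  refine integral_congr_ae ?_
  filter_upwards [coeFn_M φ f, coeFn_M φ g] with x h1 h2
  rw [h1, h2]
  simp
  ring

/-- The algebra of smooth functions on the torus. -/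
def SF : Subalgebra ℝ C(Torus, ℝ) where
  carrier := {f | ContDiff ℝ ((⊤ : ℕ∞) : WithTop ℕ∞) fun θ : ℝ => f (θ : Torus)}
  mul_mem' := fun hf hg => ContDiff.mul (mem_ofPred.1 hf) (mem_ofPred.1 hg)
  add_mem' := fun hf hg => ContDiff.add (mem_ofPred.1 hf) (mem_ofPred.1 hg)
  algebraMap_mem' := fun c => mem_ofPred.2 (contDiff_const (c := c))

namespace SF

theorem contDiff (f : SF) : ContDiff ℝ ((⊤ : ℕ∞) : WithTop ℕ∞) fun θ : ℝ => f.1 (θ : Torus) := f.2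

/-- Differentiating along translations at 0 gives a quantity that depends on the point of the
circle, not on its lift. -/
theorem deriv_aux (f : SF) (θ : ℝ) :
    deriv (fun s : ℝ => f.1 ((θ : Torus) + (s : Torus))) 0 =
      deriv (fun s : ℝ => f.1 (s : Torus)) θ := by
  have := deriv_comp_const_add (f := fun s : ℝ => f.1 (s : Torus)) θ 0
  simpa using this

/-- The derivative of a smooth function. -/
def D : SF →ₗ[ℝ] SF where
  toFun f := ⟨⟨fun x => deriv (fun s : ℝ => f.1 (x + (s : Torus))) 0, continuous_of_lift (by
      simp only [deriv_aux]
      exact (SF.contDiff f).continuous_deriv (by simp))⟩, by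
    show ContDiff ℝ ((⊤ : ℕ∞) : WithTop ℕ∞) fun θ : ℝ => deriv (fun s : ℝ => f.1 ((θ : Torus) + (s : Torus))) 0
    simp only [deriv_aux]
    exact (contDiff_infty_iff_deriv.1 (SF.contDiff f)).2⟩
  map_add' f g := by
    ext x
    induction x using QuotientAddGroup.induction_on with
    | H θ =>
      exact (deriv_aux _ θ).trans ((deriv_fun_add ((SF.contDiff f).differentiable (by simp) θ)
        ((SF.contDiff g).differentiable (by simp) θ)).trans
        (congrArg₂ (· + ·) (deriv_aux f θ).symm (deriv_aux g θ).symm))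
  map_smul' c f := by
    ext x
    induction x using QuotientAddGroup.induction_on with
    | H θ =>
      exact (deriv_aux _ θ).trans ((deriv_fun_const_smul c ((SF.contDiff f).differentiable (by simp) θ)).trans
        (congrArg (c • ·) (deriv_aux f θ).symm))

theorem D_apply (f : SF) (θ : ℝ) : (D f).1 (θ : Torus) = deriv (fun s : ℝ => f.1 (s : Torus)) θ :=
  deriv_aux f θ

theorem hasDerivAt (f : SF) (θ : ℝ) :
    HasDerivAt (fun s : ℝ => f.1 (s : Torus)) ((D f).1 (θ : Torus)) θ := by
  rw [D_apply]
  exact ((SF.contDiff f).differentiable (by simp) θ).hasDerivAt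

theorem eq_D_of_hasDerivAt {f g : SF}
    (h : ∀ θ : ℝ, HasDerivAt (fun s : ℝ => f.1 (s : Torus)) (g.1 (θ : Torus)) θ) : D f = g := by
  ext x
  induction x using QuotientAddGroup.induction_on with
  | H θ => exact ((SF.hasDerivAt f) θ).unique (h θ)

theorem D_mul (f g : SF) : D (f * g) = D f * g + f * D g :=
  eq_D_of_hasDerivAt fun θ => ((SF.hasDerivAt f) θ).mul ((SF.hasDerivAt g) θ)

theorem D_one : D 1 = 0 := eq_D_of_hasDerivAt fun θ => hasDerivAt_const θ 1

theorem integral_D (f : SF) : ∫ x, (D f).1 x = 0 := by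
  rw [← AddCircle.intervalIntegral_preimage (2 * π) 0,
    intervalIntegral.integral_eq_sub_of_hasDerivAt (fun θ _ => (SF.hasDerivAt f) θ)
      (((D f).1.continuous.comp (AddCircle.continuous_mk' _)).intervalIntegrable _ _)]
  have : ((0 + 2 * π : ℝ) : Torus) = ((0 : ℝ) : Torus) := by
    rw [zero_add, AddCircle.coe_period]; rfl
  rw [this, sub_self]

theorem inner_D (f g : SF) : ⟪cL (D f).1, cL g.1⟫_ℝ = -⟪cL f.1, cL (D g).1⟫_ℝ := by
  have h := integral_D (f * g)
  rw [D_mul] at h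
  have e : (fun x => (D f * g + f * D g).1 x) = fun x => (D f).1 x * g.1 x + f.1 x * (D g).1 x := rfl
  rw [inner_cL_cL, inner_cL_cL, eq_neg_iff_add_eq_zero]
  rw [e, integral_add] at h
  · exact h
  · exact ((D f).1 * g.1).continuous.integrable_of_hasCompactSupport
      (HasCompactSupport.of_compactSpace _)
  · exact (f.1 * (D g).1).continuous.integrable_of_hasCompactSupport
      (HasCompactSupport.of_compactSpace _)

theorem isTestPair (f : SF) : IsTestPair f.1 (D f).1 := ⟨(SF.contDiff f), (SF.hasDerivAt f)⟩

end SF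

/-- Test pairs are exactly the pairs `(φ, D φ)` with `φ` in `SF`; in this form the condition is
visibly closed in `L²`. -/
theorem hasWeakDeriv_iff {f g : L2} :
    HasWeakDeriv f g ↔ ∀ φ : SF, ⟪f, cL (SF.D φ).1⟫_ℝ = -⟪g, cL φ.1⟫_ℝ := by
  constructor
  · intro h φ
    rw [inner_cL, inner_cL]
    exact h _ _ (SF.isTestPair φ)
  · intro h φ ψ hφ
    have := h ⟨⟨φ, hφ.continuous_left⟩, hφ.1⟩
    rw [inner_cL, inner_cL] at this
    have e : (SF.D ⟨⟨φ, hφ.continuous_left⟩, hφ.1⟩).1 = ⟨ψ, hφ.continuous_right⟩ := by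
      ext y
      induction y using QuotientAddGroup.induction_on with
      | H θ => exact (SF.hasDerivAt ⟨⟨φ, hφ.continuous_left⟩, hφ.1⟩ θ).unique (hφ.2 θ)
    rw [e] at this
    exact this

theorem hasWeakDeriv_cL (f : SF) : HasWeakDeriv (cL f.1) (cL (SF.D f).1) := by
  rw [hasWeakDeriv_iff]
  intro φ
  rw [SF.inner_D, neg_neg]

/-! ### The Hartley basis of `L²`. -/

theorem fourier_coe_two_pi (n : ℤ) (θ : ℝ) :
    fourier n (θ : Torus) = Complex.exp (((n * θ : ℝ) : ℂ) * Complex.I) := by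
  rw [fourier_coe_apply]
  congr 1
  have : (π : ℂ) ≠ 0 := Complex.ofReal_ne_zero.2 Real.pi_ne_zero
  push_cast
  field_simp

/-- The Hartley functions `cos nθ + sin nθ`, `n ∈ ℤ`. -/
def cas (n : ℤ) : SF :=
  ⟨⟨fun x => (fourier n x : ℂ).re + (fourier n x : ℂ).im, by fun_prop⟩, by
    have e : (fun θ : ℝ => (fourier n (θ : Torus) : ℂ).re + (fourier n (θ : Torus) : ℂ).im) =
        fun θ : ℝ => Real.cos (n * θ) + Real.sin (n * θ) := by
      funext θ
      rw [fourier_coe_two_pi, Complex.exp_ofReal_mul_I_re, Complex.exp_ofReal_mul_I_im]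
    show ContDiff ℝ ((⊤ : ℕ∞) : WithTop ℕ∞) (fun θ : ℝ =>
      (fourier n (θ : Torus) : ℂ).re + (fourier n (θ : Torus) : ℂ).im)
    rw [e]
    fun_prop⟩

theorem cas_coe (n : ℤ) (θ : ℝ) :
    (cas n).1 (θ : Torus) = Real.cos (n * θ) + Real.sin (n * θ) := by
  show (fourier n (θ : Torus) : ℂ).re + (fourier n (θ : Torus) : ℂ).im = _
  rw [fourier_coe_two_pi, Complex.exp_ofReal_mul_I_re, Complex.exp_ofReal_mul_I_im]

theorem SF_ext {f g : SF} (h : ∀ θ : ℝ, f.1 (θ : Torus) = g.1 (θ : Torus)) : f = g := by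
  ext x
  induction x using QuotientAddGroup.induction_on with
  | H θ => exact h θ

theorem cas_zero : cas 0 = 1 := SF_ext fun θ => by
  rw [cas_coe]
  simp

/-- The reason for Hartley functions: they form a real family indexed by `ℤ` on which
differentiation is a multiplier combined with `n ↦ -n`. -/
theorem D_cas (n : ℤ) : SF.D (cas n) = (n : ℝ) • cas (-n) := by
  refine SF.eq_D_of_hasDerivAt fun θ => ?_
  simp only [cas_coe]
  have e : ((n : ℝ) • cas (-n)).1 (θ : Torus) = n * (cas (-n)).1 (θ : Torus) := rfl
  rw [e, cas_coe]
  have h1 : HasDerivAt (fun s : ℝ => (n : ℝ) * s) n θ := by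
    simpa using (hasDerivAt_id θ).const_mul (n : ℝ)
  refine (h1.cos.add h1.sin).congr_deriv ?_
  push_cast
  simp only [neg_mul, Real.cos_neg, Real.sin_neg]
  ring

theorem cas_mul_cas (m n : ℤ) : cas m * cas n =
    (1 / 2 : ℝ) • (cas (m - n) + cas (n - m) + cas (m + n) - cas (-(m + n))) := SF_ext fun θ => by
  have e : (cas m * cas n).1 (θ : Torus) = (cas m).1 (θ : Torus) * (cas n).1 (θ : Torus) := rfl
  have e' : ((1 / 2 : ℝ) • (cas (m - n) + cas (n - m) + cas (m + n) - cas (-(m + n)))).1 (θ : Torus) =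
    1 / 2 * ((cas (m - n)).1 (θ : Torus) + (cas (n - m)).1 (θ : Torus) + (cas (m + n)).1 (θ : Torus)
      - (cas (-(m + n))).1 (θ : Torus)) := rfl
  rw [e, e']
  simp only [cas_coe]
  push_cast
  have h1 : ((m : ℝ) - n) * θ = m * θ - n * θ := by ring
  have h2 : ((n : ℝ) - m) * θ = n * θ - m * θ := by ring
  have h3 : ((m : ℝ) + n) * θ = m * θ + n * θ := by ring
  have h4 : (-((m : ℝ) + n)) * θ = -(m * θ + n * θ) := by ring
  rw [h1, h2, h3, h4, Real.cos_neg, Real.sin_neg]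
  simp only [Real.cos_sub, Real.sin_sub, Real.cos_add, Real.sin_add]
  ring

/-- For `n ≠ 0` the function is, up to a factor, the derivative of `cas (-n)`. -/
theorem integral_cas (n : ℤ) : ∫ x, (cas n).1 x = if n = 0 then 2 * π else 0 := by
  split_ifs with h
  · rw [h, cas_zero]
    have : ∀ x : Torus, (1 : SF).1 x = 1 := fun x => rfl
    simp only [this]
    rw [integral_const, smul_eq_mul, mul_one, Measure.real, AddCircle.measure_univ,
      ENNReal.toReal_ofReal Real.two_pi_pos.le]
  · have h1 := SF.integral_D (cas (-n))
    rw [D_cas, neg_neg] at h1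
    have e : ∀ x, (((-n : ℤ) : ℝ) • cas n).1 x = ((-n : ℤ) : ℝ) * (cas n).1 x := fun x => rfl
    simp only [e] at h1
    rw [integral_const_mul] at h1
    exact (mul_eq_zero.1 h1).resolve_left (by simpa using h)

theorem integrable_continuous (φ : C(Torus, ℝ)) : Integrable (fun x => φ x) :=
  φ.continuous.integrable_of_hasCompactSupport (HasCompactSupport.of_compactSpace _)

theorem integral_cas_mul_cas (m n : ℤ) :
    ∫ x, (cas m).1 x * (cas n).1 x = if m = n then 2 * π else 0 := by
  have e : ∀ x, (cas m).1 x * (cas n).1 x = 1 / 2 * ((cas (m - n)).1 x + (cas (n - m)).1 x +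
      (cas (m + n)).1 x - (cas (-(m + n))).1 x) := fun x =>
    congrArg (fun f : SF => f.1 x) (cas_mul_cas m n)
  simp only [e]
  have hi : ∀ k, Integrable (fun x => (cas k).1 x) := fun k => integrable_continuous _
  have h2 : ∀ k l, Integrable (fun x => (cas k).1 x + (cas l).1 x) := fun k l => (hi k).add (hi l)
  have h3 : ∀ k l j, Integrable (fun x => (cas k).1 x + (cas l).1 x + (cas j).1 x) :=
    fun k l j => (h2 k l).add (hi j)
  rw [integral_const_mul, integral_sub (h3 _ _ _) (hi _), integral_add (h2 _ _) (hi _),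
    integral_add (hi _) (hi _)]
  simp only [integral_cas]
  by_cases h : m = n
  · subst h
    simp
    ring_nf
  · have h1 : m - n ≠ 0 := sub_ne_zero.2 h
    have h2 : n - m ≠ 0 := sub_ne_zero.2 (Ne.symm h)
    simp only [h, h1, h2, neg_eq_zero, if_false]
    ring

/-- The normalised Hartley functions. -/
def eS (n : ℤ) : SF := (√(2 * π))⁻¹ • cas n

theorem eS_coe (n : ℤ) (θ : ℝ) :
    (eS n).1 (θ : Torus) = (√(2 * π))⁻¹ * (Real.cos (n * θ) + Real.sin (n * θ)) := by
  rw [← cas_coe]; rfl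

theorem D_eS (n : ℤ) : SF.D (eS n) = (n : ℝ) • eS (-n) := by
  rw [eS, map_smul, D_cas, smul_comm, eS]

theorem norm_eS_le (n : ℤ) : ‖(eS n).1‖ ≤ 1 := by
  refine (ContinuousMap.norm_le _ zero_le_one).2 fun x => ?_
  induction x using QuotientAddGroup.induction_on with
  | H θ =>
    have h1 : (eS n).1 (QuotientAddGroup.mk θ) = _ := eS_coe n θ
    have hs : 2 ≤ √(2 * π) := Real.le_sqrt_of_sq_le (by nlinarith [Real.pi_gt_three])
    rw [h1, norm_mul, norm_inv, Real.norm_of_nonneg (Real.sqrt_nonneg _), Real.norm_eq_abs,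
      inv_mul_le_iff₀ (by linarith), mul_one]
    have := abs_add_le (Real.cos (n * θ)) (Real.sin (n * θ))
    linarith [Real.abs_cos_le_one (n * θ), Real.abs_sin_le_one (n * θ)]

/-- The Hartley basis of `L²`. -/
def e (n : ℤ) : L2 := cL (eS n).1

theorem orthonormal_e : Orthonormal ℝ e := by
  rw [orthonormal_iff_ite]
  intro m n
  rw [e, e, inner_cL_cL]
  have h1 : ∀ x, (eS m).1 x * (eS n).1 x = ((√(2 * π))⁻¹ * (√(2 * π))⁻¹) *
      ((cas m).1 x * (cas n).1 x) := fun x => by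
    have : ∀ k, (eS k).1 x = (√(2 * π))⁻¹ * (cas k).1 x := fun k => rfl
    rw [this, this]
    ring
  simp only [h1]
  rw [integral_const_mul, integral_cas_mul_cas, ← mul_inv, Real.mul_self_sqrt Real.two_pi_pos.le]
  split_ifs
  · exact inv_mul_cancel₀ Real.two_pi_pos.ne'
  · exact mul_zero _

/-- Completeness is inherited from the complex Fourier basis: real and imaginary parts of a
character are combinations of `cas n` and `cas (-n)`. -/
theorem eq_zero_of_inner_e {f : L2} (h : ∀ n, ⟪e n, f⟫_ℝ = 0) : f = 0 := by
  have hcas : ∀ n, ∫ x, f x * (cas n).1 x = 0 := fun n => by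
    have h1 := h n
    rw [real_inner_comm, e, inner_cL] at h1
    have h2 : ∀ x, f x * (eS n).1 x = (√(2 * π))⁻¹ * (f x * (cas n).1 x) := fun x => by
      have : (eS n).1 x = (√(2 * π))⁻¹ * (cas n).1 x := rfl
      rw [this]; ring
    simp only [h2] at h1
    rw [integral_const_mul] at h1
    exact (mul_eq_zero.1 h1).resolve_left (inv_ne_zero (Real.sqrt_pos.2 Real.two_pi_pos).ne')
  have hint : ∀ φ : C(Torus, ℝ), Integrable (fun x => f x * φ x) := fun φ =>
    integrable_mul_continuous f φ.continuous
  have hg : MemLp (fun x => (f x : ℂ)) 2 (AddCircle.haarAddCircle (T := 2 * π)) := by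
    rw [memLp_haarAddCircle_iff]
    exact (Lp.memLp f).ofReal
  have hzero : hg.toLp _ = 0 := by
    refine fourierBasis.repr.injective ?_
    rw [map_zero]
    ext n
    rw [fourierBasis_repr, fourierCoeff_congr_ae hg.coeFn_toLp, fourierCoeff,
      AddCircle.integral_haarAddCircle]
    have hre : ∀ x : Torus, (fourier (-n) x : ℂ).re = ((cas n).1 x + (cas (-n)).1 x) / 2 := fun x => by
      induction x using QuotientAddGroup.induction_on with
      | H θ =>
        have h1 := cas_coe n θ
        have h2 := cas_coe (-n) θ
        have h3 := fourier_coe_two_pi (-n) θ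
        erw [h1, h2, h3, Complex.exp_ofReal_mul_I_re]
        push_cast
        rw [neg_mul, Real.cos_neg, Real.sin_neg]
        ring
    have him : ∀ x : Torus, (fourier (-n) x : ℂ).im = ((cas (-n)).1 x - (cas n).1 x) / 2 := fun x => by
      induction x using QuotientAddGroup.induction_on with
      | H θ =>
        have h1 := cas_coe n θ
        have h2 := cas_coe (-n) θ
        have h3 := fourier_coe_two_pi (-n) θ
        erw [h1, h2, h3, Complex.exp_ofReal_mul_I_im]
        push_cast
        rw [neg_mul, Real.cos_neg, Real.sin_neg]
        ring
    have hsplit : ∀ x : Torus, (fourier (-n) x : ℂ) • (f x : ℂ) =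
        ((f x * ((1 / 2 : ℝ) • ((cas n).1 + (cas (-n)).1)) x : ℝ) : ℂ) +
        ((f x * ((1 / 2 : ℝ) • ((cas (-n)).1 - (cas n).1)) x : ℝ) : ℂ) * Complex.I := fun x => by
      rw [smul_eq_mul, ← Complex.re_add_im (fourier (-n) x), hre, him]
      simp only [ContinuousMap.smul_apply, ContinuousMap.add_apply, ContinuousMap.sub_apply,
        smul_eq_mul]
      push_cast
      ring
    have hz : ∀ φ : C(Torus, ℝ), ∀ c : ℝ, ∀ m k : ℤ, (∀ x, φ x = (cas m).1 x + c * (cas k).1 x) →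
        ∫ x, f x * ((1 / 2 : ℝ) • φ) x = 0 := fun φ c m k hφ => by
      have h1 : ∀ x, f x * ((1 / 2 : ℝ) • φ) x = 1 / 2 * (f x * (cas m).1 x) +
          1 / 2 * c * (f x * (cas k).1 x) := fun x => by
        rw [ContinuousMap.smul_apply, hφ, smul_eq_mul]; ring
      simp only [h1]
      rw [integral_add ((hint _).const_mul _) ((hint _).const_mul _), integral_const_mul,
        integral_const_mul, hcas, hcas]
      ring
    simp only [hsplit]
    rw [integral_add ((hint _).ofReal) ((hint _).ofReal.mul_const _), integral_mul_const,
      integral_complex_ofReal, integral_complex_ofReal,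
      hz _ 1 n (-n) (fun x => by rw [ContinuousMap.add_apply, one_mul]),
      hz _ (-1) (-n) n (fun x => by rw [ContinuousMap.sub_apply]; ring)]
    simp
  refine (Lp.eq_zero_iff_ae_eq_zero).2 ?_
  have h1 : (fun x => (f x : ℂ)) =ᵐ[AddCircle.haarAddCircle (T := 2 * π)] 0 := by
    refine hg.coeFn_toLp.symm.trans ?_
    rw [hzero]
    exact Lp.coeFn_zero _ _ _
  have h2 : (volume : Measure Torus) ≪ AddCircle.haarAddCircle := by
    rw [AddCircle.volume_eq_smul_haarAddCircle]
    exact Measure.smul_absolutelyContinuous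
  filter_upwards [h2.ae_le h1] with x hx
  simpa using hx

/-- The Hartley basis as a Hilbert basis. -/
def hb : HilbertBasis ℤ ℝ L2 := HilbertBasis.mkOfOrthogonalEqBot orthonormal_e (by
  rw [Submodule.eq_bot_iff]
  intro f hf
  exact eq_zero_of_inner_e fun n =>
    (Submodule.mem_orthogonal _ _).1 hf _ (Submodule.subset_span ⟨n, rfl⟩))

theorem hb_apply (n : ℤ) : hb n = e n := by
  rw [hb, HilbertBasis.coe_mkOfOrthogonalEqBot]

/-- The Hartley coefficients of an `L²` function. -/
def coef (n : ℤ) : L2 →L[ℝ] ℝ := innerSL ℝ (e n)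

theorem coef_apply (n : ℤ) (f : L2) : coef n f = ⟪e n, f⟫_ℝ := rfl

theorem hb_repr (f : L2) (n : ℤ) : hb.repr f n = coef n f := by
  rw [HilbertBasis.repr_apply_apply, hb_apply]; rfl

theorem coef_ext {f g : L2} (h : ∀ n, coef n f = coef n g) : f = g := by
  rw [← sub_eq_zero]
  refine eq_zero_of_inner_e fun n => ?_
  rw [inner_sub_right, sub_eq_zero]
  exact h n

theorem coef_e (m n : ℤ) : coef m (e n) = if m = n then 1 else 0 :=
  orthonormal_iff_ite.1 orthonormal_e m n

theorem hasSum_coef (f : L2) : HasSum (fun n => coef n f • e n) f := by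
  simpa only [hb_repr, hb_apply] using hb.hasSum_repr f

theorem hasSum_coef_mul (f g : L2) : HasSum (fun n => coef n f * coef n g) ⟪f, g⟫_ℝ := by
  have := hb.hasSum_inner_mul_inner f g
  simp only [hb_apply] at this
  simpa only [coef_apply, real_inner_comm] using this

theorem hasSum_coef_sq (f : L2) : HasSum (fun n => coef n f ^ 2) (‖f‖ ^ 2) := by
  rw [← real_inner_self_eq_norm_sq]
  simpa only [sq] using hasSum_coef_mul f f

theorem hasSum_coef_neg_sq (f : L2) : HasSum (fun n : ℤ => coef (-n) f ^ 2) (‖f‖ ^ 2) := by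
  have := (Equiv.neg ℤ).hasSum_iff.2 (hasSum_coef_sq f)
  simpa only [Function.comp_def, Equiv.neg_apply] using this

theorem exists_coef_eq {c : ℤ → ℝ} (hc : Summable fun n => c n ^ 2) :
    ∃ f : L2, ∀ n, coef n f = c n := by
  have hmem : Memℓp c 2 := memℓp_gen (by simpa using hc)
  refine ⟨hb.repr.symm ⟨c, hmem⟩, fun n => ?_⟩
  rw [← hb_repr, LinearIsometryEquiv.apply_symm_apply]

theorem coef_cL_D (f : SF) (n : ℤ) : coef n (cL (SF.D f).1) = -n * coef (-n) (cL f.1) := by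
  rw [coef_apply, coef_apply, real_inner_comm, e, SF.inner_D, D_eS, real_inner_comm]
  have : cL ((n : ℝ) • eS (-n)).1 = (n : ℝ) • e (-n) := cL.map_smul _ _
  rw [this, real_inner_smul_left, neg_mul]

/-- The definition tested with `eS n`, whose derivative is `n • eS (-n)`. -/
theorem HasWeakDeriv.coef_eq {f g : L2} (h : HasWeakDeriv f g) (n : ℤ) :
    coef n g = -n * coef (-n) f := by
  have h1 := hasWeakDeriv_iff.1 h (eS n)
  rw [D_eS] at h1
  have : cL ((n : ℝ) • eS (-n)).1 = (n : ℝ) • e (-n) := cL.map_smul _ _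
  rw [this, real_inner_smul_right, ← e] at h1
  have h2 : ⟪f, e (-n)⟫_ℝ = ⟪e (-n), f⟫_ℝ := real_inner_comm _ _
  have h3 : ⟪g, e n⟫_ℝ = ⟪e n, g⟫_ℝ := real_inner_comm _ _
  rw [coef_apply, coef_apply]
  linear_combination h1 - n * h2 - h3

/-! ### The Hilbert transform and Fourier multipliers. -/

theorem sign_sq_le (n : ℤ) : ((n.sign : ℤ) : ℝ) ^ 2 ≤ 1 := by
  rcases lt_trichotomy n 0 with h | h | h
  · simp [Int.sign_eq_neg_one_of_neg h]
  · simp [h]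
  · simp [Int.sign_eq_one_of_pos h]

theorem summable_hilbert (f : L2) :
    Summable fun n : ℤ => (((n.sign : ℤ) : ℝ) * coef (-n) f) ^ 2 := by
  have h1 : Summable fun n : ℤ => coef (-n) f ^ 2 :=
    (hasSum_coef_neg_sq f).summable
  refine Summable.of_nonneg_of_le (fun n => sq_nonneg _) (fun n => ?_) h1
  rw [mul_pow]
  exact mul_le_of_le_one_left (sq_nonneg _) (sign_sq_le n)

/-- The Hilbert transform on `L²`. -/
def hilbert : L2 →L[ℝ] L2 :=
  LinearMap.mkContinuous
    { toFun := fun f => (exists_coef_eq (summable_hilbert f)).choose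
      map_add' := fun f g => coef_ext fun n => by
        rw [map_add, (exists_coef_eq (summable_hilbert _)).choose_spec,
          (exists_coef_eq (summable_hilbert _)).choose_spec,
          (exists_coef_eq (summable_hilbert _)).choose_spec, map_add, mul_add]
      map_smul' := fun c f => coef_ext fun n => by
        rw [map_smul, (exists_coef_eq (summable_hilbert _)).choose_spec,
          (exists_coef_eq (summable_hilbert _)).choose_spec, map_smul, RingHom.id_apply, smul_eq_mul,
          smul_eq_mul]
        ring } 1 (fun f => by
    rw [LinearMap.coe_mk, AddHom.coe_mk, one_mul]
    have h1 : HasSum (fun n : ℤ => coef (-n) f ^ 2) (‖f‖ ^ 2) :=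
      hasSum_coef_neg_sq f
    have h2 := hasSum_le (fun n => ?_) (hasSum_coef_sq (exists_coef_eq (summable_hilbert f)).choose) h1
    · exact (pow_le_pow_iff_left₀ (norm_nonneg _) (norm_nonneg _) two_ne_zero).1 h2
    · rw [(exists_coef_eq (summable_hilbert f)).choose_spec, mul_pow]
      exact mul_le_of_le_one_left (sq_nonneg _) (sign_sq_le n))

/-- The coefficient form of `H cos nθ = sin nθ`, `H sin nθ = -cos nθ` for `n > 0`, that is, of `H eₙ
= -sign(n) e₋ₙ`. -/
theorem coef_hilbert (f : L2) (n : ℤ) :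
    coef n (hilbert f) = ((n.sign : ℤ) : ℝ) * coef (-n) f :=
  (exists_coef_eq (summable_hilbert f)).choose_spec n

theorem norm_hilbert_le (f : L2) : ‖hilbert f‖ ≤ ‖f‖ := by
  have h1 : HasSum (fun n : ℤ => coef (-n) f ^ 2) (‖f‖ ^ 2) :=
    hasSum_coef_neg_sq f
  have h2 := hasSum_le (fun n => ?_) (hasSum_coef_sq (hilbert f)) h1
  · exact (pow_le_pow_iff_left₀ (norm_nonneg _) (norm_nonneg _) two_ne_zero).1 h2
  · rw [coef_hilbert, mul_pow]
    exact mul_le_of_le_one_left (sq_nonneg _) (sign_sq_le n)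

section Multiplier

variable {m : ℤ → ℝ} (hm : Summable fun n => m n ^ 2)
include hm

/-- Cauchy–Schwarz: a square-summable multiplier turns `L²` functions into absolutely convergent
series, hence into continuous functions. -/
theorem summable_mul_coef_and_le (f : L2) : Summable (fun n => |m n| * |coef n f|) ∧
    ∑' n, |m n| * |coef n f| ≤ √(∑' n, m n ^ 2) * ‖f‖ := by
  have h := Real.summable_and_inner_le_Lp_mul_Lq_tsum_of_nonneg (f := fun n => |m n|)
    (g := fun n => |coef n f|) (p := 2) (q := 2) Real.HolderConjugate.two_two (fun n => abs_nonneg _)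
    (fun n => abs_nonneg _) (by simpa using hm) (by simpa using (hasSum_coef_sq f).summable)
  refine ⟨h.1, h.2.trans (le_of_eq ?_)⟩
  simp only [Real.rpow_two, sq_abs, (hasSum_coef_sq f).tsum_eq]
  rw [← Real.sqrt_eq_rpow, ← Real.sqrt_eq_rpow, Real.sqrt_sq (norm_nonneg _)]

theorem summable_multiplier (s : ℤ → ℤ) (f : L2) :
    Summable fun n => (m n * coef n f) • (eS (s n)).1 := by
  refine Summable.of_norm_bounded (summable_mul_coef_and_le hm f).1 fun n => ?_
  rw [norm_smul, norm_mul, Real.norm_eq_abs, Real.norm_eq_abs]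
  exact mul_le_of_le_one_right (by positivity) (norm_eS_le _)

/-- The operator `f ↦ ∑ mₙ f̂(n) e_{s(n)}` from `L²` to `C(𝕋)`, for a square-summable `m`. -/
def multiplier (s : ℤ → ℤ) : L2 →L[ℝ] C(Torus, ℝ) :=
  LinearMap.mkContinuous
    { toFun := fun f => ∑' n, (m n * coef n f) • (eS (s n)).1
      map_add' := fun f g => by
        rw [← (summable_multiplier hm s f).tsum_add (summable_multiplier hm s g)]
        simp only [map_add, mul_add, add_smul]
      map_smul' := fun c f => by
        rw [RingHom.id_apply, ← (summable_multiplier hm s f).tsum_const_smul]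
        simp only [map_smul, smul_eq_mul, smul_smul]
        congr 1
        funext n
        congr 1
        ring } (√(∑' n, m n ^ 2)) (fun f => by
    rw [LinearMap.coe_mk, AddHom.coe_mk]
    refine le_trans ?_ (summable_mul_coef_and_le hm f).2
    refine tsum_of_norm_bounded (summable_mul_coef_and_le hm f).1.hasSum fun n => ?_
    rw [norm_smul, norm_mul, Real.norm_eq_abs, Real.norm_eq_abs]
    exact mul_le_of_le_one_right (by positivity) (norm_eS_le _))

theorem hasSum_multiplier (s : ℤ → ℤ) (f : L2) :
    HasSum (fun n => (m n * coef n f) • (eS (s n)).1) (multiplier hm s f) :=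
  (summable_multiplier hm s f).hasSum

theorem coef_multiplier (s : ℤ ≃ ℤ) (f : L2) (n : ℤ) :
    coef (s n) (cL (multiplier hm s f)) = m n * coef n f := by
  have h1 := ((hasSum_multiplier hm s f).mapL cL).mapL (coef (s n))
  refine h1.unique ?_
  have h2 : ∀ k, coef (s n) (cL ((m k * coef k f) • (eS (s k)).1)) =
      if k = n then m n * coef n f else 0 := fun k => by
    rw [map_smul, map_smul, ← e, coef_e, smul_eq_mul]
    by_cases h : k = n
    · simp [h]
    · have : s n ≠ s k := fun h' => h (s.injective h').symm
      simp [h, this]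
  simp only [h2]
  exact hasSum_ite_eq n _

end Multiplier

/-! ### Frequency truncation and the Sobolev spaces. -/

/-- The partial sums of the Hartley series. -/
def TN (N : ℕ) : L2 →ₗ[ℝ] SF where
  toFun f := ∑ n ∈ Finset.Icc (-N : ℤ) N, coef n f • eS n
  map_add' f g := by simp only [map_add, add_smul, Finset.sum_add_distrib]
  map_smul' c f := by
    simp only [map_smul, smul_eq_mul, RingHom.id_apply, Finset.smul_sum, smul_smul]

theorem TN_apply (N : ℕ) (f : L2) : TN N f = ∑ n ∈ Finset.Icc (-N : ℤ) N, coef n f • eS n := rfl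

theorem cL_sum {ι : Type*} (s : Finset ι) (c : ι → ℝ) (f : ι → SF) :
    cL (∑ i ∈ s, c i • f i).1 = ∑ i ∈ s, c i • cL (f i).1 := by
  have h : (∑ i ∈ s, c i • f i).1 = ∑ i ∈ s, c i • (f i).1 := by
    simp
  rw [h, map_sum]
  simp only [map_smul]

theorem cL_TN (N : ℕ) (f : L2) : cL (TN N f).1 = ∑ n ∈ Finset.Icc (-N : ℤ) N, coef n f • e n := by
  rw [TN_apply, cL_sum]; rfl

theorem coef_cL_TN (N : ℕ) (f : L2) (n : ℤ) :
    coef n (cL (TN N f).1) = if n ∈ Finset.Icc (-N : ℤ) N then coef n f else 0 := by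
  rw [cL_TN, map_sum]
  simp only [map_smul, coef_e, smul_eq_mul, mul_ite, mul_one, mul_zero]
  rw [Finset.sum_ite_eq]

theorem tendsto_cL_TN (f : L2) : Tendsto (fun N => cL (TN N f).1) atTop (𝓝 f) := by
  simp only [cL_TN]
  have h := (hasSum_coef f)
  have h2 : Tendsto (fun n : ℕ => Finset.Icc (-n : ℤ) n) atTop atTop := Finset.tendsto_Icc_neg
  exact h.comp h2

theorem TN_cL_TN (N : ℕ) (f : L2) : TN N (cL (TN N f).1) = TN N f := by
  show ∑ n ∈ Finset.Icc (-N : ℤ) N, coef n (cL (TN N f).1) • eS n =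
    ∑ n ∈ Finset.Icc (-N : ℤ) N, coef n f • eS n
  refine Finset.sum_congr rfl fun n hn => ?_
  rw [coef_cL_TN, if_pos hn]

theorem inner_cL_TN (N : ℕ) (f g : L2) : ⟪cL (TN N f).1, g⟫_ℝ = ⟪f, cL (TN N g).1⟫_ℝ := by
  have h1 := hasSum_coef_mul (cL (TN N f).1) g
  have h2 := hasSum_coef_mul f (cL (TN N g).1)
  refine h1.unique ?_
  convert h2 using 2 with n
  rw [coef_cL_TN, coef_cL_TN]
  split_ifs <;> simp

theorem sum_Icc_neg {A : Type*} [AddCommMonoid A] (N : ℕ) (f : ℤ → A) :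
    ∑ n ∈ Finset.Icc (-N : ℤ) N, f (-n) = ∑ n ∈ Finset.Icc (-N : ℤ) N, f n :=
  Finset.sum_nbij' (fun n => -n) (fun n => -n) (by simp; omega) (by simp; omega) (by simp)
    (by simp) (by simp)

/-- The frequency range is symmetric, so the reflection caused by differentiation preserves it. -/
theorem D_TN {f g : L2} (h : HasWeakDeriv f g) (N : ℕ) : SF.D (TN N f) = TN N g := by
  rw [TN_apply, TN_apply, map_sum, ← sum_Icc_neg]
  refine Finset.sum_congr rfl fun n _ => ?_
  rw [map_smul, D_eS, h.coef_eq, neg_neg, smul_smul]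
  push_cast
  congr 1
  ring

/-- The discarded frequencies have `|n| ≥ N + 1`, and there `|coef n f| = |coef (-n) g| / |n|`. -/
theorem norm_cL_TN_sub_le {f g : L2} (h : HasWeakDeriv f g) (N : ℕ) :
    ‖cL (TN N f).1 - f‖ ≤ 1 / (N + 1) * ‖g‖ := by
  have h1 : HasSum (fun n : ℤ => (1 / ((N : ℝ) + 1)) ^ 2 * coef (-n) g ^ 2)
      ((1 / ((N : ℝ) + 1)) ^ 2 * ‖g‖ ^ 2) :=
    (hasSum_coef_neg_sq g).mul_left _
  have h2 := hasSum_le (fun n => ?_) (hasSum_coef_sq (cL (TN N f).1 - f)) h1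
  · rw [← mul_pow] at h2
    exact (pow_le_pow_iff_left₀ (norm_nonneg _) (by positivity) two_ne_zero).1 h2
  · rw [map_sub, coef_cL_TN, h.coef_eq, neg_neg]
    split_ifs with hn
    · rw [sub_self, zero_pow two_ne_zero]
      positivity
    · rw [zero_sub, neg_sq, mul_pow, ← mul_assoc]
      refine le_mul_of_one_le_left (sq_nonneg _) ?_
      rw [← mul_pow]
      refine one_le_pow₀ ?_ |>.trans_eq (sq_abs _)
      rw [abs_mul, abs_neg, abs_of_pos (by positivity : (0 : ℝ) < 1 / (N + 1)), one_div_mul_eq_div,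
        one_le_div (by positivity)]
      rw [Finset.mem_Icc, ← abs_le, not_le] at hn
      have h3 : (N : ℤ) + 1 ≤ |n| := hn
      have h4 : ((N : ℝ) + 1) ≤ ((|n| : ℤ) : ℝ) := by exact_mod_cast h3
      push_cast
      rw [abs_neg]
      push_cast at h4
      exact h4

theorem isClosed_sobolev (k : ℕ) : IsClosed (sobolev k : Set (PiLp 2 fun _ : Fin (k + 1) => L2)) := by
  have h : (sobolev k : Set (PiLp 2 fun _ : Fin (k + 1) => L2)) =
      ⋂ j : Fin k, ⋂ φ : SF, {v | ⟪v j.castSucc, cL (SF.D φ).1⟫_ℝ = -⟪v j.succ, cL φ.1⟫_ℝ} := by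
    ext v
    simp only [mem_iInter, mem_ofPred]
    exact forall_congr' fun j => hasWeakDeriv_iff
  rw [h]
  refine isClosed_iInter fun j => isClosed_iInter fun φ => isClosed_eq ?_ ?_
  · fun_prop
  · fun_prop

instance completeSpace_Hk (k : ℕ) : CompleteSpace (Hk k) :=
  (isClosed_sobolev k).completeSpace_coe

namespace Hk

variable {k : ℕ}

theorem hasWeakDeriv (v : Hk k) {j : ℕ} (hj : j + 1 ≤ k) :
    HasWeakDeriv (v.wderiv j (by omega)) (v.wderiv (j + 1) hj) := v.2 ⟨j, hj⟩

/-- The `j`-th weak derivative as a continuous linear map. -/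
def wderivL (j : ℕ) (hj : j ≤ k) : Hk k →L[ℝ] L2 :=
  (PiLp.proj 2 (fun _ : Fin (k + 1) => L2) ⟨j, Nat.lt_succ_of_le hj⟩).comp (sobolev k).subtypeL

/-- The underlying `L²` function as a continuous linear map. -/
def valL : Hk k →L[ℝ] L2 := wderivL 0 (Nat.zero_le k)

theorem valL_apply (v : Hk k) : valL v = v.val := rfl

theorem norm_wderiv_le (v : Hk k) (j : ℕ) (hj : j ≤ k) : ‖v.wderiv j hj‖ ≤ ‖v‖ :=
  PiLp.norm_apply_le v.1 _

theorem norm_val_le (v : Hk k) : ‖v.val‖ ≤ ‖v‖ := norm_wderiv_le v 0 _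

theorem inner_def (v w : Hk k) : ⟪v, w⟫_ℝ = ∑ j : Fin (k + 1), ⟪v.1 j, w.1 j⟫_ℝ := by
  rw [Submodule.coe_inner, PiLp.inner_apply]

theorem norm_sq_eq (v : Hk k) : ‖v‖ ^ 2 = ∑ j : Fin (k + 1), ‖v.1 j‖ ^ 2 := by
  rw [Submodule.coe_norm, PiLp.norm_sq_eq_of_L2]

/-- The coefficients of a function determine those of all its weak derivatives. -/
theorem val_injective : Function.Injective (val : Hk k → L2) := by
  intro v w h
  have : ∀ j (hj : j ≤ k), v.wderiv j hj = w.wderiv j hj := by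
    intro j
    induction j with
    | zero => intro _; exact h
    | succ j ih =>
      intro hj
      refine coef_ext fun n => ?_
      rw [(v.hasWeakDeriv hj).coef_eq, (w.hasWeakDeriv hj).coef_eq, ih]
  refine Subtype.ext ?_
  ext1 j
  exact this j.1 (Nat.le_of_lt_succ j.2)

/-- The smooth functions in `H^k`. -/
def emb (k : ℕ) : SF →ₗ[ℝ] Hk k where
  toFun f := ⟨WithLp.toLp 2 fun j => cL (SF.D^[j] f).1, fun j => by
    show HasWeakDeriv (cL (SF.D^[(j : ℕ)] f).1) (cL (SF.D^[(j : ℕ) + 1] f).1)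
    rw [Function.iterate_succ_apply']
    exact hasWeakDeriv_cL _⟩
  map_add' f g := by
    refine Subtype.ext ?_
    ext1 j
    show cL (SF.D^[(j : ℕ)] (f + g)).1 = cL (SF.D^[(j : ℕ)] f).1 + cL (SF.D^[(j : ℕ)] g).1
    rw [iterate_map_add, ← map_add]
    rfl
  map_smul' c f := by
    refine Subtype.ext ?_
    ext1 j
    show cL (SF.D^[(j : ℕ)] (c • f)).1 = c • cL (SF.D^[(j : ℕ)] f).1
    rw [← Module.End.pow_apply, ← Module.End.pow_apply]
    exact (congrArg (fun g : SF => cL g.1) (map_smul (SF.D ^ (j : ℕ)) c f)).trans (cL.map_smul c _)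

theorem emb_wderiv (f : SF) (j : ℕ) (hj : j ≤ k) : (emb k f).wderiv j hj = cL (SF.D^[j] f).1 := rfl

theorem emb_val (f : SF) : (emb k f).val = cL f.1 := rfl

/-- The truncation to frequencies `|n| ≤ N`, as a map `L² → H^k`. -/
def trunc (k N : ℕ) : L2 →L[ℝ] Hk k :=
  ∑ n ∈ Finset.Icc (-N : ℤ) N, (coef n).smulRight (emb k (eS n))

theorem trunc_apply (N : ℕ) (f : L2) : trunc k N f = emb k (TN N f) := by
  rw [trunc, TN_apply, map_sum, sum_apply]
  refine Finset.sum_congr rfl fun n _ => ?_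
  rw [ContinuousLinearMap.smulRight_apply, map_smul]

theorem iterate_D_TN (v : Hk k) (N j : ℕ) (hj : j ≤ k) :
    SF.D^[j] (TN N v.val) = TN N (v.wderiv j hj) := by
  induction j with
  | zero => rfl
  | succ j ih => rw [Function.iterate_succ_apply', ih (by omega), D_TN (v.hasWeakDeriv hj)]

theorem trunc_val_wderiv (v : Hk k) (N j : ℕ) (hj : j ≤ k) :
    (trunc k N v.val).wderiv j hj = cL (TN N (v.wderiv j hj)).1 := by
  rw [trunc_apply, emb_wderiv, iterate_D_TN]

theorem trunc_val (N : ℕ) (f : L2) : (trunc k N f).val = cL (TN N f).1 := by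
  rw [trunc_apply, emb_val]

theorem trunc_idem (N : ℕ) (f : L2) : trunc k N (trunc k N f).val = trunc k N f := by
  rw [trunc_val, trunc_apply, TN_cL_TN, trunc_apply]

/-- Truncation commutes with weak derivatives, so its symmetry in `L²` holds in each component of
the `H^k` inner product. -/
theorem inner_trunc (N : ℕ) (v w : Hk k) : ⟪trunc k N v.val, w⟫_ℝ = ⟪v, trunc k N w.val⟫_ℝ := by
  rw [inner_def, inner_def]
  refine Finset.sum_congr rfl fun j _ => ?_
  have h1 := trunc_val_wderiv v N j (Nat.le_of_lt_succ j.2)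
  have h2 := trunc_val_wderiv w N j (Nat.le_of_lt_succ j.2)
  have h3 : (trunc k N v.val).1 j = _ := h1
  have h4 : (trunc k N w.val).1 j = _ := h2
  rw [h3, h4]
  exact inner_cL_TN _ _ _

theorem norm_trunc_le (N : ℕ) (v : Hk k) : ‖trunc k N v.val‖ ≤ ‖v‖ := by
  have h1 : ‖trunc k N v.val‖ ^ 2 = ⟪v, trunc k N v.val⟫_ℝ := by
    rw [← real_inner_self_eq_norm_sq, inner_trunc, trunc_idem]
  have h2 := real_inner_le_norm v (trunc k N v.val)
  rcases eq_or_lt_of_le (norm_nonneg (trunc k N v.val)) with h | h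
  · rw [← h]; exact norm_nonneg _
  · exact le_of_mul_le_mul_right (by rw [← sq, h1]; exact h2) h

theorem tendsto_trunc (v : Hk k) : Tendsto (fun N => trunc k N v.val) atTop (𝓝 v) := by
  rw [tendsto_subtype_rng]
  refine (PiLp.continuous_toLp 2 (fun _ : Fin (k + 1) => L2)).tendsto (WithLp.ofLp v.1) |>.comp
    (f := fun N => WithLp.ofLp (trunc k N v.val).1) ?_
  rw [tendsto_pi_nhds]
  intro j
  have h : ∀ N, (trunc k N v.val).1 j = cL (TN N (v.1 j)).1 := fun N =>
    trunc_val_wderiv v N j (Nat.le_of_lt_succ j.2)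
  simp only [h]
  exact tendsto_cL_TN _

theorem norm_trunc_sub_le (hk : 1 ≤ k) (N : ℕ) (v : Hk k) :
    ‖(trunc k N v.val).val - v.val‖ ≤ 1 / (N + 1) * ‖v‖ := by
  rw [trunc_val]
  refine (norm_cL_TN_sub_le (v.hasWeakDeriv (j := 0) hk) N).trans ?_
  exact mul_le_mul_of_nonneg_left (norm_wderiv_le v 1 hk) (by positivity)

theorem incl_trunc {m : ℕ} (hm : m ≤ k) (N : ℕ) (f : L2) : (trunc k N f).incl hm = trunc m N f := by
  rw [trunc_apply, trunc_apply]
  rfl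

theorem norm_incl_le {m : ℕ} (hm : m ≤ k) (v : Hk k) : ‖v.incl hm‖ ≤ ‖v‖ := by
  refine (pow_le_pow_iff_left₀ (norm_nonneg _) (norm_nonneg _) two_ne_zero).1 ?_
  rw [norm_sq_eq, norm_sq_eq]
  have h : ∀ j : Fin (m + 1), ‖(v.incl hm).1 j‖ ^ 2 =
      (fun j : Fin (k + 1) => ‖v.1 j‖ ^ 2) (Fin.castLE (by omega) j) := fun j => rfl
  rw [Finset.sum_congr rfl fun j _ => h j, ← Finset.sum_image
    (f := fun j : Fin (k + 1) => ‖v.1 j‖ ^ 2) (fun a _ b _ hab => Fin.castLE_injective _ hab)]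
  exact Finset.sum_le_sum_of_subset_of_nonneg (Finset.subset_univ _) fun _ _ _ => sq_nonneg _

/-- The inclusion `H^k ⊆ H^m` as a continuous linear map. -/
def inclL {m : ℕ} (hm : m ≤ k) : Hk k →L[ℝ] Hk m :=
  LinearMap.mkContinuous
    { toFun := incl hm
      map_add' := fun _ _ => rfl
      map_smul' := fun _ _ => rfl } 1 (fun v => by
    rw [one_mul]
    exact norm_incl_le hm v)

theorem inclL_apply {m : ℕ} (hm : m ≤ k) (v : Hk k) : inclL hm v = v.incl hm := rfl

end Hk

/-! ### The velocity, continuous representatives and integration by parts. -/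

theorem summable_inv_sq : Summable fun n : ℤ => (-(n : ℝ)⁻¹) ^ 2 := by
  have := Real.summable_one_div_int_pow.2 (one_lt_two)
  simpa using this

/-- With `0⁻¹ = 0` the zero frequency drops out, so that these multipliers invert differentiation
off the mean. -/
theorem summable_inv_abs_sq : Summable fun n : ℤ => (|(n : ℝ)|⁻¹) ^ 2 := by
  simpa using summable_inv_sq

/-- `∑ |n|⁻¹ f̂(n) eₙ`. -/
def absInv : L2 →L[ℝ] C(Torus, ℝ) := multiplier summable_inv_abs_sq (Equiv.refl ℤ)

theorem coef_absInv (f : L2) (n : ℤ) : coef n (cL (absInv f)) = |(n : ℝ)|⁻¹ * coef n f :=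
  coef_multiplier summable_inv_abs_sq (Equiv.refl ℤ) f n

/-- The velocity `u` with `u_θ = Hf` and `u(0) = 0`. -/
def vel : L2 →L[ℝ] C(Torus, ℝ) :=
  -- The derivative of `-|n|⁻¹ eₙ` is `-sign(n) e₋ₙ = H eₙ`; the constant only normalises the value
  -- at 0.
  ((ContinuousMap.evalCLM ℝ (0 : Torus)).comp absInv).smulRight 1 - absInv

theorem vel_apply (f : L2) : vel f = (absInv f 0) • 1 - absInv f := rfl

theorem coef_cL_one {n : ℤ} (hn : n ≠ 0) : coef n (cL 1) = 0 := by
  have h := coef_cL_D (1 : SF) (-n)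
  rw [SF.D_one, neg_neg] at h
  have h0 : cL (0 : SF).1 = 0 := cL.map_zero
  rw [h0, map_zero] at h
  have h1 : coef n (cL (1 : SF).1) = 0 := by
    have h2 := (mul_eq_zero.1 h.symm).resolve_left (by simpa using hn)
    exact h2
  exact h1

theorem mul_inv_abs_eq_sign (n : ℤ) : (n : ℝ) * |(n : ℝ)|⁻¹ = ((n.sign : ℤ) : ℝ) := by
  rcases lt_trichotomy n 0 with h | h | h
  · have h' : (n : ℝ) < 0 := by exact_mod_cast h
    rw [Int.sign_eq_neg_one_of_neg h, abs_of_neg h', inv_neg, mul_neg, mul_inv_cancel₀ h'.ne]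
    simp
  · simp [h]
  · have h' : (0 : ℝ) < n := by exact_mod_cast h
    rw [Int.sign_eq_one_of_pos h, abs_of_pos h', mul_inv_cancel₀ h'.ne']
    simp

/-- A smooth velocity has the Hilbert transform as its derivative. -/
theorem cL_D_of_eq_vel {u : SF} {f : L2} (h : u.1 = vel f) : cL (SF.D u).1 = hilbert f := by
  refine coef_ext fun n => ?_
  rw [coef_cL_D, coef_hilbert, h, vel_apply, map_sub, map_sub, map_smul, map_smul, coef_absInv]
  rcases eq_or_ne n 0 with rfl | hn
  · simp
  · rw [coef_cL_one (neg_ne_zero.2 hn), smul_zero, zero_sub, ← mul_inv_abs_eq_sign]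
    push_cast
    rw [abs_neg]
    ring

theorem vel_TN_mem (N : ℕ) (f : L2) : vel (cL (TN N f).1) ∈ SF := by
  have he : ∀ n, absInv (e n) = |(n : ℝ)|⁻¹ • (eS n).1 := fun n => by
    refine cL_injective (coef_ext fun m => ?_)
    rw [coef_absInv, map_smul, map_smul, ← e, coef_e, smul_eq_mul]
    split_ifs with h
    · rw [h]
    · simp
  rw [cL_TN, map_sum]
  refine sum_mem fun n _ => ?_
  rw [map_smul, vel_apply, he]
  exact Subalgebra.smul_mem _ (Subalgebra.sub_mem _ (Subalgebra.smul_mem _ (one_mem _) _)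
    (Subalgebra.smul_mem _ (eS n).2 _)) _

theorem cL_D_of_cL_eq_hilbert {h f : SF} (hf : cL h.1 = hilbert (cL f.1)) :
    cL (SF.D h).1 = hilbert (cL (SF.D f).1) := by
  refine coef_ext fun n => ?_
  rw [coef_cL_D, coef_hilbert, hf, coef_hilbert, coef_cL_D, neg_neg, Int.sign_neg]
  push_cast
  ring

theorem cL_iterate_D_of_cL_eq_hilbert {h f : SF} (hf : cL h.1 = hilbert (cL f.1)) (j : ℕ) :
    cL (SF.D^[j] h).1 = hilbert (cL (SF.D^[j] f).1) := by
  induction j with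
  | zero => exact hf
  | succ j ih =>
    rw [Function.iterate_succ_apply', Function.iterate_succ_apply']
    exact cL_D_of_cL_eq_hilbert ih

theorem tendsto_clm_apply₂ {E F G : Type*} [NormedAddCommGroup E] [NormedSpace ℝ E]
    [NormedAddCommGroup F] [NormedSpace ℝ F] [NormedAddCommGroup G] [NormedSpace ℝ G]
    (B : E →L[ℝ] F →L[ℝ] G) {x : ℕ → E} {y : ℕ → F} {x₀ : E} {y₀ : F}
    (hx : Tendsto x atTop (𝓝 x₀)) (hy : Tendsto y atTop (𝓝 y₀)) :
    Tendsto (fun N => B (x N) (y N)) atTop (𝓝 (B x₀ y₀)) :=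
  (B.isBoundedBilinearMap.continuous.tendsto (x₀, y₀)).comp (hx.prodMk_nhds hy)

section Continuous

variable {k : ℕ} (hk : 1 ≤ k)

/-- The continuous representative of an `H¹` function. -/
def ev : Hk k →L[ℝ] C(Torus, ℝ) :=
  -- The relation between the coefficients of `v` and of its derivative, solved for `v`; it misses
  -- the mean, which the first summand restores.
  ((coef 0).comp Hk.valL).smulRight (eS 0).1 +
    (multiplier summable_inv_sq (Equiv.neg ℤ)).comp (Hk.wderivL 1 hk)

theorem cL_ev (v : Hk k) : cL (ev hk v) = v.val := by
  refine coef_ext fun n => ?_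
  have h1 : ev hk v = coef 0 v.val • (eS 0).1 +
    multiplier summable_inv_sq (Equiv.neg ℤ) (v.wderiv 1 hk) := rfl
  have h2 : coef n (cL (multiplier summable_inv_sq (Equiv.neg ℤ) (v.wderiv 1 hk))) =
      -((-n : ℤ) : ℝ)⁻¹ * coef (-n) (v.wderiv 1 hk) :=
    (congrArg (fun j => coef j _) (neg_neg n).symm).trans
      (coef_multiplier summable_inv_sq (Equiv.neg ℤ) (v.wderiv 1 hk) (-n))
  have h3 : coef (-n) (v.wderiv 1 hk) = -((-n : ℤ) : ℝ) * coef (- -n) v.val :=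
    (v.hasWeakDeriv (j := 0) hk).coef_eq (-n)
  rw [h1, map_add, map_add, map_smul, map_smul, h2, ← e, coef_e, h3, neg_neg]
  rcases eq_or_ne n 0 with rfl | hn
  · simp
  · have hn' : (n : ℝ) ≠ 0 := by exact_mod_cast hn
    rw [if_neg hn, smul_zero, zero_add]
    push_cast
    rw [inv_neg, neg_neg, neg_neg, inv_mul_cancel_left₀ hn']

theorem ev_of_val_eq {v : Hk k} {φ : C(Torus, ℝ)} (h : v.val = cL φ) : ev hk v = φ :=
  cL_injective ((cL_ev hk v).trans h)

/-- The continuous representative of the Hilbert transform of an `H¹` function. -/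
def evH : Hk k →L[ℝ] C(Torus, ℝ) := -absInv.comp (Hk.wderivL 1 hk)

theorem evH_apply (v : Hk k) : evH hk v = -absInv (v.wderiv 1 hk) := rfl

/-- As `n · |n|⁻¹ = sign n`, the Hilbert transform is `-|D|⁻¹` applied to the derivative, which
makes it continuous on `H¹`. -/
theorem cL_evH (v : Hk k) : cL (evH hk v) = hilbert v.val := by
  refine coef_ext fun n => ?_
  have h3 : coef n (v.wderiv 1 hk) = -n * coef (-n) v.val :=
    (v.hasWeakDeriv (j := 0) hk).coef_eq n
  rw [evH_apply, map_neg, map_neg, coef_absInv, coef_hilbert, h3, ← mul_inv_abs_eq_sign]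
  ring

/-- Integration by parts in the transport term. -/
theorem inner_transport (v w z : Hk k) :
    ⟪M (vel w.val) (v.wderiv 1 hk), z.val⟫_ℝ + ⟪M (vel w.val) v.val, z.wderiv 1 hk⟫_ℝ +
      ⟪M (evH hk w) v.val, z.val⟫_ℝ = 0 := by
  have hP : ∀ y : Hk k, Tendsto (fun N => Hk.trunc k N y.val) atTop (𝓝 y) := Hk.tendsto_trunc
  have hval : ∀ y : Hk k, Tendsto (fun N => (Hk.trunc k N y.val).val) atTop (𝓝 y.val) := fun y =>
    (Hk.valL.continuous.tendsto y).comp (hP y)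
  have hder : ∀ y : Hk k, Tendsto (fun N => (Hk.trunc k N y.val).wderiv 1 hk) atTop
      (𝓝 (y.wderiv 1 hk)) := fun y => ((Hk.wderivL 1 hk).continuous.tendsto y).comp (hP y)
  have hU : Tendsto (fun N => vel (Hk.trunc k N w.val).val) atTop (𝓝 (vel w.val)) :=
    (vel.continuous.tendsto _).comp (hval w)
  have hE : Tendsto (fun N => evH hk (Hk.trunc k N w.val)) atTop (𝓝 (evH hk w)) :=
    ((evH hk).continuous.tendsto w).comp (hP w)
  have l1 := (tendsto_clm_apply₂ M hU (hder v)).inner (𝕜 := ℝ) (hval z)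
  have l2 := (tendsto_clm_apply₂ M hU (hval v)).inner (𝕜 := ℝ) (hder z)
  have l3 := (tendsto_clm_apply₂ M hE (hval v)).inner (𝕜 := ℝ) (hval z)
  refine tendsto_nhds_unique ((l1.add l2).add l3) ?_
  -- All terms are continuous in `H^k`, so trigonometric polynomials suffice; there the identity is
  -- integration by parts of `u f` against `g`.
  refine tendsto_const_nhds.congr fun N => ?_
  set f := TN N v.val
  set g := TN N z.val
  set u : SF := ⟨_, vel_TN_mem N w.val⟩
  have hh : evH hk (Hk.trunc k N w.val) = (SF.D u).1 :=
    cL_injective (by rw [cL_evH, Hk.trunc_val, cL_D_of_eq_vel]; rfl)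
  have hd : ∀ y : Hk k, (Hk.trunc k N y.val).wderiv 1 hk = cL (SF.D (TN N y.val)).1 := fun y => by
    rw [Hk.trunc_apply, Hk.emb_wderiv]; rfl
  simp only [hh, hd, Hk.trunc_val, M_cL]
  have h1 := SF.inner_D (u * f) g
  rw [SF.D_mul] at h1
  have e1 : (SF.D u * f + u * SF.D f).1 = (SF.D u).1 * f.1 + u.1 * (SF.D f).1 := rfl
  have e2 : (u * f).1 = u.1 * f.1 := rfl
  rw [e1, e2, map_add, inner_add_left] at h1
  linarith

end Continuous

/-! ### Product, commutator and energy estimates for smooth functions. -/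

namespace SF

theorem norm_cL_mul_le (f g : SF) : ‖cL (f * g).1‖ ≤ ‖f.1‖ * ‖cL g.1‖ := by
  have h : cL (f * g).1 = M f.1 (cL g.1) := (M_cL _ _).symm
  rw [h]
  exact norm_M_le _ _

theorem norm_cL_mul_le' (f g : SF) : ‖cL (f * g).1‖ ≤ ‖g.1‖ * ‖cL f.1‖ := by
  have h : f * g = g * f := mul_comm f g
  rw [h]
  exact norm_cL_mul_le g f

theorem iterate_D_add (j : ℕ) (f g : SF) : D^[j] (f + g) = D^[j] f + D^[j] g :=
  iterate_map_add D j f g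

theorem iterate_D_smul (j : ℕ) (c : ℝ) (f : SF) : D^[j] (c • f) = c • D^[j] f := by
  rw [← Module.End.pow_apply, ← Module.End.pow_apply, map_smul]

theorem cL_add (f g : SF) : cL (f + g).1 = cL f.1 + cL g.1 := cL.map_add _ _

theorem cL_smul (c : ℝ) (f : SF) : cL (c • f).1 = c • cL f.1 := cL.map_smul _ _

/-- Leibniz's rule without binomial coefficients: each differentiation doubles the number of terms.
-/
theorem norm_iterate_D_mul_le (j : ℕ) {K : ℝ} : ∀ {f g : SF},
    (∀ i l, i + l = j → ‖cL (D^[i] f * D^[l] g).1‖ ≤ K) → ‖cL (D^[j] (f * g)).1‖ ≤ 2 ^ j * K := by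
  induction j with
  | zero =>
    intro f g h
    simpa using h 0 0 rfl
  | succ j ih =>
    intro f g h
    rw [Function.iterate_succ_apply, D_mul, iterate_D_add, cL_add]
    have h1 := ih (f := D f) (g := g) fun i l hil => by
      rw [← Function.iterate_succ_apply]; exact h _ _ (by omega)
    have h2 := ih (f := f) (g := D g) fun i l hil => by
      rw [← Function.iterate_succ_apply]; exact h _ _ (by omega)
    refine (norm_add_le _ _).trans ?_
    rw [pow_succ]
    linarith

/-- Subtracting the term in which all derivatives fall on `g` leaves only terms with a derivative on
`u`, so no bound on `u` itself enters. -/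
theorem norm_iterate_D_commutator_le (j : ℕ) {K : ℝ} (hK : 0 ≤ K) : ∀ {u g : SF},
    (∀ i l, i + 1 + l = j → ‖cL (D^[i + 1] u * D^[l] g).1‖ ≤ K) →
    ‖cL (D^[j] (u * g)).1 - cL (u * D^[j] g).1‖ ≤ 2 ^ j * K := by
  induction j with
  | zero =>
    intro u g _
    simpa using hK
  | succ j ih =>
    intro u g h
    rw [Function.iterate_succ_apply, D_mul, iterate_D_add, cL_add, Function.iterate_succ_apply]
    have h1 := norm_iterate_D_mul_le j (f := D u) (g := g) (K := K) fun i l hil => by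
      rw [← Function.iterate_succ_apply]; exact h _ _ (by omega)
    have h2 := ih (u := u) (g := D g) fun i l hil => by
      rw [← Function.iterate_succ_apply D l]; exact h _ _ (by omega)
    rw [add_sub_assoc]
    refine (norm_add_le _ _).trans ?_
    rw [pow_succ]
    linarith

/-- Twice the constant of the Sobolev embedding `H¹ ⊆ C`. -/
def sob : ℝ := 2 * ‖ev (k := 1) le_rfl‖

theorem sob_nonneg : 0 ≤ sob := by unfold sob; positivity

theorem norm_le_of_forall_norm_le {k : ℕ} {v : Hk k} {K : ℝ} (hK : 0 ≤ K)
    (h : ∀ j (hj : j ≤ k), ‖v.wderiv j hj‖ ≤ K) : ‖v‖ ≤ (k + 1) * K := by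
  refine (pow_le_pow_iff_left₀ (norm_nonneg _) (by positivity) two_ne_zero).1 ?_
  rw [Hk.norm_sq_eq]
  have h1 : ∀ j : Fin (k + 1), ‖v.1 j‖ ^ 2 ≤ K ^ 2 := fun j =>
    pow_le_pow_left₀ (norm_nonneg _) (h j.1 (Nat.le_of_lt_succ j.2)) 2
  refine (Finset.sum_le_sum fun j _ => h1 j).trans ?_
  rw [Finset.sum_const, Finset.card_univ, Fintype.card_fin, nsmul_eq_mul, mul_pow]
  push_cast
  refine mul_le_mul_of_nonneg_right ?_ (sq_nonneg _)
  nlinarith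

theorem norm_le_sob {f : SF} {a : ℝ} (ha : 0 ≤ a) (h0 : ‖cL f.1‖ ≤ a) (h1 : ‖cL (D f).1‖ ≤ a) :
    ‖f.1‖ ≤ sob * a := by
  have e : ev (k := 1) le_rfl (Hk.emb 1 f) = f.1 := ev_of_val_eq le_rfl (Hk.emb_val f)
  have h2 := (ev (k := 1) le_rfl).le_opNorm (Hk.emb 1 f)
  have h3 : ‖Hk.emb 1 f‖ ≤ ((1 : ℕ) + 1) * a := norm_le_of_forall_norm_le ha fun j hj => by
    interval_cases j
    · exact h0
    · exact h1
  rw [e] at h2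
  calc ‖f.1‖ ≤ ‖ev (k := 1) le_rfl‖ * (((1 : ℕ) + 1) * a) := h2.trans (by gcongr)
    _ = sob * a := by rw [sob]; push_cast; ring

/-- All derivatives up to order `k` are bounded by `a` in `L²`. -/
def Bdd (k : ℕ) (f : SF) (a : ℝ) : Prop := ∀ j ≤ k, ‖cL (D^[j] f).1‖ ≤ a

theorem Bdd.nonneg {k : ℕ} {f : SF} {a : ℝ} (h : Bdd k f a) : 0 ≤ a :=
  (norm_nonneg _).trans (h 0 (Nat.zero_le k))

theorem Bdd.norm_le {k : ℕ} {f : SF} {a : ℝ} (h : Bdd k f a) {i : ℕ} (hi : i + 1 ≤ k) :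
    ‖(D^[i] f).1‖ ≤ sob * a :=
  norm_le_sob h.nonneg (h i (by omega)) (by
    rw [← Function.iterate_succ_apply' D]; exact h (i + 1) hi)

/-- A factor with fewer than `k` derivatives goes into the sup norm. If all `k` fall on `f`, none
falls on `g`, and `k ≥ 1` lets `g` take that place. -/
theorem Bdd.mul {k : ℕ} (hk : 1 ≤ k) {f g : SF} {a b : ℝ} (hf : Bdd k f a) (hg : Bdd k g b) {j : ℕ}
    (hj : j ≤ k) : ‖cL (D^[j] (f * g)).1‖ ≤ 2 ^ j * (sob * a * b) := by
  refine norm_iterate_D_mul_le j fun i l hil => ?_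
  have hs := sob_nonneg
  have ha := hf.nonneg
  have hb := hg.nonneg
  by_cases hi : i + 1 ≤ k
  · refine (norm_cL_mul_le _ _).trans ?_
    exact mul_le_mul (hf.norm_le hi) (hg l (by omega)) (norm_nonneg _) (by positivity)
  · refine (norm_cL_mul_le' _ _).trans ?_
    have h1 := mul_le_mul (hg.norm_le (i := l) (by omega)) (hf i (by omega)) (norm_nonneg _)
      (by positivity)
    linarith

/-- `D u`, with at most `k - 1` further derivatives, goes into the sup norm; `f` then carries at
most `k` derivatives in `L²`. -/
theorem Bdd.commutator {k : ℕ} {u f : SF} {a b : ℝ} (hf : Bdd k f a) (hu : Bdd k (D u) b) {j : ℕ}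
    (hj : j ≤ k) :
    ‖cL (D^[j] (u * D f)).1 - cL (u * D^[j] (D f)).1‖ ≤ 2 ^ j * (sob * a * b) := by
  have hs := sob_nonneg
  have ha := hf.nonneg
  have hb := hu.nonneg
  refine norm_iterate_D_commutator_le j (by positivity) fun i l hil => ?_
  refine (norm_cL_mul_le _ _).trans ?_
  have e1 : D^[i + 1] u = D^[i] (D u) := Function.iterate_succ_apply D i u
  have e2 : D^[l] (D f) = D^[l + 1] f := (Function.iterate_succ_apply D l f).symm
  rw [e1, e2]
  have h1 := mul_le_mul (hu.norm_le (i := i) (by omega)) (hf (l + 1) (by omega)) (norm_nonneg _)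
    (by positivity)
  linarith

/-- The cancellation behind the energy estimate: the derivative on `y` is traded for one on `u`. -/
theorem inner_mul_D (u y : SF) :
    2 * ⟪cL y.1, cL (u * D y).1⟫_ℝ = -⟪cL y.1, cL (D u * y).1⟫_ℝ := by
  have h1 := inner_D (u * y) y
  rw [D_mul, cL_add, inner_add_left] at h1
  have h2 : ⟪cL (u * y).1, cL (D y).1⟫_ℝ = ⟪cL y.1, cL (u * D y).1⟫_ℝ := by
    have e1 : cL (u * y).1 = M u.1 (cL y.1) := (M_cL _ _).symm
    have e2 : cL (u * D y).1 = M u.1 (cL (D y).1) := (M_cL _ _).symm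
    rw [e1, e2, inner_M_left]
  have h3 := real_inner_comm (cL (u * D y).1) (cL y.1)
  have h4 := real_inner_comm (cL (D u * y).1) (cL y.1)
  linarith

/-- The energy estimate for the transport term. -/
theorem Bdd.abs_inner_transport_le {k : ℕ} (hk : 1 ≤ k) {u f : SF} {a b : ℝ} (hf : Bdd k f a)
    (hu : Bdd k (D u) b) {j : ℕ} (hj : j ≤ k) :
    |⟪cL (D^[j] f).1, cL (D^[j] (u * D f)).1⟫_ℝ| ≤ (1 + 2 ^ j) * (sob * a ^ 2 * b) := by
  have hs := sob_nonneg
  have ha := hf.nonneg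
  have hb := hu.nonneg
  set y := D^[j] f with hy
  have hya : ‖cL y.1‖ ≤ a := hf j hj
  have h1 := inner_mul_D u y
  have e : D^[j] (D f) = D y := by rw [hy, ← Function.iterate_succ_apply, Function.iterate_succ_apply']
  have h2 := hf.commutator hu hj
  rw [e] at h2
  have h3 : ⟪cL y.1, cL (D^[j] (u * D f)).1⟫_ℝ = ⟪cL y.1, cL (u * D y).1⟫_ℝ +
      ⟪cL y.1, cL (D^[j] (u * D f)).1 - cL (u * D y).1⟫_ℝ := by rw [inner_sub_right]; ring
  have h4 : |⟪cL y.1, cL (D u * y).1⟫_ℝ| ≤ a * (sob * b * a) := by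
    refine (abs_real_inner_le_norm _ _).trans (mul_le_mul hya ?_ (norm_nonneg _) ha)
    exact (norm_cL_mul_le _ _).trans
      (mul_le_mul (hu.norm_le (i := 0) hk) hya (norm_nonneg _) (by positivity))
  have h5 : |⟪cL y.1, cL (D^[j] (u * D f)).1 - cL (u * D y).1⟫_ℝ| ≤ a * (2 ^ j * (sob * a * b)) :=
    (abs_real_inner_le_norm _ _).trans (mul_le_mul hya h2 (norm_nonneg _) ha)
  rw [h3]
  rw [abs_le] at h4 h5 ⊢
  have h6 : (0 : ℝ) ≤ sob * a ^ 2 * b := by positivity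
  constructor <;> nlinarith

end SF

theorem abs_linear_combination_le {a p q x y z K : ℝ} (hx : |x| ≤ K) (hy : |y| ≤ K) (hz : |z| ≤ K) :
    |-a * x + p * y + q * z| ≤ (|a| + |p| + |q|) * K := by
  refine (abs_add_le _ _).trans ?_
  have h1 := abs_add_le (-a * x) (p * y)
  rw [abs_mul, abs_mul, abs_neg] at h1
  rw [abs_mul]
  nlinarith [mul_le_mul_of_nonneg_left hx (abs_nonneg a),
    mul_le_mul_of_nonneg_left hy (abs_nonneg p), mul_le_mul_of_nonneg_left hz (abs_nonneg q)]

theorem norm_linear_combination_le {E : Type*} [NormedAddCommGroup E] [NormedSpace ℝ E]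
    {a p q K : ℝ} {x y z : E} (hx : ‖x‖ ≤ K) (hy : ‖y‖ ≤ K) (hz : ‖z‖ ≤ K) :
    ‖-a • x + p • y + q • z‖ ≤ (|a| + |p| + |q|) * K := by
  refine (norm_add_le _ _).trans ?_
  have h1 := norm_add_le (-a • x) (p • y)
  rw [norm_smul, norm_smul, Real.norm_eq_abs, Real.norm_eq_abs, abs_neg] at h1
  rw [norm_smul, Real.norm_eq_abs]
  nlinarith [mul_le_mul_of_nonneg_left hx (abs_nonneg a),
    mul_le_mul_of_nonneg_left hy (abs_nonneg p), mul_le_mul_of_nonneg_left hz (abs_nonneg q)]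

/-! ### Estimates for the right-hand side of one equation. -/

section

variable (a p q : ℝ) {k : ℕ} (hk : 1 ≤ k)

/-- The right-hand side `-a u_z v_θ + p v Hz + q z Hv`. -/
def rhs : Hk k →L[ℝ] L2 →L[ℝ] L2 :=
  -a • (M.bilinearComp vel (Hk.wderivL 1 hk)).flip + p • M.bilinearComp (ev hk) hilbert +
    q • M.comp (evH hk)

theorem rhs_apply (v : Hk k) (z : L2) :
    rhs a p q hk v z =
      -a • M (vel z) (v.wderiv 1 hk) + p • M (ev hk v) (hilbert z) + q • M (evH hk v) z := rfl

theorem norm_M_evH_le (w : Hk k) (f : L2) : ‖M (evH hk w) f‖ ≤ ‖evH hk‖ * ‖w‖ * ‖f‖ :=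
  (norm_M_le _ _).trans (mul_le_mul_of_nonneg_right ((evH hk).le_opNorm w) (norm_nonneg _))

theorem norm_M_ev_le (w : Hk k) (f : L2) : ‖M (ev hk w) f‖ ≤ ‖ev hk‖ * ‖w‖ * ‖f‖ :=
  (norm_M_le _ _).trans (mul_le_mul_of_nonneg_right ((ev hk).le_opNorm w) (norm_nonneg _))

theorem norm_M_vel_le (z f : L2) : ‖M (vel z) f‖ ≤ ‖vel‖ * ‖z‖ * ‖f‖ :=
  (norm_M_le _ _).trans (mul_le_mul_of_nonneg_right (vel.le_opNorm z) (norm_nonneg _))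

/-- Pointwise both are the same product; what changes is which factor is taken in the sup norm and
which in `L²`. -/
theorem M_ev_hilbert (d w : Hk k) : M (ev hk d) (hilbert w.val) = M (evH hk w) d.val := by
  rw [← cL_evH hk w, M_cL_comm, cL_ev]

theorem M_evH_val (d w : Hk k) : M (evH hk d) w.val = M (ev hk w) (hilbert d.val) :=
  (M_ev_hilbert hk w d).symm

theorem M_ev_val (d w : Hk k) : M (ev hk d) w.val = M (ev hk w) d.val := by
  rw [← cL_ev hk w, M_cL_comm, cL_ev]

theorem abs_inner_le_of_norm_le {x y : L2} {K : ℝ} (h : ‖x‖ ≤ K) : |⟪x, y⟫_ℝ| ≤ K * ‖y‖ :=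
  (abs_real_inner_le_norm _ _).trans (mul_le_mul_of_nonneg_right h (norm_nonneg _))

theorem inner_rhs (v φ : Hk k) (z : L2) : ⟪rhs a p q hk v z, φ.val⟫_ℝ =
    -a * ⟪M (vel z) (v.wderiv 1 hk), φ.val⟫_ℝ + p * ⟪M (ev hk v) (hilbert z), φ.val⟫_ℝ +
      q * ⟪M (evH hk v) z, φ.val⟫_ℝ := by
  rw [rhs_apply, inner_add_left, inner_add_left, real_inner_smul_left, real_inner_smul_left,
    real_inner_smul_left]

/-- The constant of the estimates in `L²`. -/
def lowConst : ℝ := (|a| + |p| + |q|) * (‖ev hk‖ + ‖evH hk‖ + ‖vel‖)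

/-- The transport term reduces to half of `⟪(Hw) d, d⟫`. In the other two terms the product is
rewritten so that `w` or `Hw` is in the sup norm and `d` only in `L²`. -/
theorem abs_inner_rhs_self_le (d w : Hk k) :
    |⟪rhs a p q hk d w.val, d.val⟫_ℝ| ≤ lowConst a p q hk * ‖w‖ * ‖d.val‖ ^ 2 := by
  have n1 := norm_nonneg (ev hk)
  have n2 := norm_nonneg (evH hk)
  have n3 := norm_nonneg vel
  have hX : 0 ≤ ‖w‖ * ‖d.val‖ ^ 2 := by positivity
  have h1 := abs_inner_le_of_norm_le (y := d.val) (norm_M_evH_le hk w d.val)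
  have h2 := abs_inner_le_of_norm_le (y := d.val) (norm_M_ev_le hk w (hilbert d.val))
  have h3 := inner_transport hk d w d
  have h4 : ⟪M (vel w.val) d.val, d.wderiv 1 hk⟫_ℝ = ⟪M (vel w.val) (d.wderiv 1 hk), d.val⟫_ℝ := by
    rw [inner_M_left, real_inner_comm]
  have h5 : ⟪M (vel w.val) (d.wderiv 1 hk), d.val⟫_ℝ = -(1 / 2) * ⟪M (evH hk w) d.val, d.val⟫_ℝ := by
    linarith
  have h6 : ‖ev hk‖ * ‖w‖ * ‖hilbert d.val‖ * ‖d.val‖ ≤ ‖ev hk‖ * ‖w‖ * ‖d.val‖ * ‖d.val‖ := by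
    have := norm_hilbert_le d.val
    gcongr
  rw [inner_rhs, h5, M_ev_hilbert hk d w, M_evH_val hk d w, lowConst, mul_assoc, mul_assoc]
  refine abs_linear_combination_le ?_ ?_ ?_
  · rw [abs_mul, abs_neg, abs_of_pos (by norm_num : (0 : ℝ) < 1 / 2)]
    nlinarith [abs_nonneg ⟪M (evH hk w) d.val, d.val⟫_ℝ, mul_nonneg n1 hX, mul_nonneg n3 hX]
  · nlinarith [mul_nonneg n1 hX, mul_nonneg n3 hX]
  · nlinarith [mul_nonneg n2 hX, mul_nonneg n3 hX]

/-- All regularity is put on `φ`: the transport derivative is moved onto it by parts, and in the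
products `φ` takes the sup norm. -/
theorem abs_inner_rhs_le (v w φ : Hk k) :
    |⟪rhs a p q hk v w.val, φ.val⟫_ℝ| ≤ lowConst a p q hk * ‖φ‖ * ‖v.val‖ * ‖w.val‖ := by
  have n1 := norm_nonneg (ev hk)
  have n2 := norm_nonneg (evH hk)
  have n3 := norm_nonneg vel
  have hX : 0 ≤ ‖φ‖ * ‖v.val‖ * ‖w.val‖ := by positivity
  have e1 : ⟪M (evH hk w) v.val, φ.val⟫_ℝ = ⟪M (ev hk φ) v.val, hilbert w.val⟫_ℝ := by
    rw [← M_ev_hilbert, inner_M_left, M_ev_val, real_inner_comm]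
  have e2 : ⟪M (evH hk v) w.val, φ.val⟫_ℝ = ⟪M (ev hk φ) w.val, hilbert v.val⟫_ℝ := by
    rw [← M_ev_hilbert, inner_M_left, M_ev_val, real_inner_comm]
  have h1 : |⟪M (evH hk w) v.val, φ.val⟫_ℝ| ≤ ‖ev hk‖ * (‖φ‖ * ‖v.val‖ * ‖w.val‖) := by
    rw [e1]
    refine (abs_inner_le_of_norm_le (norm_M_ev_le hk φ v.val)).trans ?_
    have := norm_hilbert_le w.val
    calc _ ≤ ‖ev hk‖ * ‖φ‖ * ‖v.val‖ * ‖w.val‖ := by gcongr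
      _ = _ := by ring
  have h2 : |⟪M (evH hk v) w.val, φ.val⟫_ℝ| ≤ ‖ev hk‖ * (‖φ‖ * ‖v.val‖ * ‖w.val‖) := by
    rw [e2]
    refine (abs_inner_le_of_norm_le (norm_M_ev_le hk φ w.val)).trans ?_
    have := norm_hilbert_le v.val
    calc _ ≤ ‖ev hk‖ * ‖φ‖ * ‖w.val‖ * ‖v.val‖ := by gcongr
      _ = _ := by ring
  have h3 : |⟪M (vel w.val) v.val, φ.wderiv 1 hk⟫_ℝ| ≤ ‖vel‖ * (‖φ‖ * ‖v.val‖ * ‖w.val‖) := by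
    refine (abs_inner_le_of_norm_le (norm_M_vel_le w.val v.val)).trans ?_
    have := φ.norm_wderiv_le 1 hk
    calc _ ≤ ‖vel‖ * ‖w.val‖ * ‖v.val‖ * ‖φ‖ := by gcongr
      _ = _ := by ring
  have h4 := inner_transport hk v w φ
  rw [inner_rhs, M_ev_hilbert, lowConst, mul_assoc, mul_assoc, mul_assoc, ← mul_assoc ‖φ‖]
  refine abs_linear_combination_le ?_ ?_ ?_
  · rw [abs_le] at h1 h3 ⊢
    constructor <;> nlinarith [mul_nonneg n2 hX]
  · nlinarith [mul_nonneg n2 hX, mul_nonneg n3 hX]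
  · nlinarith [mul_nonneg n2 hX, mul_nonneg n3 hX]

/-- The constant of the estimates in `H^k`. -/
def highConst (k : ℕ) : ℝ :=
  -- The factor `k + 1` counts derivatives, `(1 + 2 ^ k) * SF.sob` covers transport energy and
  -- products, and `‖vel‖` is needed only for the bound in `H^{k-1}`.
  (k + 1) * ((|a| + |p| + |q|) * ((1 + 2 ^ k) * SF.sob + ‖vel‖))

/-- Smooth representatives of a trigonometric polynomial in `H^k`, of its velocity and of its
Hilbert transform. -/
theorem exists_smooth_of_trunc_eq {N : ℕ} {v : Hk k} (hv : Hk.trunc k N v.val = v) :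
    ∃ f u : SF, v = Hk.emb k f ∧ u.1 = vel v.val ∧ (SF.D u).1 = evH hk v ∧
      SF.Bdd k f ‖v‖ ∧ SF.Bdd k (SF.D u) ‖v‖ := by
  have hf : v = Hk.emb k (TN N v.val) := by rw [← Hk.trunc_apply, hv]
  have hfv : v.val = cL (TN N v.val).1 := by rw [← Hk.emb_val (k := k), ← hf]
  refine ⟨TN N v.val, ⟨_, vel_TN_mem N v.val⟩, hf, (congrArg vel hfv).symm, ?_, ?_, ?_⟩
  · exact cL_injective (by rw [cL_evH, cL_D_of_eq_vel rfl, ← hfv])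
  · intro j hj
    rw [← Hk.emb_wderiv _ j hj, ← hf]
    exact v.norm_wderiv_le j hj
  · intro j hj
    rw [cL_iterate_D_of_cL_eq_hilbert (cL_D_of_eq_vel rfl) j]
    refine (norm_hilbert_le _).trans ?_
    rw [← Hk.emb_wderiv _ j hj, ← hf]
    exact v.norm_wderiv_le j hj

theorem rhs_emb {v w : Hk k} {f g u u' : SF} (hv : v = Hk.emb k f) (hw : w = Hk.emb k g)
    (hu : u.1 = vel w.val) (hDu : (SF.D u).1 = evH hk w) (hDu' : (SF.D u').1 = evH hk v) :
    rhs a p q hk v w.val =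
      cL (-a • (u * SF.D f) + p • (f * SF.D u) + q • (SF.D u' * g)).1 := by
  have e1 : v.wderiv 1 hk = cL (SF.D f).1 := by rw [hv, Hk.emb_wderiv]; rfl
  have e2 : ev hk v = f.1 := ev_of_val_eq hk (by rw [hv, Hk.emb_val])
  have e3 : w.val = cL g.1 := by rw [hw, Hk.emb_val]
  rw [rhs_apply, ← hu, e1, e2, ← cL_evH hk w, ← hDu, ← hDu', e3, M_cL, M_cL, M_cL, SF.cL_add,
    SF.cL_add, SF.cL_smul, SF.cL_smul, SF.cL_smul]
  rfl

theorem cL_iterate_D_linear_combination (j : ℕ) (x y z : SF) :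
    cL (SF.D^[j] (-a • x + p • y + q • z)).1 =
      -a • cL (SF.D^[j] x).1 + p • cL (SF.D^[j] y).1 + q • cL (SF.D^[j] z).1 := by
  rw [SF.iterate_D_add, SF.iterate_D_add, SF.iterate_D_smul, SF.iterate_D_smul, SF.iterate_D_smul,
    SF.cL_add, SF.cL_add, SF.cL_smul, SF.cL_smul, SF.cL_smul]

theorem two_pow_mul_le {j : ℕ} (hj : j ≤ k) {x : ℝ} (hx : 0 ≤ x) : (2 : ℝ) ^ j * x ≤ 2 ^ k * x :=
  mul_le_mul_of_nonneg_right (pow_le_pow_right₀ one_le_two hj) hx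

/-- Against a truncated `v` the outer truncation disappears by symmetry. What remains is a smooth
inner product, estimated one derivative at a time with the transport cancellation. -/
theorem inner_trunc_rhs_le {N : ℕ} {v w : Hk k} (hv : Hk.trunc k N v.val = v)
    (hw : Hk.trunc k N w.val = w) :
    ⟪v, Hk.trunc k N (rhs a p q hk v w.val)⟫_ℝ ≤ highConst a p q k * ‖v‖ ^ 2 * ‖w‖ := by
  obtain ⟨f, u', hf, -, hDu', bf, bu'⟩ := exists_smooth_of_trunc_eq hk hv
  obtain ⟨g, u, hg, hu, hDu, bg, bu⟩ := exists_smooth_of_trunc_eq hk hw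
  set F := -a • (u * SF.D f) + p • (f * SF.D u) + q • (SF.D u' * g)
  have e1 : rhs a p q hk v w.val = (Hk.emb k F).val :=
    rhs_emb a p q hk hf hg hu hDu hDu'
  rw [e1, ← Hk.inner_trunc, hv, Hk.inner_def]
  have hs := SF.sob_nonneg
  have hV := norm_nonneg vel
  have hX : 0 ≤ SF.sob * ‖v‖ ^ 2 * ‖w‖ := by positivity
  have hj : ∀ j : Fin (k + 1), ⟪v.1 j, (Hk.emb k F).1 j⟫_ℝ ≤
      (|a| + |p| + |q|) * (((1 + 2 ^ k) * SF.sob + ‖vel‖) * (‖v‖ ^ 2 * ‖w‖)) := by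
    intro j
    have hjk : (j : ℕ) ≤ k := Nat.le_of_lt_succ j.2
    have e2 : v.1 j = cL (SF.D^[j] f).1 := (congrArg (fun z : Hk k => z.1 j) hf).trans rfl
    have e3 : (Hk.emb k F).1 j = cL (SF.D^[j] F).1 := rfl
    rw [e3, cL_iterate_D_linear_combination, inner_add_right, inner_add_right,
      real_inner_smul_right, real_inner_smul_right, real_inner_smul_right, e2]
    refine (le_abs_self _).trans (abs_linear_combination_le ?_ ?_ ?_)
    · have h1 := bf.abs_inner_transport_le hk bu hjk
      have h2 := two_pow_mul_le hjk hX
      have h3 : 0 ≤ ‖vel‖ * (‖v‖ ^ 2 * ‖w‖) := by positivity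
      nlinarith
    · have h1 := abs_real_inner_le_norm (cL (SF.D^[j] f).1) (cL (SF.D^[j] (f * SF.D u)).1)
      have h4 := mul_le_mul (bf j hjk) (bf.mul hk bu hjk) (norm_nonneg _) (norm_nonneg _)
      have h2 := two_pow_mul_le hjk hX
      have h3 : 0 ≤ ‖vel‖ * (‖v‖ ^ 2 * ‖w‖) := by positivity
      nlinarith
    · have h1 := abs_real_inner_le_norm (cL (SF.D^[j] f).1) (cL (SF.D^[j] (SF.D u' * g)).1)
      have h4 := mul_le_mul (bf j hjk) (bu'.mul hk bg hjk) (norm_nonneg _) (norm_nonneg _)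
      have h2 := two_pow_mul_le hjk hX
      have h3 : 0 ≤ ‖vel‖ * (‖v‖ ^ 2 * ‖w‖) := by positivity
      nlinarith
  refine (Finset.sum_le_sum fun j _ => hj j).trans (le_of_eq ?_)
  rw [Finset.sum_const, Finset.card_univ, Fintype.card_fin, nsmul_eq_mul, highConst]
  push_cast
  ring

/-- With one derivative given up, `u D^{j+1} f` has `j + 1 ≤ k` and is bounded directly, without
cancellation. -/
theorem norm_incl_trunc_rhs_le {N : ℕ} {v w : Hk k} (hv : Hk.trunc k N v.val = v)
    (hw : Hk.trunc k N w.val = w) :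
    ‖(Hk.trunc k N (rhs a p q hk v w.val)).incl (Nat.sub_le k 1)‖ ≤
      highConst a p q k * ‖v‖ * ‖w‖ := by
  obtain ⟨f, u', hf, -, hDu', bf, bu'⟩ := exists_smooth_of_trunc_eq hk hv
  obtain ⟨g, u, hg, hu, hDu, bg, bu⟩ := exists_smooth_of_trunc_eq hk hw
  set F := -a • (u * SF.D f) + p • (f * SF.D u) + q • (SF.D u' * g)
  have e1 : rhs a p q hk v w.val = (Hk.emb (k - 1) F).val :=
    rhs_emb a p q hk hf hg hu hDu hDu'
  rw [Hk.incl_trunc, e1]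
  refine (Hk.norm_trunc_le _ _).trans ?_
  have hs := SF.sob_nonneg
  have hV := norm_nonneg vel
  have hX : 0 ≤ SF.sob * ‖v‖ * ‖w‖ := by positivity
  have hK : 0 ≤ (|a| + |p| + |q|) * (((1 + 2 ^ k) * SF.sob + ‖vel‖) * (‖v‖ * ‖w‖)) := by positivity
  have h3 : 0 ≤ ‖vel‖ * (‖v‖ * ‖w‖) := by positivity
  have hj : ∀ j (hj : j ≤ k - 1), ‖(Hk.emb (k - 1) F).wderiv j hj‖ ≤
      (|a| + |p| + |q|) * (((1 + 2 ^ k) * SF.sob + ‖vel‖) * (‖v‖ * ‖w‖)) := by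
    intro j hj
    have hjk : j ≤ k := by omega
    have h2 := two_pow_mul_le hjk hX
    rw [Hk.emb_wderiv, cL_iterate_D_linear_combination]
    refine norm_linear_combination_le ?_ ?_ ?_
    · have h1 := bf.commutator bu hjk
      have h4 : ‖cL (u * SF.D^[j] (SF.D f)).1‖ ≤ ‖vel‖ * ‖w‖ * ‖v‖ := by
        refine (SF.norm_cL_mul_le _ _).trans ?_
        rw [← Function.iterate_succ_apply SF.D j f, hu]
        refine mul_le_mul ?_ (bf (j + 1) (by omega)) (norm_nonneg _) (by positivity)
        exact (vel.le_opNorm _).trans (mul_le_mul_of_nonneg_left w.norm_val_le hV)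
      have h5 := norm_le_insert' (cL (SF.D^[j] (u * SF.D f)).1) (cL (u * SF.D^[j] (SF.D f)).1)
      nlinarith
    · have h1 := bf.mul hk bu hjk
      nlinarith
    · have h1 := bu'.mul hk bg hjk
      nlinarith
  refine (SF.norm_le_of_forall_norm_le hK hj).trans ?_
  have hk' : ((k - 1 : ℕ) : ℝ) + 1 ≤ (k : ℝ) + 1 := by
    have : ((k - 1 : ℕ) : ℝ) ≤ k := by exact_mod_cast Nat.sub_le k 1
    linarith
  refine (mul_le_mul_of_nonneg_right hk' hK).trans (le_of_eq ?_)
  rw [highConst]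
  ring

theorem lowConst_nonneg : 0 ≤ lowConst a p q hk := by unfold lowConst; positivity

theorem highConst_nonneg : 0 ≤ highConst a p q k := by
  have := SF.sob_nonneg
  unfold highConst; positivity

end

/-! ### Pairs, and the system as an instance of the abstract scheme. -/

/-- The Hilbert space of pairs. -/
abbrev Pair (E : Type*) : Type _ := WithLp 2 (E × E)

namespace Pair

variable {E F G : Type*} [NormedAddCommGroup E] [InnerProductSpace ℝ E] [NormedAddCommGroup F]
  [InnerProductSpace ℝ F] [NormedAddCommGroup G] [InnerProductSpace ℝ G]

/-- A continuous linear map applied to both components. -/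
def map (A : E →L[ℝ] F) : Pair E →L[ℝ] Pair F :=
  (WithLp.prodContinuousLinearEquiv 2 ℝ F F).symm.toContinuousLinearMap.comp
    ((A.prodMap A).comp (WithLp.prodContinuousLinearEquiv 2 ℝ E E).toContinuousLinearMap)

@[simp] theorem map_fst (A : E →L[ℝ] F) (x : Pair E) : (map A x).fst = A x.fst := rfl

@[simp] theorem map_snd (A : E →L[ℝ] F) (x : Pair E) : (map A x).snd = A x.snd := rfl

theorem ext {V : Type*} {x y : Pair V} (h1 : x.fst = y.fst) (h2 : x.snd = y.snd) : x = y :=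
  WithLp.ofLp_injective 2 (Prod.ext h1 h2)

theorem map_injective {A : E →L[ℝ] F} (hA : Function.Injective A) : Function.Injective (map A) :=
  fun _ _ h => ext (hA (congrArg WithLp.fst h)) (hA (congrArg WithLp.snd h))

theorem inner_def (x y : Pair E) : ⟪x, y⟫_ℝ = ⟪x.fst, y.fst⟫_ℝ + ⟪x.snd, y.snd⟫_ℝ := rfl

theorem norm_sq_eq {V : Type*} [NormedAddCommGroup V] (x : Pair V) : ‖x‖ ^ 2 = ‖x.fst‖ ^ 2 + ‖x.snd‖ ^ 2 :=
  WithLp.prod_norm_sq_eq_of_L2 x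

theorem norm_fst_le {V : Type*} [NormedAddCommGroup V] (x : Pair V) : ‖x.fst‖ ≤ ‖x‖ := WithLp.norm_fst_le _ x

theorem norm_snd_le {V : Type*} [NormedAddCommGroup V] (x : Pair V) : ‖x.snd‖ ≤ ‖x‖ := WithLp.norm_snd_le _ x

theorem norm_le_add {V : Type*} [NormedAddCommGroup V] (x : Pair V) : ‖x‖ ≤ ‖x.fst‖ + ‖x.snd‖ := by
  refine (pow_le_pow_iff_left₀ (norm_nonneg _) (by positivity) two_ne_zero).1 ?_
  rw [norm_sq_eq]
  nlinarith [norm_nonneg x.fst, norm_nonneg x.snd]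

theorem norm_le_mul_norm {V W : Type*} [NormedAddCommGroup V] [NormedAddCommGroup W] {x : Pair W}
    {y : Pair V} {c : ℝ} (hc : 0 ≤ c)
    (h1 : ‖x.fst‖ ≤ c * ‖y.fst‖) (h2 : ‖x.snd‖ ≤ c * ‖y.snd‖) : ‖x‖ ≤ c * ‖y‖ := by
  refine (pow_le_pow_iff_left₀ (norm_nonneg _) (by positivity) two_ne_zero).1 ?_
  rw [mul_pow, norm_sq_eq, norm_sq_eq, mul_add, ← mul_pow, ← mul_pow]
  exact add_le_add (pow_le_pow_left₀ (norm_nonneg _) h1 2) (pow_le_pow_left₀ (norm_nonneg _) h2 2)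

theorem tendsto {V ι : Type*} [NormedAddCommGroup V] {l : Filter ι} {f : ι → Pair V} {x : Pair V}
    (h1 : Tendsto (fun i => (f i).fst) l (𝓝 x.fst)) (h2 : Tendsto (fun i => (f i).snd) l (𝓝 x.snd)) :
    Tendsto f l (𝓝 x) :=
  ((WithLp.prod_continuous_toLp 2 V V).tendsto (x.fst, x.snd)).comp (h1.prodMk_nhds h2)

/-- The bilinear map `(x, y) ↦ (β x₁ y₂, β x₂ y₁)`. -/
def cross (β : E →L[ℝ] F →L[ℝ] G) : Pair E →L[ℝ] Pair F →L[ℝ] Pair G :=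
  (ContinuousLinearMap.compL ℝ (Pair F) (G × G) (Pair G)
    (WithLp.prodContinuousLinearEquiv 2 ℝ G G).symm.toContinuousLinearMap).comp
    ((ContinuousLinearMap.compL ℝ (Pair F) G (G × G) (ContinuousLinearMap.inl ℝ G G)).comp
      (β.bilinearComp (WithLp.fstL 2 ℝ E E) (WithLp.sndL 2 ℝ F F)) +
    (ContinuousLinearMap.compL ℝ (Pair F) G (G × G) (ContinuousLinearMap.inr ℝ G G)).comp
      (β.bilinearComp (WithLp.sndL 2 ℝ E E) (WithLp.fstL 2 ℝ F F)))

@[simp] theorem cross_fst (β : E →L[ℝ] F →L[ℝ] G) (x : Pair E) (y : Pair F) :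
    (cross β x y).fst = β x.fst y.snd := add_zero _

@[simp] theorem cross_snd (β : E →L[ℝ] F →L[ℝ] G) (x : Pair E) (y : Pair F) :
    (cross β x y).snd = β x.snd y.fst := zero_add _

/-- Cauchy–Schwarz in the plane, matching the crossed coupling of the two equations. -/
theorem norm_mul_norm_add_le {V W : Type*} [NormedAddCommGroup V] [NormedAddCommGroup W]
    (x : Pair V) (y : Pair W) :
    ‖x.fst‖ * ‖y.snd‖ + ‖x.snd‖ * ‖y.fst‖ ≤ ‖x‖ * ‖y‖ := by
  refine le_of_sq_le_sq ?_ (by positivity)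
  rw [mul_pow, norm_sq_eq, norm_sq_eq]
  nlinarith [sq_nonneg (‖x.fst‖ * ‖y.fst‖ - ‖x.snd‖ * ‖y.snd‖)]

end Pair

section

variable (a p q : ℝ) {k : ℕ} (hk : 1 ≤ k)

/-- The constant of all estimates. -/
def estimateConst : ℝ := lowConst a p q hk + highConst a p q k + 1

theorem lowConst_le : lowConst a p q hk ≤ estimateConst a p q hk := by
  have := highConst_nonneg a p q (k := k)
  unfold estimateConst; linarith

theorem highConst_le : highConst a p q k ≤ estimateConst a p q hk := by
  have := lowConst_nonneg a p q hk
  unfold estimateConst; linarith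

theorem estimateConst_pos : 0 < estimateConst a p q hk := by
  have := lowConst_nonneg a p q hk
  have := highConst_nonneg a p q (k := k)
  unfold estimateConst; linarith

theorem cross_self_le (d y : Pair (Hk k)) :
    |⟪Pair.cross (rhs a p q hk) d (Pair.map Hk.valL y), Pair.map Hk.valL d⟫_ℝ| ≤
      estimateConst a p q hk * ‖y‖ * ‖Pair.map Hk.valL d‖ ^ 2 := by
  rw [Pair.inner_def, Pair.norm_sq_eq]
  simp only [Pair.cross_fst, Pair.cross_snd, Pair.map_fst, Pair.map_snd, Hk.valL_apply]
  have hC := lowConst_le a p q hk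
  have h0 := lowConst_nonneg a p q hk
  have h0' := (estimateConst_pos a p q hk).le
  have h1 := (abs_inner_rhs_self_le a p q hk d.fst y.snd).trans
    (mul_le_mul_of_nonneg_right (mul_le_mul hC (Pair.norm_snd_le y) (norm_nonneg _) h0')
      (sq_nonneg _))
  have h2 := (abs_inner_rhs_self_le a p q hk d.snd y.fst).trans
    (mul_le_mul_of_nonneg_right (mul_le_mul hC (Pair.norm_fst_le y) (norm_nonneg _) h0')
      (sq_nonneg _))
  refine (abs_add_le _ _).trans ?_
  linarith

theorem cross_weak_le (y z φ : Pair (Hk k)) :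
    |⟪Pair.cross (rhs a p q hk) y (Pair.map Hk.valL z), Pair.map Hk.valL φ⟫_ℝ| ≤
      estimateConst a p q hk * ‖φ‖ * ‖Pair.map Hk.valL y‖ * ‖Pair.map Hk.valL z‖ := by
  have h3 := Pair.norm_mul_norm_add_le (Pair.map Hk.valL y) (Pair.map Hk.valL z)
  rw [Pair.inner_def]
  simp only [Pair.cross_fst, Pair.cross_snd, Pair.map_fst, Pair.map_snd, Hk.valL_apply] at h3 ⊢
  have hC := lowConst_le a p q hk
  have h0' := (estimateConst_pos a p q hk).le
  have h1 := (abs_inner_rhs_le a p q hk y.fst z.snd φ.fst).trans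
    (mul_le_mul_of_nonneg_right (mul_le_mul_of_nonneg_right
      (mul_le_mul hC (Pair.norm_fst_le φ) (norm_nonneg _) h0') (norm_nonneg _)) (norm_nonneg _))
  have h2 := (abs_inner_rhs_le a p q hk y.snd z.fst φ.snd).trans
    (mul_le_mul_of_nonneg_right (mul_le_mul_of_nonneg_right
      (mul_le_mul hC (Pair.norm_snd_le φ) (norm_nonneg _) h0') (norm_nonneg _)) (norm_nonneg _))
  have h4 := mul_le_mul_of_nonneg_left h3 (mul_nonneg h0' (norm_nonneg φ))
  refine (abs_add_le _ _).trans ?_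
  linarith

theorem trunc_fst_of_eq {N : ℕ} {y : Pair (Hk k)}
    (hy : Pair.map (Hk.trunc k N) (Pair.map Hk.valL y) = y) : Hk.trunc k N y.fst.val = y.fst :=
  congrArg WithLp.fst hy

theorem trunc_snd_of_eq {N : ℕ} {y : Pair (Hk k)}
    (hy : Pair.map (Hk.trunc k N) (Pair.map Hk.valL y) = y) : Hk.trunc k N y.snd.val = y.snd :=
  congrArg WithLp.snd hy

theorem cross_energy_le (N : ℕ) (y : Pair (Hk k))
    (hy : Pair.map (Hk.trunc k N) (Pair.map Hk.valL y) = y) :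
    ⟪y, Pair.map (Hk.trunc k N) (Pair.cross (rhs a p q hk) y (Pair.map Hk.valL y))⟫_ℝ ≤
      estimateConst a p q hk * ‖y‖ ^ 3 := by
  rw [Pair.inner_def]
  simp only [Pair.cross_fst, Pair.cross_snd, Pair.map_fst, Pair.map_snd, Hk.valL_apply]
  have hC := highConst_le a p q hk
  have h0' := (estimateConst_pos a p q hk).le
  have h1 := (inner_trunc_rhs_le a p q hk (trunc_fst_of_eq hy) (trunc_snd_of_eq hy)).trans
    (mul_le_mul (mul_le_mul_of_nonneg_right hC (sq_nonneg _)) (Pair.norm_snd_le y) (norm_nonneg _)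
      (mul_nonneg h0' (sq_nonneg _)))
  have h2 := (inner_trunc_rhs_le a p q hk (trunc_snd_of_eq hy) (trunc_fst_of_eq hy)).trans
    (mul_le_mul (mul_le_mul_of_nonneg_right hC (sq_nonneg _)) (Pair.norm_fst_le y) (norm_nonneg _)
      (mul_nonneg h0' (sq_nonneg _)))
  rw [pow_succ, Pair.norm_sq_eq]
  linarith

theorem cross_smooth_le (N : ℕ) (y : Pair (Hk k))
    (hy : Pair.map (Hk.trunc k N) (Pair.map Hk.valL y) = y) :
    ‖Pair.map (Hk.inclL (Nat.sub_le k 1))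
      (Pair.map (Hk.trunc k N) (Pair.cross (rhs a p q hk) y (Pair.map Hk.valL y)))‖ ≤
      estimateConst a p q hk * ‖y‖ ^ 2 := by
  refine (Pair.norm_le_add _).trans ?_
  simp only [Pair.cross_fst, Pair.cross_snd, Pair.map_fst, Pair.map_snd, Hk.valL_apply,
    Hk.inclL_apply]
  have h0' := (estimateConst_pos a p q hk).le
  have h1 := norm_incl_trunc_rhs_le a p q hk (trunc_fst_of_eq hy) (trunc_snd_of_eq hy)
  have h2 := norm_incl_trunc_rhs_le a p q hk (trunc_snd_of_eq hy) (trunc_fst_of_eq hy)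
  have h3 := Pair.norm_mul_norm_add_le y y
  have h4 := mul_le_mul (highConst_le a p q hk) h3 (by positivity) h0'
  rw [sq]
  linarith

/-- The system as a quadratic evolution equation. -/
def system : Galerkin (Pair (Hk k)) (Pair (Hk (k - 1))) (Pair L2) where
  ι := Pair.map Hk.valL
  j := Pair.map (Hk.inclL (Nat.sub_le k 1))
  κ := Pair.map Hk.valL
  κ_j := fun _ => rfl
  κ_inj := Pair.map_injective Hk.val_injective
  ι_inj := Pair.map_injective Hk.val_injective
  dense := fun x => by
    refine mem_closure_of_tendsto (Pair.tendsto (tendsto_cL_TN x.fst) (tendsto_cL_TN x.snd) :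
      Tendsto (fun N => (WithLp.toLp 2 (cL (TN N x.fst).1, cL (TN N x.snd).1) : Pair L2)) atTop
        (𝓝 x)) (Eventually.of_forall fun N => ?_)
    exact ⟨WithLp.toLp 2 (Hk.emb k (TN N x.fst), Hk.emb k (TN N x.snd)), rfl⟩
  b := Pair.cross (rhs a p q hk)
  P := fun N => Pair.map (Hk.trunc k N)
  P_symm := fun N x x' => by
    rw [Pair.inner_def, Pair.inner_def]
    simp only [Pair.map_fst, Pair.map_snd, Hk.valL_apply, Hk.trunc_val]
    rw [inner_cL_TN, inner_cL_TN]
  P_symm' := fun N y y' => by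
    rw [Pair.inner_def, Pair.inner_def]
    simp only [Pair.map_fst, Pair.map_snd, Hk.valL_apply]
    rw [Hk.inner_trunc, Hk.inner_trunc]
  P_idem := fun N x => Pair.ext (Hk.trunc_idem N x.fst) (Hk.trunc_idem N x.snd)
  ε := fun N => 1 / (N + 1)
  ε_tendsto := tendsto_one_div_add_atTop_nhds_zero_nat
  P_approx := fun N y => Pair.norm_le_mul_norm (by positivity) (Hk.norm_trunc_sub_le hk N y.fst)
    (Hk.norm_trunc_sub_le hk N y.snd)
  P_tendsto := fun y => Pair.tendsto (Hk.tendsto_trunc y.fst) (Hk.tendsto_trunc y.snd)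
  C := estimateConst a p q hk
  C_pos := estimateConst_pos a p q hk
  b_self := cross_self_le a p q hk
  b_weak := cross_weak_le a p q hk
  b_energy := cross_energy_le a p q hk
  b_smooth := cross_smooth_le a p q hk

theorem system_B (y : Pair (Hk k)) : (system a p q hk).B y =
    WithLp.toLp 2 (rhs a p q hk y.fst y.snd.val, rhs a p q hk y.snd y.fst.val) :=
  Pair.ext (Pair.cross_fst _ _ _) (Pair.cross_snd _ _ _)

end

/-! ### The principal value integral: passage to the line, the cotangent kernel, folding. -/

section Transfer

theorem ae_coe_of_ae {P : Torus → Prop} (h : ∀ᵐ x, P x) : ∀ᵐ θ : ℝ, P (θ : Torus) := by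
  rw [← Measure.restrict_univ (μ := (volume : Measure ℝ)),
    ← iUnion_Ioc_add_zsmul Real.two_pi_pos 0, ae_restrict_iUnion_iff]
  intro n
  have e : (0 : ℝ) + (n + 1) • (2 * π) = 0 + n • (2 * π) + 2 * π := by
    rw [add_smul, one_smul, add_assoc]
  rw [e]
  exact (AddCircle.measurePreserving_mk (2 * π) (0 + n • (2 * π))).quasiMeasurePreserving.ae h

theorem ae_of_ae_coe {P : Torus → Prop} (h : ∀ᵐ θ : ℝ, P (θ : Torus)) : ∀ᵐ x, P x := by
  have h1 := (ae_restrict_iff_subtype (measurableSet_Ioc (a := (0 : ℝ)) (b := 0 + 2 * π))).1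
    (ae_restrict_of_ae h)
  filter_upwards [(AddCircle.measurePreserving_equivIoc (2 * π) (a := 0)).quasiMeasurePreserving.ae h1]
    with x hx
  have e : ((AddCircle.equivIoc (2 * π) 0 x : ℝ) : Torus) = x :=
    (AddCircle.equivIoc (2 * π) 0).symm_apply_apply x
  rwa [e] at hx

theorem hilbertTrunc_congr_ae {f g : Torus → ℝ} (h : f =ᵐ[volume] g) (ε θ : ℝ) :
    hilbertTrunc f ε θ = hilbertTrunc g ε θ := by
  unfold hilbertTrunc
  congr 1
  refine integral_congr_ae (ae_restrict_of_ae ?_)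
  filter_upwards [ae_coe_of_ae h] with x hx
  rw [hx]

end Transfer

section Kernel

/-- The difference of the sines is `2 cos((n + 1/2) y) sin(y/2)`, and the sine cancels the
denominator of the cotangent. -/
theorem cot_half_mul_sin_succ {y : ℝ} (hy : Real.sin (y / 2) ≠ 0) (n : ℕ) :
    Real.cot (y / 2) * Real.sin ((n + 1 : ℕ) * y) =
      Real.cot (y / 2) * Real.sin (n * y) + (Real.cos ((n + 1 : ℕ) * y) + Real.cos (n * y)) := by
  obtain ⟨z, hz⟩ : ∃ z : ℝ, z = n * y + y / 2 := ⟨_, rfl⟩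
  have h1 : ((n + 1 : ℕ) : ℝ) * y = z + y / 2 := by rw [hz]; push_cast; ring
  have h2 : (n : ℝ) * y = z - y / 2 := by rw [hz]; ring
  rw [h1, h2, Real.sin_add, Real.sin_sub, Real.cos_add, Real.cos_sub, Real.cot_eq_cos_div_sin]
  field_simp
  ring

theorem sin_half_pos {y : ℝ} (hy : y ∈ Ioc 0 π) : 0 < Real.sin (y / 2) :=
  Real.sin_pos_of_pos_of_lt_pi (by linarith [hy.1]) (by linarith [hy.2, Real.pi_pos])

theorem integral_cos_nat_mul (n : ℕ) : ∫ y in (0 : ℝ)..π, Real.cos (n * y) = if n = 0 then π else 0 := by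
  split_ifs with h
  · simp [h]
  · have hn : (n : ℝ) ≠ 0 := by exact_mod_cast h
    rw [intervalIntegral.integral_comp_mul_left (fun x => Real.cos x) hn, integral_cos]
    simp [Real.sin_nat_mul_pi]

/-- In the recursion only the constant cosine, met in the step from 0 to 1, has a nonzero integral.
-/
theorem cot_half_sin_nat (n : ℕ) :
    IntervalIntegrable (fun y => Real.cot (y / 2) * Real.sin (n * y)) volume 0 π ∧
      ∫ y in (0 : ℝ)..π, Real.cot (y / 2) * Real.sin (n * y) = if n = 0 then 0 else π := by
  induction n with
  | zero => simp
  | succ n ih =>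
    have hc : IntervalIntegrable (fun y : ℝ => Real.cos ((n + 1 : ℕ) * y) + Real.cos (n * y))
        volume 0 π := (by fun_prop : Continuous fun y : ℝ =>
          Real.cos ((n + 1 : ℕ) * y) + Real.cos (n * y)).intervalIntegrable _ _
    have e : EqOn (fun y => Real.cot (y / 2) * Real.sin (n * y) +
        (Real.cos ((n + 1 : ℕ) * y) + Real.cos (n * y)))
        (fun y => Real.cot (y / 2) * Real.sin ((n + 1 : ℕ) * y)) (Ioc 0 π) := fun y hy =>
      (cot_half_mul_sin_succ (sin_half_pos hy).ne' n).symm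
    have e' : EqOn (fun y => Real.cot (y / 2) * Real.sin (n * y) +
        (Real.cos ((n + 1 : ℕ) * y) + Real.cos (n * y)))
        (fun y => Real.cot (y / 2) * Real.sin ((n + 1 : ℕ) * y)) (uIoc 0 π) := by
      rw [uIoc_of_le Real.pi_pos.le]; exact e
    refine ⟨(ih.1.add hc).congr e', ?_⟩
    rw [← intervalIntegral.integral_congr_ae (Eventually.of_forall fun y hy => e' hy),
      intervalIntegral.integral_add ih.1 hc, ih.2, intervalIntegral.integral_add
        ((by fun_prop : Continuous fun y : ℝ => Real.cos ((n + 1 : ℕ) * y)).intervalIntegrable _ _)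
        ((by fun_prop : Continuous fun y : ℝ => Real.cos (n * y)).intervalIntegrable _ _),
      integral_cos_nat_mul, integral_cos_nat_mul]
    by_cases hn : n = 0 <;> simp [hn]

theorem integral_cot_half_sin (n : ℤ) :
    ∫ y in (0 : ℝ)..π, Real.cot (y / 2) * Real.sin (n * y) = π * ((n.sign : ℤ) : ℝ) := by
  obtain ⟨m, rfl | rfl⟩ := n.eq_nat_or_neg
  · have h := (cot_half_sin_nat m).2
    rcases eq_or_ne m 0 with rfl | hm
    · simp
    · rw [if_neg hm] at h
      rw [Int.sign_eq_one_of_pos (by omega)]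
      simpa using h
  · have h := (cot_half_sin_nat m).2
    rcases eq_or_ne m 0 with rfl | hm
    · simp
    · rw [if_neg hm] at h
      rw [Int.sign_eq_neg_one_of_neg (by omega)]
      push_cast
      simp only [neg_mul, Real.sin_neg, mul_neg]
      rw [intervalIntegral.integral_neg, h, mul_one]

theorem abs_sin_le_rpow (x : ℝ) : |Real.sin x| ≤ |x| ^ (1 / 4 : ℝ) := by
  rcases le_total |x| 1 with h | h
  · refine Real.abs_sin_le_abs.trans ?_
    conv_lhs => rw [← Real.rpow_one |x|]
    exact Real.rpow_le_rpow_of_exponent_ge' (abs_nonneg x) h (by norm_num) (by norm_num)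
  · exact (Real.abs_sin_le_one x).trans (Real.one_le_rpow h (by norm_num))

theorem abs_cot_half_le {y : ℝ} (hy : y ∈ Ioc 0 π) : |Real.cot (y / 2)| ≤ 2 * y⁻¹ := by
  have hs := sin_half_pos hy
  have hc : 0 ≤ Real.cos (y / 2) :=
    Real.cos_nonneg_of_neg_pi_div_two_le_of_le (by linarith [hy.1, Real.pi_pos]) (by linarith [hy.2])
  rw [Real.cot_eq_cos_div_sin, abs_of_nonneg (div_nonneg hc hs.le), div_le_iff₀ hs]
  rcases eq_or_lt_of_le hy.2 with h | h
  · rw [h, Real.cos_pi_div_two, Real.sin_pi_div_two]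
    have := Real.pi_pos
    positivity
  · have h1 := Real.le_tan (x := y / 2) (by linarith [hy.1]) (by linarith)
    have hc' : 0 < Real.cos (y / 2) :=
      Real.cos_pos_of_mem_Ioo ⟨by linarith [hy.1, Real.pi_pos], by linarith⟩
    rw [Real.tan_eq_sin_div_cos, le_div_iff₀ hc'] at h1
    have hy0 := hy.1
    rw [← div_eq_mul_inv, div_mul_eq_mul_div, le_div_iff₀ hy0]
    linarith

/-- The exponent `1/4` is a compromise: being positive, it makes the singularity at 0 integrable,
and being below `1/2`, it is summable against the coefficients of an `H¹` function. -/
theorem abs_cot_half_mul_sin_le {y : ℝ} (hy : y ∈ Ioc 0 π) (n : ℤ) :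
    |Real.cot (y / 2) * Real.sin (n * y)| ≤ 2 * |(n : ℝ)| ^ (1 / 4 : ℝ) * y ^ (-(3 / 4) : ℝ) := by
  rw [abs_mul]
  have h1 := abs_sin_le_rpow (n * y)
  rw [abs_mul, abs_of_pos hy.1, Real.mul_rpow (abs_nonneg _) hy.1.le] at h1
  have h2 := mul_le_mul (abs_cot_half_le hy) h1 (abs_nonneg _) (by have := hy.1; positivity)
  refine h2.trans (le_of_eq ?_)
  have h3 : y ^ (-(3 / 4) : ℝ) = y⁻¹ * y ^ (1 / 4 : ℝ) := by
    rw [← Real.rpow_neg_one, ← Real.rpow_add hy.1]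
    norm_num
  rw [h3]
  ring

theorem eS_sub_eS (n : ℤ) (θ y : ℝ) :
    (eS n).1 ((θ - y : ℝ) : Torus) - (eS n).1 ((θ + y : ℝ) : Torus) =
      -2 * Real.sin (n * y) * (eS (-n)).1 (θ : Torus) := by
  rw [eS_coe, eS_coe, eS_coe, mul_sub (n : ℝ), mul_add (n : ℝ), Real.cos_add, Real.cos_sub, Real.sin_add,
    Real.sin_sub]
  push_cast
  rw [neg_mul (n : ℝ), Real.cos_neg, Real.sin_neg]
  ring

end Kernel

section Fold

variable (φ : C(Torus, ℝ))

/-- The folded integrand of the principal value integral. -/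
def foldCot (θ y : ℝ) : ℝ :=
  Real.cot (y / 2) * (φ ((θ - y : ℝ) : Torus) - φ ((θ + y : ℝ) : Torus))

theorem measurable_cot : Measurable Real.cot := by
  have e : Real.cot = fun x => Real.cos x / Real.sin x := funext Real.cot_eq_cos_div_sin
  rw [e]
  fun_prop

theorem continuous_coe_torus : Continuous fun θ : ℝ => (θ : Torus) :=
  AddCircle.continuous_mk' (2 * π)

theorem norm_coe_torus {y : ℝ} (hy : |y| ≤ π) : ‖(y : Torus)‖ = |y| :=
  (AddCircle.norm_coe_eq_abs_iff (2 * π) Real.two_pi_pos.ne').2 (by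
    rw [abs_of_pos Real.two_pi_pos]; linarith)

theorem cot_add_pi (x : ℝ) : Real.cot (x + π) = Real.cot x := by
  rw [Real.cot_eq_cos_div_sin, Real.cot_eq_cos_div_sin, Real.cos_add_pi, Real.sin_add_pi, neg_div_neg_eq]

theorem cot_neg (x : ℝ) : Real.cot (-x) = -Real.cot x := by
  rw [Real.cot_eq_cos_div_sin, Real.cot_eq_cos_div_sin, Real.cos_neg, Real.sin_neg, div_neg]

/-- The truncated kernel times a translate of `φ`. -/
def truncCot (ε θ y : ℝ) : ℝ :=
  {y : ℝ | ε < ‖(y : Torus)‖}.indicator (fun y => Real.cot (y / 2) * φ ((θ - y : ℝ) : Torus)) y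

theorem measurable_truncCot (ε θ : ℝ) : Measurable (truncCot φ ε θ) := by
  refine Measurable.indicator ?_ ?_
  · refine (measurable_cot.comp (measurable_id.div_const 2)).mul ?_
    exact (φ.continuous.comp (continuous_coe_torus.comp (continuous_const.sub continuous_id))).measurable
  · exact (isOpen_lt continuous_const continuous_coe_torus.norm).measurableSet

theorem periodic_truncCot (ε θ : ℝ) : Function.Periodic (truncCot φ ε θ) (2 * π) := by
  intro y
  have h1 : ((y + 2 * π : ℝ) : Torus) = (y : Torus) := AddCircle.coe_add_period (2 * π) y
  have h2 : ((θ - (y + 2 * π) : ℝ) : Torus) = ((θ - y : ℝ) : Torus) := by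
    rw [← AddCircle.coe_add_period (2 * π) (θ - (y + 2 * π))]
    congr 1; ring
  have h3 : Real.cot ((y + 2 * π) / 2) = Real.cot (y / 2) := by
    rw [← cot_add_pi (y / 2)]; congr 1; ring
  unfold truncCot
  simp only [indicator, mem_ofPred, h1, h2, h3]

/-- The substitution `y = θ - ϑ` shifts the interval; periodicity of the truncated integrand shifts
it back. -/
theorem hilbertTrunc_eq (ε θ : ℝ) :
    hilbertTrunc φ ε θ = 1 / (2 * π) * ∫ y in (-π)..π, truncCot φ ε θ y := by
  have h1 : ∫ ϑ in {ϑ : ℝ | ϑ ∈ Ioc (-π) π ∧ ε < ‖((θ - ϑ : ℝ) : Torus)‖},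
      Real.cot ((θ - ϑ) / 2) * φ (ϑ : Torus) = ∫ ϑ in (-π)..π, truncCot φ ε θ (θ - ϑ) := by
    rw [intervalIntegral.integral_of_le (by linarith [Real.pi_pos])]
    have e : {ϑ : ℝ | ϑ ∈ Ioc (-π) π ∧ ε < ‖((θ - ϑ : ℝ) : Torus)‖} =
        Ioc (-π) π ∩ {ϑ : ℝ | ε < ‖((θ - ϑ : ℝ) : Torus)‖} := rfl
    have hm : MeasurableSet {ϑ : ℝ | ε < ‖((θ - ϑ : ℝ) : Torus)‖} :=
      (isOpen_lt continuous_const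
        (continuous_coe_torus.comp (continuous_const.sub continuous_id)).norm).measurableSet
    rw [e, ← setIntegral_indicator hm]
    refine integral_congr_ae (Eventually.of_forall fun ϑ => ?_)
    simp only [truncCot, indicator, mem_ofPred, sub_sub_cancel]
  unfold hilbertTrunc
  rw [h1, intervalIntegral.integral_comp_sub_left]
  congr 1
  have h2 := (periodic_truncCot φ ε θ).intervalIntegral_add_eq (θ - π) (-π)
  rw [show θ - π + 2 * π = θ - -π by ring, show -π + 2 * π = π by ring] at h2
  exact h2

theorem intervalIntegrable_truncCot {ε : ℝ} (hε : 0 < ε) (θ : ℝ) {a b : ℝ} (ha : a ∈ Icc (-π) π)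
    (hb : b ∈ Icc (-π) π) : IntervalIntegrable (truncCot φ ε θ) volume a b := by
  refine intervalIntegrable_iff.2 (Measure.integrableOn_of_bounded (M := 2 * ε⁻¹ * ‖φ‖)
    (by rw [uIoc]; simp) (measurable_truncCot φ ε θ).aestronglyMeasurable ?_)
  refine (ae_restrict_iff' measurableSet_uIoc).2 (Eventually.of_forall fun y hy => ?_)
  have hyπ : |y| ≤ π := by
    have h1 := (uIcc_subset_Icc ha hb) (uIoc_subset_uIcc hy)
    exact abs_le.2 h1
  unfold truncCot
  by_cases h : ε < ‖(y : Torus)‖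
  · have hmem : y ∈ {y : ℝ | ε < ‖(y : Torus)‖} := h
    rw [indicator_of_mem hmem, norm_mul, Real.norm_eq_abs]
    rw [norm_coe_torus hyπ] at h
    have h2 := abs_cot_half_le (y := |y|) ⟨hε.trans h, hyπ⟩
    have h3 : |Real.cot (|y| / 2)| = |Real.cot (y / 2)| := by
      rcases abs_choice y with h | h <;> rw [h]
      rw [neg_div, cot_neg, abs_neg]
    rw [h3] at h2
    have h4 : |y|⁻¹ ≤ ε⁻¹ := inv_anti₀ hε h.le
    refine mul_le_mul (h2.trans (by linarith)) (φ.norm_coe_le_norm _) (norm_nonneg _) (by positivity)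
  · have hmem : y ∉ {y : ℝ | ε < ‖(y : Torus)‖} := h
    rw [indicator_of_notMem hmem, norm_zero]
    positivity

/-- The cotangent is odd, so the halves `y < 0` and `y > 0` combine into a difference of `φ` that
tames the singularity. -/
theorem hilbertTrunc_eq_fold {ε : ℝ} (hε : 0 < ε) (hεπ : ε ≤ π) (θ : ℝ) :
    hilbertTrunc φ ε θ = 1 / (2 * π) * ∫ y in ε..π, foldCot φ θ y := by
  have hπ := Real.pi_pos
  have m0 : (0 : ℝ) ∈ Icc (-π) π := ⟨by linarith, hπ.le⟩
  have mπ : π ∈ Icc (-π) π := ⟨by linarith, le_rfl⟩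
  have mπ' : -π ∈ Icc (-π) π := ⟨le_rfl, by linarith⟩
  have i1 := intervalIntegrable_truncCot φ hε θ mπ' m0
  have i2 := intervalIntegrable_truncCot φ hε θ m0 mπ
  have i3 : IntervalIntegrable (fun y => truncCot φ ε θ (-y)) volume 0 π := by
    simpa using (IntervalIntegrable.iff_comp_neg (f := truncCot φ ε θ)).1 i1.symm
  rw [hilbertTrunc_eq, ← intervalIntegral.integral_add_adjacent_intervals i1 i2]
  congr 1
  have e1 : ∫ y in (-π)..0, truncCot φ ε θ y = ∫ y in (0 : ℝ)..π, truncCot φ ε θ (-y) := by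
    rw [intervalIntegral.integral_comp_neg, neg_zero]
  rw [e1, ← intervalIntegral.integral_add i3 i2, intervalIntegral.integral_of_le hπ.le,
    intervalIntegral.integral_of_le hεπ]
  have e2 : Ioc ε π = Ioc 0 π ∩ Ioi ε := by
    ext y; simp only [mem_Ioc, mem_inter_iff, mem_Ioi]
    exact ⟨fun h => ⟨⟨hε.trans h.1, h.2⟩, h.1⟩, fun h => ⟨h.2, h.1.2⟩⟩
  rw [e2, ← setIntegral_indicator measurableSet_Ioi]
  refine setIntegral_congr_fun measurableSet_Ioc fun y hy => ?_
  have h1 : ‖(y : Torus)‖ = y := by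
    rw [norm_coe_torus (by rw [abs_of_pos hy.1]; exact hy.2), abs_of_pos hy.1]
  have h2 : ‖((-y : ℝ) : Torus)‖ = y := by
    rw [norm_coe_torus (by rw [abs_neg, abs_of_pos hy.1]; exact hy.2), abs_neg, abs_of_pos hy.1]
  simp only [truncCot, indicator, mem_ofPred, h1, h2, mem_Ioi, foldCot, sub_neg_eq_add]
  split_ifs
  · rw [neg_div, cot_neg]; ring
  · simp

end Fold

/-! ### Fourier series of `H¹` functions, principal values and velocities. -/

/-- A continuous function with absolutely summable coefficients is the sum of its Fourier series. -/
theorem hasSum_coef_cL {φ : C(Torus, ℝ)} (h : Summable fun n => |coef n (cL φ)|) :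
    HasSum (fun n => coef n (cL φ) • (eS n).1) φ := by
  have h1 : Summable fun n => coef n (cL φ) • (eS n).1 := by
    refine Summable.of_norm_bounded h fun n => ?_
    rw [norm_smul, Real.norm_eq_abs]
    exact mul_le_of_le_one_right (abs_nonneg _) (norm_eS_le n)
  have h2 : ∑' n, coef n (cL φ) • (eS n).1 = φ := by
    refine cL_injective ((h1.hasSum.mapL cL).unique ?_)
    have h3 : ∀ n, cL (coef n (cL φ) • (eS n).1) = coef n (cL φ) • e n := fun n => by
      rw [map_smul]; rfl
    simp only [h3]
    exact hasSum_coef (cL φ)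
  rw [← h2]
  simpa only [h2] using h1.hasSum

theorem hasSum_coef_apply {φ : C(Torus, ℝ)} (h : Summable fun n => |coef n (cL φ)|) (x : Torus) :
    HasSum (fun n => coef n (cL φ) * (eS n).1 x) (φ x) :=
  (hasSum_coef_cL h).mapL (ContinuousMap.evalCLM ℝ x)

theorem summable_abs_coef_neg {f : L2} (h : Summable fun n => |coef n f|) :
    Summable fun n : ℤ => |coef (-n) f| :=
  (Equiv.neg ℤ).summable_iff.2 h

theorem abs_eS_le (n : ℤ) (x : Torus) : |(eS n).1 x| ≤ 1 :=
  ((eS n).1.norm_coe_le_norm x).trans (norm_eS_le n)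

section

variable {k : ℕ} (hk : 1 ≤ k) (v : Hk k)

/-- Cauchy–Schwarz with the coefficients of the derivative: the remaining weight `|n|^(-3/4)` is
square-summable. -/
theorem summable_rpow_mul_coef {k : ℕ} (hk : 1 ≤ k) (v : Hk k) :
    Summable fun n : ℤ => |(n : ℝ)| ^ (1 / 4 : ℝ) * |coef n v.val| := by
  have hm : Summable fun n : ℤ => (|((-n : ℤ) : ℝ)| ^ (-(3 / 4) : ℝ)) ^ 2 := by
    have h := Real.summable_abs_int_rpow (b := 3 / 2) (by norm_num)
    refine h.congr fun n => ?_
    rw [← Real.rpow_mul_natCast (abs_nonneg _)]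
    push_cast
    rw [abs_neg]
    norm_num
  have h := (summable_mul_coef_and_le hm (v.wderiv 1 hk)).1
  rw [← (Equiv.neg ℤ).summable_iff] at h
  refine h.congr fun n => ?_
  have h3 : coef (-n) (v.wderiv 1 hk) = -((-n : ℤ) : ℝ) * coef (- -n) v.val :=
    (v.hasWeakDeriv (j := 0) hk).coef_eq (-n)
  simp only [Function.comp_apply, Equiv.neg_apply, neg_neg]
  rw [h3, neg_neg, abs_mul, abs_of_nonneg (Real.rpow_nonneg (abs_nonneg _) _)]
  push_cast
  rw [neg_neg, ← mul_assoc]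
  congr 1
  rcases eq_or_ne n 0 with rfl | hn
  · simp
  · have hn' : 0 < |(n : ℝ)| := abs_pos.2 (by exact_mod_cast hn)
    nth_rewrite 2 [← Real.rpow_one |(n : ℝ)|]
    rw [← Real.rpow_add hn']
    norm_num

theorem summable_abs_coef {k : ℕ} (hk : 1 ≤ k) (v : Hk k) :
    Summable fun n : ℤ => |coef n v.val| := by
  have h := (summable_rpow_mul_coef hk v).add
    (hasSum_ite_eq (0 : ℤ) |coef 0 v.val|).summable
  refine Summable.of_nonneg_of_le (fun n => abs_nonneg _) (fun n => ?_) h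
  rcases eq_or_ne n 0 with rfl | hn
  · simp
  · have hn' : (1 : ℝ) ≤ |(n : ℝ)| := by exact_mod_cast Int.one_le_abs hn
    rw [if_neg hn, add_zero]
    exact le_mul_of_one_le_left (abs_nonneg _) (Real.one_le_rpow hn' (by norm_num))

theorem hasSum_ev (x : Torus) : HasSum (fun n => coef n v.val * (eS n).1 x) (ev hk v x) := by
  have h := hasSum_coef_apply (φ := ev hk v) (by rw [cL_ev]; exact summable_abs_coef hk v) x
  rwa [cL_ev] at h

theorem abs_sign_le (n : ℤ) : |((n.sign : ℤ) : ℝ)| ≤ 1 :=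
  (sq_le_one_iff_abs_le_one _).1 (sign_sq_le n)

theorem hasSum_evH (x : Torus) :
    HasSum (fun n : ℤ => -((n.sign : ℤ) : ℝ) * coef n v.val * (eS (-n)).1 x) (evH hk v x) := by
  have hs : Summable fun n => |coef n (cL (evH hk v))| := by
    refine Summable.of_nonneg_of_le (fun n => abs_nonneg _) (fun n => ?_)
      (summable_abs_coef_neg (summable_abs_coef hk v))
    rw [cL_evH, coef_hilbert, abs_mul]
    exact mul_le_of_le_one_left (abs_nonneg _) (abs_sign_le n)
  have h := hasSum_coef_apply hs x
  rw [← (Equiv.neg ℤ).hasSum_iff] at h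
  refine h.congr_fun fun n => ?_
  simp only [Function.comp_apply, Equiv.neg_apply]
  rw [cL_evH, coef_hilbert, neg_neg, Int.sign_neg]
  push_cast
  ring

theorem hasSum_foldCot (θ y : ℝ) :
    HasSum (fun n : ℤ => coef n v.val * (-2 * (eS (-n)).1 (θ : Torus)) *
      (Real.cot (y / 2) * Real.sin (n * y))) (foldCot (ev hk v) θ y) := by
  have h := ((hasSum_ev hk v ((θ - y : ℝ) : Torus)).sub
    (hasSum_ev hk v ((θ + y : ℝ) : Torus))).mul_left (Real.cot (y / 2))
  refine h.congr_fun fun n => ?_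
  rw [← mul_sub, eS_sub_eS]
  ring

/-- The integrable function dominating the terms of the Fourier series of `foldCot`. -/
def foldBound (n : ℤ) (y : ℝ) : ℝ :=
  4 * (|(n : ℝ)| ^ (1 / 4 : ℝ) * |coef n v.val|) * y ^ (-(3 / 4) : ℝ)

theorem foldCot_term_le (θ : ℝ) {y : ℝ} (hy : y ∈ Ioc 0 π) (n : ℤ) :
    ‖coef n v.val * (-2 * (eS (-n)).1 (θ : Torus)) * (Real.cot (y / 2) * Real.sin (n * y))‖ ≤
      foldBound v n y := by
  rw [norm_mul, norm_mul, norm_mul, Real.norm_eq_abs, Real.norm_eq_abs, Real.norm_eq_abs,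
    Real.norm_eq_abs, foldBound]
  have h1 := abs_cot_half_mul_sin_le hy n
  have h2 := abs_eS_le (-n) (θ : Torus)
  have h3 : |(-2 : ℝ)| = 2 := by norm_num
  have h4 : 0 ≤ y ^ (-(3 / 4) : ℝ) := Real.rpow_nonneg hy.1.le _
  rw [h3]
  calc |coef n v.val| * (2 * |(eS (-n)).1 (θ : Torus)|) * |Real.cot (y / 2) * Real.sin (n * y)|
      ≤ |coef n v.val| * (2 * 1) * (2 * |(n : ℝ)| ^ (1 / 4 : ℝ) * y ^ (-(3 / 4) : ℝ)) := by gcongr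
    _ = _ := by ring

theorem integrableOn_tsum_foldBound :
    IntegrableOn (fun y => ∑' n, foldBound v n y) (Ioc 0 π) := by
  have h1 : ∀ y, ∑' n, foldBound v n y =
      (∑' n : ℤ, 4 * (|(n : ℝ)| ^ (1 / 4 : ℝ) * |coef n v.val|)) * y ^ (-(3 / 4) : ℝ) := fun y =>
    tsum_mul_right
  simp only [h1]
  refine Integrable.const_mul ?_ _
  exact (intervalIntegrable_iff_integrableOn_Ioc_of_le Real.pi_pos.le).1
    (intervalIntegral.intervalIntegrable_rpow' (by norm_num))

theorem summable_foldBound {k : ℕ} (hk : 1 ≤ k) (v : Hk k) (y : ℝ) : Summable fun n => foldBound v n y :=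
  ((summable_rpow_mul_coef hk v).mul_left 4).mul_right _

theorem measurable_foldCot (φ : C(Torus, ℝ)) (θ : ℝ) : Measurable (foldCot φ θ) := by
  refine (measurable_cot.comp (measurable_id.div_const 2)).mul (Measurable.sub ?_ ?_)
  · exact (φ.continuous.comp (continuous_coe_torus.comp (continuous_const.sub continuous_id))).measurable
  · exact (φ.continuous.comp (continuous_coe_torus.comp (continuous_const.add continuous_id))).measurable

theorem integrableOn_foldCot (θ : ℝ) : IntegrableOn (foldCot (ev hk v) θ) (Ioc 0 π) := by
  refine Integrable.mono' (integrableOn_tsum_foldBound v)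
    (measurable_foldCot _ θ).aestronglyMeasurable ?_
  refine (ae_restrict_iff' measurableSet_Ioc).2 (Eventually.of_forall fun y hy => ?_)
  rw [← (hasSum_foldCot hk v θ y).tsum_eq]
  exact tsum_of_norm_bounded (summable_foldBound hk v y).hasSum fun n => foldCot_term_le v θ hy n

/-- Termwise integration of the Fourier series, justified by `foldBound`; each mode contributes `π
sign n`, which reproduces the Hilbert multiplier. -/
theorem integral_foldCot (θ : ℝ) :
    ∫ y in (0 : ℝ)..π, foldCot (ev hk v) θ y = 2 * π * evH hk v (θ : Torus) := by
  have h := hasSum_integral_of_dominated_convergence (μ := volume.restrict (Ioc 0 π))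
    (F := fun n y => coef n v.val * (-2 * (eS (-n)).1 (θ : Torus)) *
      (Real.cot (y / 2) * Real.sin (n * y))) (f := foldCot (ev hk v) θ) (foldBound v)
    (fun n => by
      refine (Measurable.const_mul ?_ _).aestronglyMeasurable
      exact (measurable_cot.comp (measurable_id.div_const 2)).mul (by fun_prop))
    (fun n => (ae_restrict_iff' measurableSet_Ioc).2
      (Eventually.of_forall fun y hy => foldCot_term_le v θ hy n))
    (Eventually.of_forall fun y => summable_foldBound hk v y) (integrableOn_tsum_foldBound v)
    (Eventually.of_forall fun y => hasSum_foldCot hk v θ y)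
  rw [intervalIntegral.integral_of_le Real.pi_pos.le]
  refine h.unique (((hasSum_evH hk v θ).mul_left (2 * π)).congr_fun fun n => ?_)
  have h1 := integral_cot_half_sin n
  rw [intervalIntegral.integral_of_le Real.pi_pos.le] at h1
  rw [integral_const_mul, h1]
  ring

/-- The principal value integral of an `H¹` function converges everywhere. -/
theorem isHilbertTransform_evH : IsHilbertTransform v.val fun θ => evH hk v (θ : Torus) := by
  intro θ
  have hπ := Real.pi_pos
  have hc := intervalIntegral.continuousOn_primitive_interval_left (a := 0) (b := π)
    (f := foldCot (ev hk v) θ) (μ := volume) (by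
      rw [uIcc_of_le hπ.le, integrableOn_Icc_iff_integrableOn_Ioc]
      exact integrableOn_foldCot hk v θ)
  have h1 := (hc 0 left_mem_uIcc).tendsto
  have hle : 𝓝[>] (0 : ℝ) ≤ 𝓝[uIcc 0 π] 0 := nhdsWithin_le_of_mem (by
    rw [uIcc_of_le hπ.le]
    exact Icc_mem_nhdsGT hπ)
  have h2 := (h1.mono_left hle).const_mul (1 / (2 * π))
  rw [integral_foldCot] at h2
  have e : 1 / (2 * π) * (2 * π * evH hk v (θ : Torus)) = evH hk v (θ : Torus) := by
    field_simp
  rw [e] at h2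
  refine h2.congr' ?_
  have hae : (v.val : Torus → ℝ) =ᵐ[volume] ev hk v := by
    have := coeFn_cL (ev hk v)
    rwa [cL_ev] at this
  filter_upwards [Ioc_mem_nhdsGT hπ] with ε hε
  rw [hilbertTrunc_congr_ae hae, hilbertTrunc_eq_fold _ hε.1 hε.2]

theorem hasDerivAt_eS (n : ℤ) (θ : ℝ) :
    HasDerivAt (fun s : ℝ => (eS n).1 (s : Torus)) (n * (eS (-n)).1 (θ : Torus)) θ := by
  have h := SF.hasDerivAt (eS n) θ
  rw [D_eS] at h
  exact h

/-- Termwise differentiation is legitimate since the differentiated series is dominated by the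
summable `|coef n v.val|`. -/
theorem isVelocity_vel :
    IsVelocity (fun θ => evH hk v (θ : Torus)) fun θ => vel v.val (θ : Torus) := by
  have e1 : ∀ x : Torus, vel v.val x = absInv v.val 0 - absInv v.val x := fun x => by
    rw [vel_apply]; simp
  refine ⟨(e1 _).trans (sub_self _), fun θ => ?_⟩
  have e2 : (fun θ : ℝ => vel v.val (θ : Torus)) = fun θ : ℝ => absInv v.val 0 -
      ∑' n : ℤ, |(n : ℝ)|⁻¹ * coef n v.val * (eS n).1 (θ : Torus) := funext fun θ => by
    rw [e1]
    congr 1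
    exact ((hasSum_multiplier summable_inv_abs_sq (Equiv.refl ℤ) v.val).mapL
      (ContinuousMap.evalCLM ℝ (θ : Torus))).tsum_eq.symm
  have hd : ∀ (n : ℤ) (θ : ℝ), HasDerivAt
      (fun s : ℝ => |(n : ℝ)|⁻¹ * coef n v.val * (eS n).1 (s : Torus))
      (((n.sign : ℤ) : ℝ) * coef n v.val * (eS (-n)).1 (θ : Torus)) θ := fun n θ => by
    refine ((hasDerivAt_eS n θ).const_mul (|(n : ℝ)|⁻¹ * coef n v.val)).congr_deriv ?_
    rw [← mul_inv_abs_eq_sign]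
    ring
  have h := hasDerivAt_tsum (summable_abs_coef hk v) hd (fun n y => by
    rw [norm_mul, norm_mul, Real.norm_eq_abs, Real.norm_eq_abs, Real.norm_eq_abs]
    have h1 := abs_sign_le n
    have h2 := abs_eS_le (-n) (y : Torus)
    calc _ ≤ 1 * |coef n v.val| * 1 := by gcongr
      _ = _ := by ring) (y₀ := 0) (((hasSum_multiplier summable_inv_abs_sq (Equiv.refl ℤ) v.val).mapL
      (ContinuousMap.evalCLM ℝ ((0 : ℝ) : Torus))).summable) θ
  rw [e2]
  refine ((hasDerivAt_const θ _).sub h).congr_deriv ?_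
  rw [zero_sub, ← tsum_neg]
  refine Eq.trans ?_ (hasSum_evH hk v θ).tsum_eq
  refine tsum_congr fun n => ?_
  ring

end

/-! ### Equivalence of the pointwise equations with the abstract one. -/

theorem IsVelocity.eq {h u w : ℝ → ℝ} (hu : IsVelocity h u) (hw : IsVelocity h w) : u = w := by
  funext θ
  have hd : ∀ s, HasDerivAt (fun s => u s - w s) 0 s := fun s => by
    have := (hu.2 s).sub (hw.2 s)
    rwa [sub_self] at this
  have h := is_const_of_deriv_eq_zero (f := fun s => u s - w s)
    (fun s => (hd s).differentiableAt) (fun s => (hd s).deriv) θ 0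
  simp only [hu.1, hw.1, sub_zero] at h
  exact sub_eq_zero.1 h

theorem IsHilbertTransform.eq {f : Torus → ℝ} {h h' : ℝ → ℝ} (H : IsHilbertTransform f h)
    (H' : IsHilbertTransform f h') : h = h' :=
  funext fun θ => tendsto_nhds_unique (H θ) (H' θ)

/-- Principal values and normalised primitives are unique, so the existential functions in
`Equation` must be `evH` and `vel`; the rest is the passage between null sets of the line and of the
circle. -/
theorem equation_iff (a p q : ℝ) {k : ℕ} (hk : 1 ≤ k) (v w : Hk k) (F : L2) :
    Equation a p q hk v w F ↔ F = rhs a p q hk v w.val := by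
  have key : (∀ᵐ θ : ℝ, F (θ : Torus) + a * vel w.val (θ : Torus) * v.wderiv 1 hk (θ : Torus) =
      p * v.val (θ : Torus) * evH hk w (θ : Torus) + q * w.val (θ : Torus) * evH hk v (θ : Torus)) ↔
      F = rhs a p q hk v w.val := by
    have h0 : (∀ᵐ x : Torus, F x + a * vel w.val x * v.wderiv 1 hk x =
        p * v.val x * evH hk w x + q * w.val x * evH hk v x) ↔ F = rhs a p q hk v w.val := by
      rw [rhs_apply, M_ev_hilbert, Lp.ext_iff]
      set A := M (vel w.val) (v.wderiv 1 hk)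
      set B := M (evH hk w) v.val
      set C := M (evH hk v) w.val
      have hA : A =ᵐ[volume] fun x => vel w.val x * v.wderiv 1 hk x := coeFn_M _ _
      have hB : B =ᵐ[volume] fun x => evH hk w x * v.val x := coeFn_M _ _
      have hC : C =ᵐ[volume] fun x => evH hk v x * w.val x := coeFn_M _ _
      have hsum : ∀ᵐ x, (-a • A + p • B + q • C : L2) x =
          -a * (vel w.val x * v.wderiv 1 hk x) + p * (evH hk w x * v.val x) +
            q * (evH hk v x * w.val x) := by
        filter_upwards [hA, hB, hC, Lp.coeFn_add (-a • A + p • B) (q • C),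
          Lp.coeFn_add (-a • A) (p • B), Lp.coeFn_smul (-a) A, Lp.coeFn_smul p B,
          Lp.coeFn_smul q C] with x h1 h2 h3 h4 h5 h6 h7 h8
        rw [h4, Pi.add_apply, h5, Pi.add_apply, h6, h7, h8, Pi.smul_apply, Pi.smul_apply,
          Pi.smul_apply, h1, h2, h3]
        rfl
      constructor
      · intro h
        filter_upwards [h, hsum] with x h1 h2
        rw [h2]; linarith
      · intro h
        filter_upwards [h, hsum] with x h1 h2
        rw [h1, h2]; ring
    exact ⟨fun h => h0.1 (ae_of_ae_coe h), fun h => ae_coe_of_ae (h0.2 h)⟩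
  rw [← key]
  constructor
  · rintro ⟨Hv, Hw, u, hv, hw, hu, h⟩
    obtain rfl := hv.eq (isHilbertTransform_evH hk v)
    obtain rfl := hw.eq (isHilbertTransform_evH hk w)
    obtain rfl := hu.eq (isVelocity_vel hk w)
    exact h
  · intro h
    exact ⟨_, _, _, isHilbertTransform_evH hk v, isHilbertTransform_evH hk w, isVelocity_vel hk w, h⟩

namespace Pair

theorem continuousOn_iff {E : Type*} [NormedAddCommGroup E] [InnerProductSpace ℝ E]
    {f : ℝ → Pair E} {s : Set ℝ} :
    ContinuousOn f s ↔
      ContinuousOn (fun t => (f t).fst) s ∧ ContinuousOn (fun t => (f t).snd) s :=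
  ⟨fun h => ⟨(WithLp.fstL 2 ℝ E E).continuous.comp_continuousOn h,
    (WithLp.sndL 2 ℝ E E).continuous.comp_continuousOn h⟩,
   fun h t ht => Pair.tendsto (h.1 t ht) (h.2 t ht)⟩

theorem lipschitzOnWith_iff {E : Type*} [NormedAddCommGroup E] {f : ℝ → Pair E} {s : Set ℝ} :
    (∃ K : ℝ≥0, LipschitzOnWith K f s) ↔ (∃ K : ℝ≥0, LipschitzOnWith K (fun t => (f t).fst) s) ∧
      ∃ K : ℝ≥0, LipschitzOnWith K (fun t => (f t).snd) s := by
  constructor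
  · rintro ⟨K, hK⟩
    refine ⟨⟨K, LipschitzOnWith.of_dist_le_mul fun x hx y hy => ?_⟩,
      ⟨K, LipschitzOnWith.of_dist_le_mul fun x hx y hy => ?_⟩⟩
    · have h := hK.dist_le_mul x hx y hy
      rw [dist_eq_norm] at h ⊢
      exact (norm_fst_le (f x - f y)).trans h
    · have h := hK.dist_le_mul x hx y hy
      rw [dist_eq_norm] at h ⊢
      exact (norm_snd_le (f x - f y)).trans h
  · rintro ⟨⟨K, hK⟩, ⟨K', hK'⟩⟩
    refine ⟨K + K', LipschitzOnWith.of_dist_le_mul fun x hx y hy => ?_⟩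
    have h := hK.dist_le_mul x hx y hy
    have h' := hK'.dist_le_mul x hx y hy
    have h1 := norm_le_add (f x - f y)
    rw [dist_eq_norm] at h h' ⊢
    rw [WithLp.sub_fst, WithLp.sub_snd] at h1
    push_cast
    linarith

theorem hasDerivWithinAt_iff {E : Type*} [NormedAddCommGroup E] [InnerProductSpace ℝ E]
    {f : ℝ → Pair E} {f' : Pair E} {s : Set ℝ} {t : ℝ} :
    HasDerivWithinAt f f' s t ↔ HasDerivWithinAt (fun t => (f t).fst) f'.fst s t ∧
      HasDerivWithinAt (fun t => (f t).snd) f'.snd s t := by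
  constructor
  · intro h
    exact ⟨(WithLp.fstL 2 ℝ E E).hasFDerivAt.comp_hasDerivWithinAt t h,
      (WithLp.sndL 2 ℝ E E).hasFDerivAt.comp_hasDerivWithinAt t h⟩
  · intro h
    exact ((WithLp.prodContinuousLinearEquiv 2 ℝ E E).symm.toContinuousLinearMap.hasFDerivAt
      (x := ((f t).fst, (f t).snd))).comp_hasDerivWithinAt t (h.1.prodMk h.2)

end Pair

variable {a p q : ℝ} {k : ℕ} {hk : 1 ≤ k}

theorem isSolution_iff {ω₀p ω₀m : Hk k} {T : ℝ} {ωp ωm : ℝ → Hk k} :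
    IsSolution a p q hk ω₀p ω₀m T ωp ωm ↔
      (system a p q hk).IsSol (WithLp.toLp 2 (ω₀p, ω₀m)) T fun t => WithLp.toLp 2 (ωp t, ωm t) := by
  constructor
  · intro h
    refine ⟨Pair.continuousOn_iff.2 ⟨h.inClass_plus.1, h.inClass_minus.1⟩,
      Pair.lipschitzOnWith_iff.2 ⟨h.inClass_plus.2, h.inClass_minus.2⟩, ?_, fun t ht => ?_⟩
    · exact Pair.ext h.init_plus h.init_minus
    · obtain ⟨F, hF, eF⟩ := h.eq_plus t ht
      obtain ⟨F', hF', eF'⟩ := h.eq_minus t ht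
      rw [equation_iff] at eF eF'
      rw [system_B]
      exact Pair.hasDerivWithinAt_iff.2 ⟨eF ▸ hF, eF' ▸ hF'⟩
  · intro h
    obtain ⟨hcp, hcm⟩ := Pair.continuousOn_iff.1 h.cont
    obtain ⟨hlp, hlm⟩ := Pair.lipschitzOnWith_iff.1 h.lip
    have hd := fun t ht => Pair.hasDerivWithinAt_iff.1 (h.deriv t ht)
    simp only [system_B] at hd
    exact ⟨⟨hcp, hlp⟩, ⟨hcm, hlm⟩, congrArg WithLp.fst h.init, congrArg WithLp.snd h.init,
      fun t ht => ⟨_, (hd t ht).1, (equation_iff a p q hk _ _ _).2 rfl⟩,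
      fun t ht => ⟨_, (hd t ht).2, (equation_iff a p q hk _ _ _).2 rfl⟩⟩

theorem limsup_eq_top_of_frequently {f : ℝ → ℝ} {l : Filter ℝ} (h : ∀ M : ℝ, ∃ᶠ t in l, M < f t) :
    limsup (fun t => (f t : EReal)) l = ⊤ := by
  refine EReal.eq_top_iff_forall_lt _ |>.2 fun M => ?_
  refine lt_of_lt_of_le (b := ((M + 1 : ℝ) : EReal)) (by exact_mod_cast lt_add_one M) ?_
  exact le_limsup_of_frequently_le ((h (M + 1)).mono fun t ht => by exact_mod_cast ht.le)

end MHD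

end

theorem mainTheorem3 (a p q : ℝ) (k : ℕ) (hk : 1 ≤ k) :
    ∃ C : ℝ, 0 < C ∧ ∀ ω₀p ω₀m : MHD.Hk k,
      -- local existence and uniqueness, for times `T` below `C / E(0)`
      (∀ T : ℝ, 0 < T → T * Real.sqrt (‖ω₀p‖ ^ 2 + ‖ω₀m‖ ^ 2) < C →
        ∃ ωp ωm : ℝ → MHD.Hk k, MHD.IsSolution a p q hk ω₀p ω₀m T ωp ωm ∧
          ∀ ωp' ωm' : ℝ → MHD.Hk k, MHD.IsSolution a p q hk ω₀p ω₀m T ωp' ωm' →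
            Set.EqOn ωp' ωp (Set.Ico 0 T) ∧ Set.EqOn ωm' ωm (Set.Ico 0 T)) ∧
      -- the maximal solution and the blow-up alternative
      ∃ (Tstar : EReal) (ωp ωm : ℝ → MHD.Hk k), 0 < Tstar ∧
        MHD.IsSolutionUpTo a p q hk ω₀p ω₀m Tstar ωp ωm ∧
        (∀ (S : EReal) (ωp' ωm' : ℝ → MHD.Hk k),
          MHD.IsSolutionUpTo a p q hk ω₀p ω₀m S ωp' ωm' → S ≤ Tstar ∧
            ∀ t : ℝ, 0 ≤ t → (t : EReal) < S → ωp' t = ωp t ∧ ωm' t = ωm t) ∧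
        (Tstar = ⊤ ∨ ∃ τ : ℝ, Tstar = (τ : EReal) ∧
          Filter.limsup (fun t => ((‖ωp t‖ + ‖ωm t‖ : ℝ) : EReal))
            (nhdsWithin τ (Set.Iio τ)) = ⊤) := by
  obtain ⟨C, hC, h⟩ := (MHD.system a p q hk).wellPosed
  refine ⟨C, hC, fun ω₀p ω₀m => ?_⟩
  obtain ⟨hloc, Tstar, y, hpos, hsol, hmax, hblow⟩ := h (WithLp.toLp 2 (ω₀p, ω₀m))
  refine ⟨fun T hT hTC => ?_, Tstar, fun t => (y t).fst, fun t => (y t).snd, hpos,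
    fun T hT hTS => MHD.isSolution_iff.2 (hsol T hT hTS), fun S ωp' ωm' hS => ?_, ?_⟩
  · have hn : ‖(WithLp.toLp 2 (ω₀p, ω₀m) : MHD.Pair (MHD.Hk k))‖ =
        Real.sqrt (‖ω₀p‖ ^ 2 + ‖ω₀m‖ ^ 2) := WithLp.prod_norm_eq_of_L2 _
    obtain ⟨z, hz, hu⟩ := hloc T hT (by rw [hn]; exact hTC)
    refine ⟨fun t => (z t).fst, fun t => (z t).snd, MHD.isSolution_iff.2 hz,
      fun ωp' ωm' h' => ⟨fun t ht => ?_, fun t ht => ?_⟩⟩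
    · exact congrArg WithLp.fst (hu _ (MHD.isSolution_iff.1 h') ht)
    · exact congrArg WithLp.snd (hu _ (MHD.isSolution_iff.1 h') ht)
  · obtain ⟨h1, h2⟩ := hmax S (fun t => WithLp.toLp 2 (ωp' t, ωm' t))
      fun T hT hTS => MHD.isSolution_iff.1 (hS T hT hTS)
    exact ⟨h1, fun t ht htS =>
      ⟨congrArg WithLp.fst (h2 t ht htS), congrArg WithLp.snd (h2 t ht htS)⟩⟩
  · refine hblow.imp_right fun ⟨τ, hτ, hf⟩ => ⟨τ, hτ, ?_⟩
    -- The abstract alternative concerns the `ℓ²` norm of the pair, which is at most the sum of the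
    -- two norms.
    exact MHD.limsup_eq_top_of_frequently fun M => (hf M).mono fun t ht =>
      ht.trans_le (MHD.Pair.norm_le_add (y t))
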